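/- **Setting.** Inputs and outputs are real. A data set $D=(\mathbf x,\mathbf y)$ is a finite (possibly empty) tuple of observations $(x_i,y_i)\in\mathbb R\times\mathbb R$; $\mathcal D=\bigcup_{m\ge0}(\mathbb R\times\mathbb R)^m$ carries the disjoint-union topology. A collection $\tilde{\mathcal D}\subseteq\mathcal D$ is *bounded* if $\sup_{(\mathbf x,\mathbf y)\in\tilde{\mathcal D}}\sum_i\max(|y_i|,1)<\infty$. Laws of processes are probability measures on $\mathbb R^{\mathbb R}$ with the cylindrical $\sigma$-algebra, and $P_{\mathbf x}\mu$ is the law of $(f(x_1),\dots,f(x_n))$ for $f\sim\mu$. A process (or its law) is *noisy with noise variance* $\sigma^2>0$ if it is a sum $f_s+f_n$ of two independent processes, where $f_s$ is continuous and $(f_n(x_1),\dots,f_n(x_m))\sim\mathcal N(0,\sigma^2I)$ for all distinct $x_1,\dots,x_m$. A *prediction map* is a map $\pi$ from $\mathcal D$ to laws of processes. Let $\overline{\mathcal M}_G^{\mathrm{f.d.d.}}$ be the set of prediction maps $\pi$ such that every $\pi(D)$ is the law of a noisy Gaussian process (the noise variance may depend on $D$) and such that $D_i\to D$ implies the weak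 convergence $P_{\mathbf x}\pi(D_i)\rightharpoonup P_{\mathbf x}\pi(D)$ for every finite tuple $\mathbf x$ of inputs. Let $f=f_s+f_n$ be a noisy process with noise variance $\sigma^2>0$. Its *posterior prediction map* $\pi_f$ sends $D=(\mathbf x,\mathbf y)$ to the law of $f_{s,D}+\hat f_n$, where $\hat f_n$ is an independent copy of $f_n$ and $f_{s,D}$ has the posterior law of $f_s$ given $D$, that is, the law with density $\mathcal N(\mathbf y;f_s(\mathbf x),\sigma^2I)/\mathbb E[\mathcal N(\mathbf y;f_s(\mathbf x),\sigma^2I)]$ with respect to the law of $f_s$. For a law $\mu$ with finite second moments, $\mathcal{GP}(\mu)$ is the law of the Gaussian process with the mean and covariance functions of $\mu$, and $\mathcal{GP}(\pi_f)(D)=\mathcal{GP}(\pi_f(D))$. For a probability measure $\mu$ and a Gaussian measure $\nu$ on $\mathbb R^n$, the *Gaussian divergence* is $\mathcal G(\mu,\nu)=\mathrm{KL}(\mu,\nu)-\inf_\xi\mathrm{KL}(\mu,\xi)$, the infimum being over all (possibly degenerate) Gaussian measures $\xi$ on $\mathbb R^n$, if this infimum is finite, and $\mathcal G(\mu,\nu)=\infty$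 otherwise. **Proposition.** Let $f=f_s+f_n$ be a noisy process with noise variance $\sigma^2>0$ and $\sup_{x\in\mathbb R}\mathbb E[f(x)^2]<\infty$. Assume that there are $p\ge2$, $\beta\in(\tfrac12,1]$, $c>0$ and $r>0$ with $\|f_s(x)-f_s(y)\|_{L^p}\le c|x-y|^\beta$ whenever $|x-y|<r$. Let $\tilde{\mathcal D}\subseteq\mathcal D$ be open and bounded, let $p(D)$ be a Borel probability distribution with full support on $\tilde{\mathcal D}$, let $n\ge2$, and let $p(\mathbf x)$ be a Borel probability distribution with full support on $\mathbb R^n$. Then: 1. For every $D\in\mathcal D$, the law $\mathcal{GP}(\pi_f(D))$ exists, is unique, and is noisy with noise variance $\sigma^2$. Moreover, $\mathcal{GP}(\pi_f)\in\overline{\mathcal M}_G^{\mathrm{f.d.d.}}$, and the second moments of $\mathcal{GP}(\pi_f)(D)$ are bounded uniformly over $D\in\tilde{\mathcal D}$ and over all inputs. 2. $\mathbb E_{p(D)p(\mathbf x)}[\mathrm{KL}(P_{\mathbf x}\pi_f(D),P_{\mathbf x}\,\mathcal{GP}(\pi_f)(D))]<\infty$. 3. A map $\pi\in\overline{\mathcal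 M}_G^{\mathrm{f.d.d.}}$ minimises $\pi\mapsto\mathbb E_{p(D)p(\mathbf x)}[\mathrm{KL}(P_{\mathbf x}\pi_f(D),P_{\mathbf x}\pi(D))]$ over $\overline{\mathcal M}_G^{\mathrm{f.d.d.}}$ if and only if $\pi(D)=\mathcal{GP}(\pi_f)(D)$ for all $D\in\tilde{\mathcal D}$. 4. A map $\pi\in\overline{\mathcal M}_G^{\mathrm{f.d.d.}}$ minimises $\pi\mapsto\mathbb E_{p(D)p(\mathbf x)}[\mathcal G(P_{\mathbf x}\pi_f(D),P_{\mathbf x}\pi(D))]$ over $\overline{\mathcal M}_G^{\mathrm{f.d.d.}}$ if and only if $\pi(D)=\mathcal{GP}(\pi_f)(D)$ for all $D\in\tilde{\mathcal D}$. -/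

import Mathlib

open MeasureTheory ProbabilityTheory InformationTheory Topology
open scoped NNReal ENNReal

noncomputable section

/-- A data set: a finite (possibly empty) tuple of observations `(x, y)` with input `x : ℝ` and
output `y : ℝ`. The sigma type carries the disjoint union topology, that is the topology of the
extended metric which is Euclidean between data sets of the same size and `∞` otherwise. -/
abbrev DataSet : Type := Σ m : ℕ, (Fin m → ℝ × ℝ)

/-- The `σ`-algebra on data sets is the Borel `σ`-algebra. -/
instance DataSet.borelSpace : BorelSpace DataSet := by
  refine ⟨le_antisymm ?_ ?_⟩
  · intro s hs
    have h : ∀ m, MeasurableSet (Sigma.mk m ⁻¹' s) := fun m =>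
      (MeasurableSpace.measurableSet_iInf.1 hs m : _)
    have hU : s = ⋃ m, Sigma.mk m '' (Sigma.mk m ⁻¹' s) := by
      ext ⟨m, d⟩
      refine ⟨fun h => Set.mem_iUnion.2 ⟨m, d, h, rfl⟩, fun h => ?_⟩
      obtain ⟨k, e, he, hke⟩ := Set.mem_iUnion.1 h
      exact hke ▸ he
    rw [hU]
    refine @MeasurableSet.iUnion _ _ (borel DataSet) _ _ fun m => ?_
    borelize DataSet
    exact (Topology.IsOpenEmbedding.sigmaMk.measurableEmbedding).measurableSet_image' (h m)
  · refine MeasurableSpace.generateFrom_le fun s hs => ?_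
    refine MeasurableSpace.measurableSet_iInf.2 fun m => ?_
    exact (isOpen_sigma_iff.1 hs m).measurableSet

/-- The quantity `∑ i, max |y i| 1` of a data set. -/
def DataSet.size (D : DataSet) : ℝ := ∑ i, max |(D.2 i).2| 1

/-- A collection of data sets is bounded if the supremum over it of `∑ i, max |y i| 1` is finite:
numbers of observations and magnitudes of outputs are bounded, inputs need not be. -/
def IsBoundedCollection (S : Set DataSet) : Prop := BddAbove (DataSet.size '' S)

/-- Projection of a function onto the coordinates `x`. -/
def proj {m : ℕ} (x : Fin m → ℝ) (f : ℝ → ℝ) : Fin m → ℝ := fun i => f (x i)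

theorem measurable_proj {m : ℕ} (x : Fin m → ℝ) : Measurable (proj x) :=
  measurable_pi_lambda _ fun i => measurable_pi_apply (x i)

/-- The finite-dimensional distribution at `x` of the law `μ` of a process, where laws live on the
space `ℝ → ℝ` of all functions with the cylindrical `σ`-algebra. -/
def fdd (μ : ProbabilityMeasure (ℝ → ℝ)) {m : ℕ} (x : Fin m → ℝ) :
    ProbabilityMeasure (Fin m → ℝ) :=
  μ.map (measurable_proj x).aemeasurable

/-- `fs + fn` is a noisy process with smooth part `fs`, noisy part `fn` and noise variance `v`:
`fs` is a continuous process, `fn` has law `𝒩(0, v I)` at any distinct inputs, the two processes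
are independent, and `v > 0`. -/
structure IsNoisyDecomposition {Ω : Type*} [MeasurableSpace Ω] (P : Measure Ω)
    (fs fn : ℝ → Ω → ℝ) (v : ℝ≥0) : Prop where
  measurable_smooth : ∀ t, Measurable (fs t)
  measurable_noise : ∀ t, Measurable (fn t)
  continuous_smooth : ∀ᵐ ω ∂P, Continuous fun t => fs t ω
  noise_law : ∀ (m : ℕ) (x : Fin m → ℝ), Function.Injective x →
    P.map (fun ω i => fn (x i) ω) = Measure.pi fun _ => gaussianReal 0 v
  indep : IndepFun (fun ω t => fs t ω) (fun ω t => fn t ω) P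
  var_pos : 0 < v

/-- The law `μ` is the law of a noisy process with noise variance `v`. -/
def IsNoisyWith (μ : ProbabilityMeasure (ℝ → ℝ)) (v : ℝ≥0) : Prop :=
  ∃ (Ω : Type) (_ : MeasurableSpace Ω) (P : Measure Ω) (_ : IsProbabilityMeasure P)
    (fs fn : ℝ → Ω → ℝ), IsNoisyDecomposition P fs fn v ∧
      P.map (fun ω t => fs t ω + fn t ω) = (μ : Measure (ℝ → ℝ))

/-- The law `μ` is the law of a noisy process. -/
def IsNoisy (μ : ProbabilityMeasure (ℝ → ℝ)) : Prop := ∃ v : ℝ≥0, IsNoisyWith μ v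

/-- The law `μ` is the law of a Gaussian process. -/
def IsGaussianLaw (μ : ProbabilityMeasure (ℝ → ℝ)) : Prop :=
  IsGaussianProcess (fun (t : ℝ) (f : ℝ → ℝ) => f t) (μ : Measure (ℝ → ℝ))

/-- `ν` is the Gaussianisation of `μ`: the mean function and covariance function of `μ` exist, and
`ν` is the law of a Gaussian process with this mean function and covariance function. -/
structure IsGaussianisation (μ ν : ProbabilityMeasure (ℝ → ℝ)) : Prop where
  memLp : ∀ t : ℝ, MemLp (fun f : ℝ → ℝ => f t) 2 (μ : Measure (ℝ → ℝ))
  gaussian : IsGaussianLaw ν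
  mean_eq : ∀ t : ℝ, ∫ f, f t ∂(ν : Measure (ℝ → ℝ)) = ∫ f, f t ∂(μ : Measure (ℝ → ℝ))
  cov_eq : ∀ s t : ℝ,
    covariance (fun f : ℝ → ℝ => f s) (fun f : ℝ → ℝ => f t) (ν : Measure (ℝ → ℝ)) =
      covariance (fun f : ℝ → ℝ => f s) (fun f : ℝ → ℝ => f t) (μ : Measure (ℝ → ℝ))

/-- A prediction map sends data sets to laws of processes. -/
abbrev PredictionMap : Type := DataSet → ProbabilityMeasure (ℝ → ℝ)

/-- Continuity along finite-dimensional distributions: `D_i → D` implies the weak convergence of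
the finite-dimensional distributions of `π D_i` to those of `π D`. -/
def IsContinuousAlongFdds (π : PredictionMap) : Prop :=
  ∀ (m : ℕ) (x : Fin m → ℝ), Continuous fun D => fdd (π D) x

/-- The noisy Gaussian prediction maps that are continuous along their finite-dimensional
distributions. The noise variance of `π D` may depend on `D`. -/
def noisyGaussianMaps : Set PredictionMap :=
  {π | (∀ D, IsNoisy (π D)) ∧ (∀ D, IsGaussianLaw (π D)) ∧ IsContinuousAlongFdds π}

section Posterior

variable {Ω : Type*} [MeasurableSpace Ω]

/-- The Gaussian likelihood `𝒩(y; fs(x), v I)` of the data set `D = (x, y)`. -/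
def likelihood (fs : ℝ → Ω → ℝ) (v : ℝ≥0) (D : DataSet) (ω : Ω) : ℝ≥0∞ :=
  ∏ i, gaussianPDF (fs (D.2 i).1 ω) v (D.2 i).2

/-- `P` reweighted by Bayes' rule: the law of `fs` under `smoothPosterior P fs v D` is the posterior
law of `fs` given noisy observations `D`, with density `𝒩(y; fs(x), v I) / 𝔼[𝒩(y; fs(x), v I)]`
with respect to the law of `fs` under `P`. -/
def smoothPosterior (P : Measure Ω) (fs : ℝ → Ω → ℝ) (v : ℝ≥0) (D : DataSet) : Measure Ω :=
  P.withDensity fun ω => likelihood fs v D ω / ∫⁻ ω', likelihood fs v D ω' ∂P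

theorem measurable_likelihood {fs : ℝ → Ω → ℝ} (hfs : ∀ t, Measurable (fs t)) (v : ℝ≥0)
    (D : DataSet) : Measurable (likelihood fs v D) := by
  refine Finset.measurable_prod _ fun i _ => ?_
  exact measurable_uncurry_gaussianPDF.comp
    ((hfs _).prodMk (measurable_const.prodMk measurable_const))

theorem isProbabilityMeasure_smoothPosterior {P : Measure Ω} [IsProbabilityMeasure P]
    {fs : ℝ → Ω → ℝ} (hfs : ∀ t, Measurable (fs t)) {v : ℝ≥0} (hv : 0 < v) (D : DataSet) :
    IsProbabilityMeasure (smoothPosterior P fs v D) := by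
  have hm := measurable_likelihood hfs v D
  have hpos : ∀ ω, 0 < likelihood fs v D ω := fun ω =>
    pos_iff_ne_zero.2 (Finset.prod_ne_zero_iff.2 fun i _ => (gaussianPDF_pos _ hv.ne' _).ne')
  have h0 : ∫⁻ ω, likelihood fs v D ω ∂P ≠ 0 := by
    rw [Ne, lintegral_eq_zero_iff hm]
    intro h
    obtain ⟨ω, hω⟩ := h.exists
    exact (hpos ω).ne' hω
  have hbound : ∀ ω, likelihood fs v D ω ≤
      ∏ _i : Fin D.1, ENNReal.ofReal ((√(2 * Real.pi * v))⁻¹) := fun ω => by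
    refine Finset.prod_le_prod' fun i _ => ENNReal.ofReal_le_ofReal ?_
    rw [gaussianPDFReal]
    refine mul_le_of_le_one_right (by positivity) (Real.exp_le_one_iff.2 ?_)
    exact div_nonpos_of_nonpos_of_nonneg (neg_nonpos.2 (sq_nonneg _)) (by positivity)
  have htop : ∫⁻ ω, likelihood fs v D ω ∂P ≠ ∞ := by
    refine ne_top_of_le_ne_top ?_ (lintegral_mono hbound)
    rw [lintegral_const, measure_univ, mul_one]
    exact ENNReal.prod_ne_top fun i _ => ENNReal.ofReal_ne_top
  refine ⟨?_⟩
  rw [smoothPosterior, withDensity_apply _ MeasurableSet.univ, setLIntegral_univ]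
  simp only [div_eq_mul_inv]
  rw [lintegral_mul_const _ hm]
  exact ENNReal.mul_inv_cancel h0 htop

/-- The posterior prediction map of the noisy process `fs + fn`: the law, given `D`, of the sum of
the posterior of `fs` and of an independent copy of the noise `fn`. -/
def posteriorPredictionMap {P : Measure Ω} [IsProbabilityMeasure P] {fs fn : ℝ → Ω → ℝ} {v : ℝ≥0}
    (h : IsNoisyDecomposition P fs fn v) : PredictionMap := fun D =>
  ⟨((smoothPosterior P fs v D).prod P).map fun (p : Ω × Ω) t => fs t p.1 + fn t p.2, by
    have := isProbabilityMeasure_smoothPosterior (P := P) h.measurable_smooth h.var_pos D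
    refine Measure.isProbabilityMeasure_map (Measurable.aemeasurable ?_)
    exact measurable_pi_lambda _ fun t =>
      ((h.measurable_smooth t).comp measurable_fst).add
        ((h.measurable_noise t).comp measurable_snd)⟩

end Posterior

open Classical in
/-- The Gaussian divergence of `μ` from `ν`: the excess of `KL(μ, ν)` over the least
Kullback–Leibler divergence of `μ` from a (possibly degenerate) Gaussian distribution, and `∞` if
the latter is infinite. -/
def gaussianDiv {m : ℕ} (μ ν : Measure (Fin m → ℝ)) : ℝ≥0∞ :=
  if ∃ ξ : Measure (Fin m → ℝ), IsGaussian ξ ∧ klDiv μ ξ < ∞ then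
    klDiv μ ν - ⨅ (ξ : Measure (Fin m → ℝ)) (_ : IsGaussian ξ), klDiv μ ξ
  else ∞

/-- `𝔼_{p(D) p(x)} [KL(P_x (ρ D), P_x (π D))]`. -/
def klObjective {n : ℕ} {S : Set DataSet} (pD : Measure S) (px : Measure (Fin n → ℝ))
    (ρ π : PredictionMap) : ℝ≥0∞ :=
  ∫⁻ D, ∫⁻ x, klDiv (fdd (ρ D) x : Measure (Fin n → ℝ)) (fdd (π D) x) ∂px ∂pD

/-- `𝔼_{p(D) p(x)} [𝒢(P_x (ρ D), P_x (π D))]`, with the Gaussian divergence `𝒢`. -/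
def gaussianObjective {n : ℕ} {S : Set DataSet} (pD : Measure S) (px : Measure (Fin n → ℝ))
    (ρ π : PredictionMap) : ℝ≥0∞ :=
  ∫⁻ D, ∫⁻ x, gaussianDiv (fdd (ρ D) x : Measure (Fin n → ℝ)) (fdd (π D) x) ∂px ∂pD

/-- Uniform Hölder condition in `L^p` on a process. -/
def IsHolderInLp {Ω : Type*} [MeasurableSpace Ω] (P : Measure Ω) (fs : ℝ → Ω → ℝ) : Prop :=
  ∃ p : ℝ≥0∞, 2 ≤ p ∧ ∃ β : ℝ, 1 / 2 < β ∧ β ≤ 1 ∧ ∃ c > (0 : ℝ), ∃ r > (0 : ℝ),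
    ∀ x y : ℝ, |x - y| < r →
      eLpNorm (fun ω => fs x ω - fs y ω) p P ≤ ENNReal.ofReal (c * |x - y| ^ β)


section Bayes

variable {Ω : Type*} [MeasurableSpace Ω]

theorem pi_gaussianReal_eq_withDensity {m : ℕ} (a : Fin m → ℝ) {v : ℝ≥0} (hv : v ≠ 0) :
    Measure.pi (fun i => gaussianReal (a i) v) =
      volume.withDensity fun y : Fin m → ℝ => ∏ i, gaussianPDF (a i) v (y i) := by
  refine Measure.pi_eq fun s hs => ?_
  have hg : ∀ i, Integrable ((s i).indicator (gaussianPDFReal (a i) v)) := fun i =>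
    (integrable_gaussianPDFReal _ _).indicator (hs i)
  have hg' := Integrable.fintype_prod hg
  rw [← volume_pi] at hg'
  have h1 : ∀ i y, 0 ≤ (s i).indicator (gaussianPDFReal (a i) v) y := fun i y =>
    Set.indicator_nonneg (fun z _ => gaussianPDFReal_nonneg _ _ z) y
  have h2 : ∀ y : Fin m → ℝ, (Set.univ.pi s).indicator
      (fun y : Fin m → ℝ => ∏ i, gaussianPDF (a i) v (y i)) y =
      ENNReal.ofReal (∏ i, (s i).indicator (gaussianPDFReal (a i) v) (y i)) := fun y => by
    rw [ENNReal.ofReal_prod_of_nonneg fun i _ => h1 i _]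
    by_cases hy : y ∈ Set.univ.pi s
    · rw [Set.indicator_of_mem hy]
      exact Finset.prod_congr rfl fun i _ => by
        rw [Set.indicator_of_mem (hy i trivial), gaussianPDF]
    · rw [Set.indicator_of_notMem hy]
      simp only [Set.mem_pi, Set.mem_univ, true_implies, not_forall] at hy
      obtain ⟨i, hi⟩ := hy
      refine (Finset.prod_eq_zero (Finset.mem_univ i) ?_).symm
      rw [Set.indicator_of_notMem hi, ENNReal.ofReal_zero]
  rw [withDensity_apply _ (MeasurableSet.univ_pi hs), ← lintegral_indicator (MeasurableSet.univ_pi hs),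
    lintegral_congr h2, ← ofReal_integral_eq_lintegral_ofReal hg'
      (Filter.Eventually.of_forall fun y => Finset.prod_nonneg fun i _ => h1 i _),
    integral_fintype_prod_volume_eq_prod,
    ENNReal.ofReal_prod_of_nonneg fun i _ => integral_nonneg (h1 i)]
  refine Finset.prod_congr rfl fun i _ => ?_
  rw [gaussianReal_apply_eq_integral _ hv, integral_indicator (hs i)]

theorem map_add_pi_gaussianReal {m : ℕ} (a : Fin m → ℝ) (v : ℝ≥0) :
    (Measure.pi fun _ : Fin m => gaussianReal 0 v).map (fun z i => a i + z i) =
      Measure.pi fun i => gaussianReal (a i) v := by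
  have h : ∀ i, (gaussianReal 0 v).map (fun z => a i + z) = gaussianReal (a i) v := fun i => by
    rw [gaussianReal_map_const_add, zero_add]
  have := Measure.pi_map_pi (μ := fun _ : Fin m => gaussianReal 0 v) (f := fun i z => a i + z)
    (fun i => (measurable_const_add (a i)).aemeasurable)
  rw [this]
  simp only [h]

/-- Joint law of the smooth part and of noisy observations at distinct inputs. -/
theorem lintegral_smooth_observations {P : Measure Ω} [IsProbabilityMeasure P]
    {fs fn : ℝ → Ω → ℝ} {v : ℝ≥0} (h : IsNoisyDecomposition P fs fn v) {m : ℕ} {x : Fin m → ℝ}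
    (hx : Function.Injective x) {φ : (ℝ → ℝ) × (Fin m → ℝ) → ℝ≥0∞} (hφ : Measurable φ) :
    ∫⁻ ω, φ (fun t => fs t ω, fun i => fs (x i) ω + fn (x i) ω) ∂P =
      ∫⁻ ω, ∫⁻ y : Fin m → ℝ,
        likelihood fs v ⟨m, fun i => (x i, y i)⟩ ω * φ (fun t => fs t ω, y) ∂volume ∂P := by
  have hS : Measurable fun ω t => fs t ω := measurable_pi_lambda _ h.measurable_smooth
  have hN : Measurable fun ω (i : Fin m) => fn (x i) ω :=
    measurable_pi_lambda _ fun i => h.measurable_noise (x i)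
  have hind : IndepFun (fun ω t => fs t ω) (fun ω (i : Fin m) => fn (x i) ω) P :=
    h.indep.comp (φ := id) measurable_id (measurable_proj x)
  have hmap := (indepFun_iff_map_prod_eq_prod_map_map hS.aemeasurable hN.aemeasurable).1 hind
  rw [h.noise_law m x hx] at hmap
  have hψ : Measurable fun q : (ℝ → ℝ) × (Fin m → ℝ) => φ (q.1, fun i => q.1 (x i) + q.2 i) :=
    hφ.comp (by fun_prop)
  calc ∫⁻ ω, φ (fun t => fs t ω, fun i => fs (x i) ω + fn (x i) ω) ∂P
      = ∫⁻ q, φ (q.1, fun i => q.1 (x i) + q.2 i)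
          ∂(P.map fun ω => ((fun t => fs t ω), fun i : Fin m => fn (x i) ω)) := by
        rw [lintegral_map hψ (hS.prodMk hN)]
    _ = ∫⁻ ω, ∫⁻ z, φ (fun t => fs t ω, fun i => fs (x i) ω + z i)
          ∂(Measure.pi fun _ => gaussianReal 0 v) ∂P := by
        rw [hmap, lintegral_prod _ hψ.aemeasurable, lintegral_map hψ.lintegral_prod_right' hS]
    _ = _ := by
        refine lintegral_congr fun ω => ?_
        have hφω : Measurable fun y : Fin m → ℝ => φ (fun t => fs t ω, y) :=
          hφ.comp measurable_prodMk_left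
        have hz : Measurable fun (z : Fin m → ℝ) i => fs (x i) ω + z i := by fun_prop
        have hd : Measurable fun y : Fin m → ℝ => ∏ i, gaussianPDF (fs (x i) ω) v (y i) :=
          Finset.measurable_prod _ fun i _ => (measurable_gaussianPDF _ _).comp (measurable_pi_apply i)
        rw [← lintegral_map hφω hz, map_add_pi_gaussianReal (fun i => fs (x i) ω),
          pi_gaussianReal_eq_withDensity _ h.var_pos.ne', lintegral_withDensity_eq_lintegral_mul _ hd hφω]
        rfl

/-- At distinct inputs, `y ↦ smoothPosterior P fs v (x, y)` is a version of the conditional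
distribution of the smooth part given the noisy observations `(fs + fn)(x) = y`. -/
theorem smoothPosterior_isConditional {P : Measure Ω} [IsProbabilityMeasure P]
    {fs fn : ℝ → Ω → ℝ} {v : ℝ≥0} (h : IsNoisyDecomposition P fs fn v) {m : ℕ} {x : Fin m → ℝ}
    (hx : Function.Injective x) {A : Set (ℝ → ℝ)} (hA : MeasurableSet A) {B : Set (Fin m → ℝ)}
    (hB : MeasurableSet B) :
    P {ω | (fun t => fs t ω) ∈ A ∧ (fun i => fs (x i) ω + fn (x i) ω) ∈ B} =
      ∫⁻ y in B, smoothPosterior P fs v ⟨m, fun i => (x i, y i)⟩ {ω | (fun t => fs t ω) ∈ A}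
        ∂(P.map fun ω i => fs (x i) ω + fn (x i) ω) := by
  have hS : Measurable fun ω t => fs t ω := measurable_pi_lambda _ h.measurable_smooth
  have hF : Measurable fun ω (i : Fin m) => fs (x i) ω + fn (x i) ω :=
    measurable_pi_lambda _ fun i => (h.measurable_smooth _).add (h.measurable_noise _)
  have hA' : MeasurableSet {ω | (fun t => fs t ω) ∈ A} := hS hA
  have hL : Measurable fun q : Ω × (Fin m → ℝ) =>
      likelihood fs v ⟨m, fun i => (x i, q.2 i)⟩ q.1 := by
    change Measurable fun q : Ω × (Fin m → ℝ) => ∏ i : Fin m, gaussianPDF (fs (x i) q.1) v (q.2 i)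
    refine Finset.measurable_prod _ fun i _ => ?_
    exact measurable_uncurry_gaussianPDF.comp (((h.measurable_smooth _).comp measurable_fst).prodMk
      (measurable_const.prodMk ((measurable_pi_apply i).comp measurable_snd)))
  obtain ⟨L, hLdef⟩ : ∃ L : Ω → (Fin m → ℝ) → ℝ≥0∞, ∀ ω y,
      likelihood fs v ⟨m, fun i => (x i, y i)⟩ ω = L ω y := ⟨_, fun _ _ => rfl⟩
  simp only [hLdef] at hL
  have hL' : Measurable fun q : (Fin m → ℝ) × Ω => L q.2 q.1 := hL.comp measurable_swap
  have hLm : ∀ y, Measurable fun ω => L ω y := fun y => hL.comp measurable_prodMk_right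
  have hZ : Measurable fun y : Fin m → ℝ => ∫⁻ ω, L ω y ∂P := hL'.lintegral_prod_right'
  have hN : Measurable fun y : Fin m → ℝ =>
      ∫⁻ ω in {ω | (fun t => fs t ω) ∈ A}, L ω y ∂P := hL'.lintegral_prod_right'
  have hpost : ∀ y : Fin m → ℝ,
      smoothPosterior P fs v ⟨m, fun i => (x i, y i)⟩ {ω | (fun t => fs t ω) ∈ A} =
      (∫⁻ ω in {ω | (fun t => fs t ω) ∈ A}, L ω y ∂P) / ∫⁻ ω, L ω y ∂P := fun y => by
    rw [smoothPosterior, withDensity_apply _ hA']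
    simp only [hLdef, div_eq_mul_inv]
    exact lintegral_mul_const _ (hLm y)
  have hcancel : ∀ y : Fin m → ℝ, (∫⁻ ω, L ω y ∂P) *
        smoothPosterior P fs v ⟨m, fun i => (x i, y i)⟩ {ω | (fun t => fs t ω) ∈ A} =
      ∫⁻ ω in {ω | (fun t => fs t ω) ∈ A}, L ω y ∂P := fun y => by
    have hp := (isProbabilityMeasure_smoothPosterior (P := P) h.measurable_smooth h.var_pos
      ⟨m, fun i => (x i, y i)⟩).measure_univ
    rw [smoothPosterior, withDensity_apply _ MeasurableSet.univ, setLIntegral_univ] at hp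
    simp only [hLdef, div_eq_mul_inv] at hp
    rw [lintegral_mul_const _ (hLm y)] at hp
    rw [hpost]
    refine ENNReal.mul_div_cancel ?_ ?_ <;> intro h0 <;> rw [h0] at hp <;> simp at hp
  obtain ⟨W, hW⟩ : ∃ W : (Fin m → ℝ) → ℝ≥0∞, ∀ y,
      smoothPosterior P fs v ⟨m, fun i => (x i, y i)⟩ {ω | (fun t => fs t ω) ∈ A} = W y :=
    ⟨_, fun _ => rfl⟩
  have hobs : ∀ φ : (ℝ → ℝ) × (Fin m → ℝ) → ℝ≥0∞, Measurable φ →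
      ∫⁻ ω, φ (fun t => fs t ω, fun i => fs (x i) ω + fn (x i) ω) ∂P =
        ∫⁻ ω, ∫⁻ y : Fin m → ℝ, L ω y * φ (fun t => fs t ω, y) ∂volume ∂P := fun φ hφ => by
    rw [lintegral_smooth_observations h hx hφ]
    simp only [hLdef]
  simp only [hW] at hpost hcancel ⊢
  have hWm : Measurable W := by
    rw [funext hpost]
    exact hN.div hZ
  have hR : Measurable (B.indicator W) := hWm.indicator hB
  have hE : MeasurableSet {ω | (fun t => fs t ω) ∈ A ∧
      (fun i => fs (x i) ω + fn (x i) ω) ∈ B} := hA'.inter (hF hB)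
  have h1 : P {ω | (fun t => fs t ω) ∈ A ∧ (fun i => fs (x i) ω + fn (x i) ω) ∈ B} =
      ∫⁻ ω, ∫⁻ y : Fin m → ℝ, L ω y * (A ×ˢ B).indicator 1 (fun t => fs t ω, y) ∂volume ∂P := by
    rw [← hobs _ (measurable_one.indicator (hA.prod hB)), ← lintegral_indicator_one hE]
    rfl
  have h2 : ∫⁻ y in B, W y ∂(P.map fun ω i => fs (x i) ω + fn (x i) ω) =
      ∫⁻ ω, ∫⁻ y : Fin m → ℝ, L ω y * B.indicator W y ∂volume ∂P := by
    rw [← lintegral_indicator hB, lintegral_map hR hF]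
    exact hobs (fun q => B.indicator W q.2) (hR.comp measurable_snd)
  have s1 := lintegral_lintegral_swap (μ := P) (ν := (volume : Measure (Fin m → ℝ)))
    (f := fun ω y => L ω y * (A ×ˢ B).indicator 1 (fun t => fs t ω, y))
    (hL.mul ((measurable_one.indicator (hA.prod hB)).comp
      ((hS.comp measurable_fst).prodMk measurable_snd))).aemeasurable
  have s2 := lintegral_lintegral_swap (μ := P) (ν := (volume : Measure (Fin m → ℝ)))
    (f := fun ω y => L ω y * B.indicator W y) (hL.mul (hR.comp measurable_snd)).aemeasurable
  rw [h1, h2, s1, s2]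
  refine lintegral_congr fun y => ?_
  by_cases hy : y ∈ B
  · simp only [Set.indicator_of_mem hy]
    rw [lintegral_mul_const _ (hLm y), hcancel, ← lintegral_indicator hA']
    refine lintegral_congr fun ω => ?_
    by_cases hω : (fun t => fs t ω) ∈ A <;> simp [Set.indicator, hy, hω]
  · simp [Set.indicator, hy]

end Bayes

end

/-!
The posterior prediction at a data set `D` is the law of a noisy process whose smooth part is the
prior smooth part reweighted by the bounded density `exp (-misfit)` over the `evidence`. The
posterior is therefore dominated by the prior (`smoothPosterior_le`), which gives it second moments
and the Hölder condition of the prior, and its means and covariances are continuous in `D`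
(`continuous_integral_smoothPosterior`). On a bounded collection of data sets the evidence is
bounded below by Jensen's inequality (`exists_le_evidence`), so that second moments are bounded
uniformly.

Since the Hölder exponent in `L²` exceeds `1 / 2`, Kolmogorov's criterion provides a continuous
Gaussian process with the posterior mean and covariance functions
(`exists_continuous_gaussianProcess_of_holder`). Adding white noise to it gives the Gaussianisation
`γ D` (`exists_isGaussianisation_posteriorPredictionMap`). Gaussian laws are determined by their
first two moments and depend continuously on them, whence `γ` is unique and continuous along its
finite-dimensional distributions.

For the optimality of `γ`, let `μ` be a finite-dimensional distribution of the posterior prediction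
at distinct inputs, which the noise makes nondegenerate, and let `γ` be the Gaussian measure with
the moments of `μ`. The log-likelihood ratio of two nondegenerate Gaussian measures is a quadratic
polynomial, which has the same expectation under `μ` and under `γ`. Hence `KL(μ, γ) + KL(γ, ξ) ≤
KL(μ, ξ)` for all Gaussian `ξ` (`klDiv_add_klDiv_le_of_isGaussian`). Repeated inputs reduce to
distinct ones by data processing (`IsGaussianisation.klDiv_fdd_le`). Comparison with white noise
bounds `KL(μ, γ)` by second moments (`klDiv_fdd_noisyLaw_le`), so the optimal value is finite.

Finally, any other minimiser `π` has `KL(γ, π) = 0` in the mean over data and inputs. To get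
`π D = γ D` for every `D` in the collection, rather than almost every one, `KL(γ, π)` is bounded
below by the variational expressions `∫ g dγ - ∫ (exp g - 1) dπ` for bounded continuous `g`. They
are continuous in the data and in distinct inputs, hence nonpositive everywhere, and this forces
`π = γ` (`eq_of_forall_integral_le`, `eq_on_of_lintegral_le`). The Gaussian divergence differs from the
Kullback–Leibler divergence by its finite value at `γ` (`IsGaussianisation.gaussianDiv_fdd`), so the
same argument applies to it.
-/

/-! ### Gaussian vectors in coordinates -/

section GaussianVectors

theorem dual_pi_apply {ι : Type*} [Fintype ι] [DecidableEq ι] (L : StrongDual ℝ (ι → ℝ))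
    (x : ι → ℝ) : L x = ∑ i, L (Pi.single i 1) * x i := by
  conv_lhs => rw [← Finset.univ_sum_single x, map_sum]
  refine Finset.sum_congr rfl fun i _ => ?_
  have : (Pi.single i (x i) : ι → ℝ) = x i • Pi.single i 1 := by
    rw [← Pi.single_smul, smul_eq_mul, mul_one]
  rw [this, map_smul, smul_eq_mul, mul_comm]

theorem integral_linear_combination {Ω ι : Type*} [MeasurableSpace Ω] [Fintype ι] {P : Measure Ω}
    {X : ι → Ω → ℝ} (hX : ∀ i, Integrable (X i) P) (a : ι → ℝ) :
    ∫ ω, ∑ i, a i * X i ω ∂P = ∑ i, a i * ∫ ω, X i ω ∂P := by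
  rw [integral_finsetSum _ fun i _ => (hX i).const_mul _]
  simp only [integral_const_mul]

theorem covariance_linear_combination {Ω ι κ : Type*} [MeasurableSpace Ω] [Fintype ι] [Fintype κ]
    {P : Measure Ω} [IsProbabilityMeasure P] {X : ι → Ω → ℝ} {Y : κ → Ω → ℝ}
    (hX : ∀ i, MemLp (X i) 2 P) (hY : ∀ i, MemLp (Y i) 2 P) (a : ι → ℝ) (b : κ → ℝ) :
    covariance (fun ω => ∑ i, a i * X i ω) (fun ω => ∑ i, b i * Y i ω) P =
      ∑ i, ∑ j, a i * b j * covariance (X i) (Y j) P := by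
  rw [covariance_fun_sum_fun_sum (fun i => (hX i).const_mul _) (fun i => (hY i).const_mul _)]
  refine Finset.sum_congr rfl fun i _ => Finset.sum_congr rfl fun j _ => ?_
  rw [covariance_const_mul_left, covariance_const_mul_right, mul_assoc]

theorem variance_linear_combination {Ω ι : Type*} [MeasurableSpace Ω] [Fintype ι]
    {P : Measure Ω} [IsProbabilityMeasure P] {X : ι → Ω → ℝ}
    (hX : ∀ i, MemLp (X i) 2 P) (a : ι → ℝ) :
    variance (fun ω => ∑ i, a i * X i ω) P =
      ∑ i, ∑ j, a i * a j * covariance (X i) (X j) P := by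
  rw [← covariance_self, covariance_linear_combination hX hX]
  exact (memLp_finsetSum _ fun i _ => (hX i).const_mul _).aestronglyMeasurable.aemeasurable

theorem memLp_eval_of_isGaussian {ι : Type*} [Fintype ι] (μ : Measure (ι → ℝ)) [IsGaussian μ]
    (i : ι) : MemLp (fun x : ι → ℝ => x i) 2 μ :=
  IsGaussian.memLp_dual μ (ContinuousLinearMap.proj (R := ℝ) (φ := fun _ : ι => ℝ) i) 2 (by simp)

/-- The characteristic function of a Gaussian vector in terms of its coordinates. -/
theorem charFunDual_eq_of_isGaussian_pi {ι : Type*} [Fintype ι] [DecidableEq ι]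
    (μ : Measure (ι → ℝ)) [IsGaussian μ] (L : StrongDual ℝ (ι → ℝ)) :
    charFunDual μ L = Complex.exp
      (((∑ i, L (Pi.single i 1) * ∫ x, x i ∂μ : ℝ) : ℂ) * Complex.I -
        ((∑ i, ∑ j, L (Pi.single i 1) * L (Pi.single j 1) *
          covariance (fun x => x i) (fun x => x j) μ : ℝ) : ℂ) / 2) := by
  have h2 := memLp_eval_of_isGaussian μ
  have hL : (L : (ι → ℝ) → ℝ) = fun x => ∑ i, L (Pi.single i 1) * x i :=
    funext fun x => dual_pi_apply L x
  rw [IsGaussian.charFunDual_eq, integral_complex_ofReal]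
  congr 4
  · conv_lhs => rw [hL]
    exact integral_linear_combination (fun i => (h2 i).integrable (by norm_num)) _
  · conv_lhs => rw [hL]
    exact variance_linear_combination h2 _

/-- A Gaussian vector is determined by its mean vector and its covariance matrix. -/
theorem IsGaussian.ext_pi {ι : Type*} [Fintype ι] {μ ν : Measure (ι → ℝ)}
    [IsGaussian μ] [IsGaussian ν] (hm : ∀ i, ∫ x, x i ∂μ = ∫ x, x i ∂ν)
    (hc : ∀ i j, covariance (fun x : ι → ℝ => x i) (fun x => x j) μ =
      covariance (fun x : ι → ℝ => x i) (fun x => x j) ν) : μ = ν := by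
  classical
  refine Measure.ext_of_charFunDual (funext fun L => ?_)
  simp only [charFunDual_eq_of_isGaussian_pi, hm, hc]

/-- Weak convergence on `ι → ℝ` follows from pointwise convergence of characteristic functions. -/
theorem tendsto_of_tendsto_charFunDual_pi {ι : Type*} [Fintype ι]
    {μ : ℕ → ProbabilityMeasure (ι → ℝ)} {μ₀ : ProbabilityMeasure (ι → ℝ)}
    (h : ∀ L : StrongDual ℝ (ι → ℝ), Filter.Tendsto
      (fun n => charFunDual (μ n : Measure (ι → ℝ)) L) Filter.atTop
      (𝓝 (charFunDual (μ₀ : Measure (ι → ℝ)) L))) :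
    Filter.Tendsto μ Filter.atTop (𝓝 μ₀) := by
  let e := (EuclideanSpace.equiv ι ℝ).symm
  have he : Continuous e := e.continuous
  have hc : ∀ (ρ : ProbabilityMeasure (ι → ℝ)) (t : EuclideanSpace ℝ ι),
      charFun (ρ.map he.aemeasurable : Measure (EuclideanSpace ℝ ι)) t =
        charFunDual (ρ : Measure (ι → ℝ))
          ((InnerProductSpace.toDualMap ℝ _ t).comp (e : (ι → ℝ) →L[ℝ] EuclideanSpace ℝ ι)) := by
    intro ρ t
    rw [charFun_eq_charFunDual_toDualMap, ProbabilityMeasure.toMeasure_map, ← charFunDual_map]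
    rfl
  have h1 : Filter.Tendsto (fun n => (μ n).map he.aemeasurable) Filter.atTop
      (𝓝 (μ₀.map he.aemeasurable)) := by
    refine ProbabilityMeasure.tendsto_of_tendsto_charFun fun t => ?_
    simp only [hc]
    exact h _
  have h2 := ProbabilityMeasure.tendsto_map_of_tendsto_of_continuous _ _ h1
    (EuclideanSpace.equiv ι ℝ).continuous
  have hid : ∀ ρ : ProbabilityMeasure (ι → ℝ), (ρ.map he.aemeasurable).map
      (EuclideanSpace.equiv ι ℝ).continuous.aemeasurable = ρ := fun ρ => by
    apply Subtype.ext
    change ((ρ : Measure (ι → ℝ)).map e).map (EuclideanSpace.equiv ι ℝ) = ρ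
    rw [Measure.map_map (EuclideanSpace.equiv ι ℝ).continuous.measurable he.measurable]
    exact Measure.map_id
  simpa only [hid] using h2

/-- Gaussian vectors converge weakly when their means and covariances converge. -/
theorem tendsto_of_isGaussian_pi {ι : Type*} [Fintype ι]
    {μ : ℕ → ProbabilityMeasure (ι → ℝ)} {μ₀ : ProbabilityMeasure (ι → ℝ)}
    (hμ : ∀ n, IsGaussian (μ n : Measure (ι → ℝ))) (hμ₀ : IsGaussian (μ₀ : Measure (ι → ℝ)))
    (hm : ∀ i, Filter.Tendsto (fun n => ∫ x, x i ∂(μ n : Measure (ι → ℝ))) Filter.atTop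
      (𝓝 (∫ x, x i ∂(μ₀ : Measure (ι → ℝ)))))
    (hc : ∀ i j, Filter.Tendsto (fun n => covariance (fun x : ι → ℝ => x i) (fun x => x j)
        (μ n : Measure (ι → ℝ))) Filter.atTop
      (𝓝 (covariance (fun x : ι → ℝ => x i) (fun x => x j) (μ₀ : Measure (ι → ℝ))))) :
    Filter.Tendsto μ Filter.atTop (𝓝 μ₀) := by
  classical
  refine tendsto_of_tendsto_charFunDual_pi fun L => ?_
  simp only [charFunDual_eq_of_isGaussian_pi]
  refine (Complex.continuous_exp.tendsto _).comp (Filter.Tendsto.sub ?_ ?_)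
  · refine Filter.Tendsto.mul_const _ ((Complex.continuous_ofReal.tendsto _).comp ?_)
    exact tendsto_finsetSum _ fun i _ => (hm i).const_mul _
  · refine Filter.Tendsto.div_const ((Complex.continuous_ofReal.tendsto _).comp ?_) _
    exact tendsto_finsetSum _ fun i _ => tendsto_finsetSum _ fun j _ => (hc i j).const_mul _

end GaussianVectors

/-! ### Limits and translates of Gaussian processes -/

section GaussianLimits

variable {Ω : Type*} [MeasurableSpace Ω] {P : Measure Ω}

theorem isGaussianProcess_const_add {T : Type*} {X : T → Ω → ℝ} (hX : IsGaussianProcess X P)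
    (c : T → ℝ) :
    IsGaussianProcess (fun t ω => c t + X t ω) P := by
  refine ⟨fun I => ⟨?_⟩⟩
  have h := (hX.hasGaussianLaw I).isGaussian_map
  have h2 : AEMeasurable (fun ω => I.restrict (X · ω)) P := (hX.hasGaussianLaw I).aemeasurable
  have e : P.map (fun ω => I.restrict fun t => c t + X t ω) =
      (P.map fun ω => I.restrict (X · ω)).map fun y => I.restrict c + y := by
    rw [AEMeasurable.map_map_of_aemeasurable (by fun_prop) h2]
    rfl
  rw [e]
  infer_instance

variable [IsProbabilityMeasure P]

/-- An almost sure limit of real Gaussian variables is Gaussian if means and variances converge. -/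
theorem map_eq_gaussianReal_of_tendsto {Y : ℕ → Ω → ℝ} {Z : Ω → ℝ}
    (hY : ∀ n, HasGaussianLaw (Y n) P)
    (hlim : ∀ᵐ ω ∂P, Filter.Tendsto (fun n => Y n ω) Filter.atTop (𝓝 (Z ω))) {m s : ℝ}
    (hm : Filter.Tendsto (fun n => ∫ ω, Y n ω ∂P) Filter.atTop (𝓝 m))
    (hs : Filter.Tendsto (fun n => variance (Y n) P) Filter.atTop (𝓝 s)) :
    P.map Z = gaussianReal m s.toNNReal := by
  have hZ : AEMeasurable Z P := aemeasurable_of_tendsto_metrizable_ae _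
    (fun n => (hY n).aemeasurable) hlim
  have hs0 : 0 ≤ s := ge_of_tendsto' hs fun n => variance_nonneg _ _
  have := Measure.isProbabilityMeasure_map (μ := P) hZ
  refine Measure.ext_of_charFun (funext fun t => ?_)
  have h1 : Filter.Tendsto (fun n => charFun (P.map (Y n)) t) Filter.atTop
      (𝓝 (charFun (P.map Z) t)) := by
    simp only [charFun_apply_real]
    have hcont : Continuous fun x : ℝ => Complex.exp (t * x * Complex.I) := by fun_prop
    rw [integral_map hZ hcont.aestronglyMeasurable]
    have : ∀ n, ∫ x, Complex.exp (t * x * Complex.I) ∂(P.map (Y n)) =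
        ∫ ω, Complex.exp (t * Y n ω * Complex.I) ∂P := fun n =>
      integral_map (hY n).aemeasurable hcont.aestronglyMeasurable
    simp only [this]
    refine tendsto_integral_of_dominated_convergence (fun _ => 1)
      (fun n => hcont.comp_aestronglyMeasurable (hY n).aemeasurable.aestronglyMeasurable)
      (integrable_const _) (fun n => Filter.Eventually.of_forall fun ω => ?_) ?_
    · rw [← Complex.ofReal_mul, Complex.norm_exp_ofReal_mul_I]
    · filter_upwards [hlim] with ω hω
      exact (hcont.tendsto _).comp hω
  have h2 : Filter.Tendsto (fun n => charFun (P.map (Y n)) t) Filter.atTop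
      (𝓝 (charFun (gaussianReal m s.toNNReal) t)) := by
    simp only [(hY _).map_eq_gaussianReal, charFun_gaussianReal, Real.coe_toNNReal _ hs0,
      Real.coe_toNNReal _ (variance_nonneg _ _)]
    refine (Complex.continuous_exp.tendsto _).comp (Filter.Tendsto.sub ?_ ?_)
    · exact ((Complex.continuous_ofReal.tendsto _).comp hm).const_mul _ |>.mul_const _
    · exact (((Complex.continuous_ofReal.tendsto _).comp hs).mul_const _).div_const _
  exact tendsto_nhds_unique h1 h2

/-- An almost sure limit of Gaussian processes whose means and covariances converge is a Gaussian
process with the limiting mean and covariance. -/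
theorem IsGaussianProcess.of_tendsto {T : Type*} {X : ℕ → T → Ω → ℝ} {Z : T → Ω → ℝ}
    (hX : ∀ n, IsGaussianProcess (X n) P)
    (hlim : ∀ t, ∀ᵐ ω ∂P, Filter.Tendsto (fun n => X n t ω) Filter.atTop (𝓝 (Z t ω)))
    {m : T → ℝ} {k : T → T → ℝ}
    (hm : ∀ t, Filter.Tendsto (fun n => ∫ ω, X n t ω ∂P) Filter.atTop (𝓝 (m t)))
    (hk : ∀ s t, Filter.Tendsto (fun n => covariance (X n s) (X n t) P) Filter.atTop
      (𝓝 (k s t))) :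
    IsGaussianProcess Z P ∧ (∀ t, ∫ ω, Z t ω ∂P = m t) ∧
      ∀ s t, covariance (Z s) (Z t) P = k s t := by
  classical
  have h2 : ∀ n t, MemLp (X n t) 2 P := fun n t => ((hX n).hasGaussianLaw_eval t).memLp_two
  -- by the Cramér–Wold device, linear combinations of finitely many values suffice
  have key : ∀ (I : Finset T) (a : I → ℝ),
      P.map (fun ω => ∑ i : I, a i * Z i ω) = gaussianReal (∑ i, a i * m i)
        (∑ i, ∑ j, a i * a j * k i j).toNNReal := by
    intro I a
    refine map_eq_gaussianReal_of_tendsto (Y := fun n ω => ∑ i : I, a i * X n i ω)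
      (fun n => ?_) ?_ ?_ ?_
    · let L : (I → ℝ) →L[ℝ] ℝ := ∑ i, a i • ContinuousLinearMap.proj i
      have : (fun ω => ∑ i : I, a i * X n i ω) = fun ω => L (I.restrict (X n · ω)) := by
        ext ω; simp [L]
      rw [this]
      exact ((hX n).hasGaussianLaw I).map_fun L
    · have := fun i : I => hlim i
      filter_upwards [ae_all_iff.2 this] with ω hω
      exact tendsto_finsetSum _ fun i _ => (hω i).const_mul _
    · simp only [integral_linear_combination fun i : I => (h2 _ i).integrable (by norm_num)]
      exact tendsto_finsetSum _ fun i _ => (hm i).const_mul _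
    · simp only [variance_linear_combination fun i : I => h2 _ i]
      exact tendsto_finsetSum _ fun i _ => tendsto_finsetSum _ fun j _ => (hk i j).const_mul _
  have hZ : ∀ t, AEMeasurable (Z t) P := fun t => aemeasurable_of_tendsto_metrizable_ae _
    (fun n => ((hX n).aemeasurable t)) (hlim t)
  have hG : IsGaussianProcess Z P := by
    refine ⟨fun I => ⟨⟨fun L => ?_⟩⟩⟩
    have hmeas : AEMeasurable (fun ω => I.restrict (Z · ω)) P :=
      aemeasurable_pi_lambda _ fun i => hZ i
    have hL : (fun ω => L (I.restrict (Z · ω))) =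
        fun ω => ∑ i : I, L (Pi.single i 1) * Z i ω := by
      ext ω; rw [dual_pi_apply]; rfl
    have hg := key I fun i => L (Pi.single i 1)
    rw [← hL] at hg
    have hmap : (P.map fun ω => I.restrict (Z · ω)).map L =
        P.map fun ω => L (I.restrict (Z · ω)) :=
      AEMeasurable.map_map_of_aemeasurable L.continuous.aemeasurable hmeas
    have e1 : ∫ x, L x ∂(P.map fun ω => I.restrict (Z · ω)) =
        ∫ x, x ∂((P.map fun ω => I.restrict (Z · ω)).map L) :=
      (integral_map L.continuous.aemeasurable aestronglyMeasurable_id).symm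
    have e2 : variance L (P.map fun ω => I.restrict (Z · ω)) =
        variance id ((P.map fun ω => I.restrict (Z · ω)).map L) :=
      (variance_id_map L.continuous.aemeasurable).symm
    rw [e1, e2, hmap, hg, variance_id_gaussianReal, Real.toNNReal_coe, integral_id_gaussianReal]
  have hZ2 : ∀ t, MemLp (Z t) 2 P := fun t => (hG.hasGaussianLaw_eval t).memLp_two
  have hkl : ∀ s t, k s t = k t s := fun s t => tendsto_nhds_unique (hk s t) <| by
    simpa only [covariance_comm] using hk t s
  have hk0 : ∀ (I : Finset T) (a : I → ℝ), 0 ≤ ∑ i, ∑ j, a i * a j * k i j := fun I a =>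
    ge_of_tendsto' (tendsto_finsetSum _ fun i _ => tendsto_finsetSum _ fun j _ =>
      (hk i j).const_mul _) fun n => by
        rw [← variance_linear_combination fun i : I => h2 n i]; exact variance_nonneg _ _
  have hvar : ∀ (I : Finset T) (a : I → ℝ), variance (fun ω => ∑ i : I, a i * Z i ω) P =
      ∑ i, ∑ j, a i * a j * k i j := fun I a => by
    have hm : AEMeasurable (fun ω => ∑ i : I, a i * Z i ω) P :=
      Finset.aemeasurable_fun_sum _ fun i _ => (hZ i).const_mul _
    rw [← variance_id_map hm, key I a, variance_id_gaussianReal, Real.coe_toNNReal _ (hk0 I a)]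
  have hmean : ∀ t, ∫ ω, Z t ω ∂P = m t := fun t => by
    have hm1 := key {t} fun _ => 1
    have : (fun ω => ∑ i : ({t} : Finset T), 1 * Z i ω) = Z t := by
      ext ω
      rw [Finset.sum_coe_sort {t} fun i => 1 * Z i ω]
      simp
    rw [this, Finset.sum_coe_sort {t} fun i => 1 * m i] at hm1
    rw [← integral_map (hZ t) aestronglyMeasurable_id (f := fun x => x), hm1]
    simp
  refine ⟨hG, hmean, fun s t => ?_⟩
  -- the covariance is recovered from variances by polarisation
  have hself : ∀ t, variance (Z t) P = k t t := fun t => by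
    have hm1 := hvar {t} fun _ => 1
    have : (fun ω => ∑ i : ({t} : Finset T), 1 * Z i ω) = Z t := by
      ext ω
      rw [Finset.sum_coe_sort {t} fun i => 1 * Z i ω]
      simp
    rw [this, Finset.sum_coe_sort {t} fun i => ∑ j : ({t} : Finset T), 1 * 1 * k i j] at hm1
    simpa using hm1
  by_cases hst : s = t
  · subst hst
    rw [covariance_self (hZ s), hself]
  · have hm1 := hvar {s, t} fun _ => 1
    have : (fun ω => ∑ i : ({s, t} : Finset T), 1 * Z i ω) = fun ω => Z s ω + Z t ω := by
      ext ω
      rw [Finset.sum_coe_sort {s, t} fun i => 1 * Z i ω]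
      simp [Finset.sum_pair hst]
    rw [this, variance_fun_add (hZ2 s) (hZ2 t)] at hm1
    rw [Finset.sum_coe_sort {s, t} fun i => ∑ j : ({s, t} : Finset T), 1 * 1 * k i j,
      Finset.sum_pair hst, Finset.sum_coe_sort {s, t} fun j => 1 * 1 * k s j,
      Finset.sum_coe_sort {s, t} fun j => 1 * 1 * k t j, Finset.sum_pair hst,
      Finset.sum_pair hst, hself, hself, hkl t s] at hm1
    linarith

end GaussianLimits

/-! ### Laws of processes and their finite-dimensional distributions -/

section ProcessLaws

theorem fdd_eval_integral (μ : ProbabilityMeasure (ℝ → ℝ)) {m : ℕ} (x : Fin m → ℝ) (i : Fin m) :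
    ∫ y, y i ∂(fdd μ x : Measure (Fin m → ℝ)) = ∫ f, f (x i) ∂(μ : Measure (ℝ → ℝ)) := by
  rw [fdd, ProbabilityMeasure.toMeasure_map, integral_map (measurable_proj x).aemeasurable
    (measurable_pi_apply i).aestronglyMeasurable]
  rfl

theorem fdd_eval_covariance (μ : ProbabilityMeasure (ℝ → ℝ)) {m : ℕ} (x : Fin m → ℝ)
    (i j : Fin m) :
    covariance (fun y : Fin m → ℝ => y i) (fun y => y j) (fdd μ x : Measure (Fin m → ℝ)) =
      covariance (fun f : ℝ → ℝ => f (x i)) (fun f => f (x j)) (μ : Measure (ℝ → ℝ)) := by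
  rw [fdd, ProbabilityMeasure.toMeasure_map, covariance_map_fun
    (measurable_pi_apply i).aestronglyMeasurable (measurable_pi_apply j).aestronglyMeasurable
    (measurable_proj x).aemeasurable]
  rfl

theorem memLp_fdd {μ : ProbabilityMeasure (ℝ → ℝ)}
    (h : ∀ t : ℝ, MemLp (fun f : ℝ → ℝ => f t) 2 (μ : Measure (ℝ → ℝ))) {m : ℕ} (x : Fin m → ℝ)
    (i : Fin m) : MemLp (fun y : Fin m → ℝ => y i) 2 (fdd μ x : Measure (Fin m → ℝ)) := by
  rw [fdd, ProbabilityMeasure.toMeasure_map, memLp_map_measure_iff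
    (measurable_pi_apply i).aestronglyMeasurable (measurable_proj x).aemeasurable]
  exact h (x i)

theorem IsGaussianLaw.isGaussian_fdd {μ : ProbabilityMeasure (ℝ → ℝ)} (h : IsGaussianLaw μ)
    {m : ℕ} (x : Fin m → ℝ) : IsGaussian (fdd μ x : Measure (Fin m → ℝ)) := by
  classical
  let I : Finset ℝ := Finset.univ.image x
  have hx : ∀ i, x i ∈ I := fun i => Finset.mem_image_of_mem _ (Finset.mem_univ i)
  let L : (I → ℝ) →L[ℝ] (Fin m → ℝ) :=
    ContinuousLinearMap.pi fun i => ContinuousLinearMap.proj ⟨x i, hx i⟩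
  exact ((IsGaussianProcess.hasGaussianLaw h I).map_fun L).isGaussian_map

theorem IsGaussianLaw.memLp {μ : ProbabilityMeasure (ℝ → ℝ)} (h : IsGaussianLaw μ) (t : ℝ) :
    MemLp (fun f : ℝ → ℝ => f t) 2 (μ : Measure (ℝ → ℝ)) :=
  (IsGaussianProcess.hasGaussianLaw_eval h t).memLp_two

/-- A Gaussian law on `ℝ → ℝ` is determined by its mean and covariance functions. -/
theorem IsGaussianLaw.ext {μ ν : ProbabilityMeasure (ℝ → ℝ)} (hμ : IsGaussianLaw μ)
    (hν : IsGaussianLaw ν)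
    (hm : ∀ t : ℝ, ∫ f, f t ∂(μ : Measure (ℝ → ℝ)) = ∫ f, f t ∂(ν : Measure (ℝ → ℝ)))
    (hc : ∀ s t : ℝ,
      covariance (fun f : ℝ → ℝ => f s) (fun f : ℝ → ℝ => f t) (μ : Measure (ℝ → ℝ)) =
        covariance (fun f : ℝ → ℝ => f s) (fun f : ℝ → ℝ => f t) (ν : Measure (ℝ → ℝ))) :
    μ = ν := by
  apply Subtype.ext
  have hid : ∀ ρ : ProbabilityMeasure (ℝ → ℝ),
      AEMeasurable (fun f : ℝ → ℝ => (f · : ℝ → ℝ)) (ρ : Measure (ℝ → ℝ)) :=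
    fun ρ => aemeasurable_id
  have h1 : (μ : Measure (ℝ → ℝ)).map id = (ν : Measure (ℝ → ℝ)).map id := by
    refine IsProjectiveLimit.unique (isProjectiveLimit_map (X := fun t (f : ℝ → ℝ) => f t)
      (hid μ)) ?_
    intro I
    rw [Measure.map_id]
    change (ν : Measure (ℝ → ℝ)).map (fun f => I.restrict f) =
      (μ : Measure (ℝ → ℝ)).map fun f => I.restrict f
    have i1 : IsGaussian ((μ : Measure (ℝ → ℝ)).map fun f => I.restrict f) :=
      (IsGaussianProcess.hasGaussianLaw hμ I).isGaussian_map
    have i2 : IsGaussian ((ν : Measure (ℝ → ℝ)).map fun f => I.restrict f) :=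
      (IsGaussianProcess.hasGaussianLaw hν I).isGaussian_map
    have hr : Measurable fun f : ℝ → ℝ => I.restrict f :=
      measurable_pi_lambda _ fun i => measurable_pi_apply _
    refine IsGaussian.ext_pi (fun i => ?_) fun i j => ?_
    · rw [integral_map hr.aemeasurable (measurable_pi_apply i).aestronglyMeasurable,
        integral_map hr.aemeasurable (measurable_pi_apply i).aestronglyMeasurable]
      exact (hm i).symm
    · rw [covariance_map_fun (measurable_pi_apply i).aestronglyMeasurable
          (measurable_pi_apply j).aestronglyMeasurable hr.aemeasurable,
        covariance_map_fun (measurable_pi_apply i).aestronglyMeasurable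
          (measurable_pi_apply j).aestronglyMeasurable hr.aemeasurable]
      exact (hc i j).symm
  simpa using h1

end ProcessLaws

/-! ### Quadratic functions -/

section Quadratic

variable {ι : Type*} [Fintype ι]

/-- A polynomial function of degree at most two on `ι → ℝ`. -/
def IsQuadratic (q : (ι → ℝ) → ℝ) : Prop :=
  ∃ (c : ℝ) (b : ι → ℝ) (M : ι → ι → ℝ),
    ∀ x, q x = c + ∑ i, b i * x i + ∑ i, ∑ j, M i j * (x i * x j)

theorem IsQuadratic.const (c : ℝ) : IsQuadratic fun _ : ι → ℝ => c :=
  ⟨c, 0, 0, fun x => by simp⟩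

theorem IsQuadratic.add {q r : (ι → ℝ) → ℝ} (hq : IsQuadratic q) (hr : IsQuadratic r) :
    IsQuadratic fun x => q x + r x := by
  obtain ⟨c, b, M, h⟩ := hq
  obtain ⟨c', b', M', h'⟩ := hr
  refine ⟨c + c', b + b', M + M', fun x => ?_⟩
  simp only [h, h', Pi.add_apply, add_mul, Finset.sum_add_distrib]
  ring

theorem IsQuadratic.const_mul {q : (ι → ℝ) → ℝ} (hq : IsQuadratic q) (a : ℝ) :
    IsQuadratic fun x => a * q x := by
  obtain ⟨c, b, M, h⟩ := hq
  refine ⟨a * c, fun i => a * b i, fun i j => a * M i j, fun x => ?_⟩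
  simp only [h, mul_add, Finset.mul_sum, mul_assoc]

theorem IsQuadratic.sub {q r : (ι → ℝ) → ℝ} (hq : IsQuadratic q) (hr : IsQuadratic r) :
    IsQuadratic fun x => q x - r x := by
  have := hq.add (hr.const_mul (-1))
  simpa only [neg_one_mul, ← sub_eq_add_neg] using this

theorem IsQuadratic.sum {κ : Type*} (s : Finset κ) {q : κ → (ι → ℝ) → ℝ}
    (hq : ∀ k, IsQuadratic (q k)) : IsQuadratic fun x => ∑ k ∈ s, q k x := by
  classical
  induction s using Finset.induction_on with
  | empty => simpa using IsQuadratic.const (ι := ι) 0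
  | insert a s ha ih =>
    simp only [Finset.sum_insert ha]
    exact (hq a).add ih

theorem IsQuadratic.affine_sq (a b : ι → ℝ) :
    IsQuadratic fun x : ι → ℝ => (∑ i, a i * (x i - b i)) ^ 2 := by
  refine ⟨(∑ i, a i * b i) ^ 2, fun i => (-2 * ∑ i, a i * b i) * a i, fun i j => a i * a j,
    fun x => ?_⟩
  have h1 : ∑ i, a i * (x i - b i) = ∑ i, a i * x i - ∑ i, a i * b i := by
    rw [← Finset.sum_sub_distrib]; exact Finset.sum_congr rfl fun i _ => by ring
  have h2 : ∑ i, ∑ j, a i * a j * (x i * x j) = (∑ i, a i * x i) ^ 2 := by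
    rw [sq, Finset.sum_mul_sum]
    exact Finset.sum_congr rfl fun i _ => Finset.sum_congr rfl fun j _ => by ring
  beta_reduce
  rw [h1, h2]
  generalize ∑ i, a i * b i = d
  have h3 : ∑ i, (-2 * d) * a i * x i = (-2 * d) * ∑ i, a i * x i := by
    rw [Finset.mul_sum]; exact Finset.sum_congr rfl fun i _ => mul_assoc _ _ _
  rw [h3]
  ring

theorem IsQuadratic.measurable {q : (ι → ℝ) → ℝ} (hq : IsQuadratic q) : Measurable q := by
  obtain ⟨c, b, M, h⟩ := hq
  rw [funext h]
  fun_prop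

theorem IsQuadratic.integrable {q : (ι → ℝ) → ℝ} (hq : IsQuadratic q) {μ : Measure (ι → ℝ)}
    [IsProbabilityMeasure μ] (h2 : ∀ i, MemLp (fun x : ι → ℝ => x i) 2 μ) : Integrable q μ := by
  obtain ⟨c, b, M, h⟩ := hq
  rw [funext h]
  refine ((integrable_const _).add ?_).add ?_
  · exact integrable_finsetSum _ fun i _ => ((h2 i).integrable (by norm_num)).const_mul _
  · exact integrable_finsetSum _ fun i _ => integrable_finsetSum _ fun j _ =>
      ((h2 i).integrable_mul (h2 j)).const_mul _

/-- The expectation of a quadratic function depends on mean and covariance only. -/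
theorem IsQuadratic.integral_eq {q : (ι → ℝ) → ℝ} (hq : IsQuadratic q) {μ ν : Measure (ι → ℝ)}
    [IsProbabilityMeasure μ] [IsProbabilityMeasure ν]
    (hμ : ∀ i, MemLp (fun x : ι → ℝ => x i) 2 μ) (hν : ∀ i, MemLp (fun x : ι → ℝ => x i) 2 ν)
    (hm : ∀ i, ∫ x, x i ∂μ = ∫ x, x i ∂ν)
    (hc : ∀ i j, covariance (fun x : ι → ℝ => x i) (fun x => x j) μ =
      covariance (fun x : ι → ℝ => x i) (fun x => x j) ν) : ∫ x, q x ∂μ = ∫ x, q x ∂ν := by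
  obtain ⟨c, b, M, h⟩ := hq
  have key : ∀ (ρ : Measure (ι → ℝ)) [IsProbabilityMeasure ρ],
      (∀ i, MemLp (fun x : ι → ℝ => x i) 2 ρ) →
      ∫ x, q x ∂ρ = c + ∑ i, b i * ∫ x, x i ∂ρ + ∑ i, ∑ j, M i j *
        (covariance (fun x : ι → ℝ => x i) (fun x => x j) ρ +
          (∫ x, x i ∂ρ) * ∫ x, x j ∂ρ) := by
    intro ρ _ hρ
    have hp : ∀ i j, Integrable (fun x : ι → ℝ => M i j * (x i * x j)) ρ := fun i j =>
      ((hρ i).integrable_mul (hρ j)).const_mul _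
    have h1 : ∀ i, Integrable (fun x : ι → ℝ => b i * x i) ρ := fun i =>
      ((hρ i).integrable (by norm_num)).const_mul _
    have h1s : Integrable (fun x : ι → ℝ => ∑ i, b i * x i) ρ :=
      integrable_finsetSum _ fun i _ => h1 i
    have hps : Integrable (fun x : ι → ℝ => ∑ i, ∑ j, M i j * (x i * x j)) ρ :=
      integrable_finsetSum _ fun i _ => integrable_finsetSum _ fun j _ => hp i j
    have h1c : Integrable (fun x : ι → ℝ => c + ∑ i, b i * x i) ρ := (integrable_const _).add h1s
    simp only [h]
    rw [integral_add h1c hps, integral_add (integrable_const _) h1s,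
      integral_finsetSum _ fun i _ => h1 i,
      integral_finsetSum _ fun i _ => integrable_finsetSum _ fun j _ => hp i j]
    simp only [integral_finsetSum _ fun j _ => hp _ j, integral_const_mul]
    congr 1
    · simp
    · refine Finset.sum_congr rfl fun i _ => Finset.sum_congr rfl fun j _ => ?_
      rw [covariance_eq_sub (hρ i) (hρ j)]
      simp
  rw [key μ hμ, key ν hν]
  simp only [hm, hc]

end Quadratic

/-! ### Densities of nondegenerate Gaussian vectors -/

section Density

variable {ι : Type*} [Fintype ι]

/-- No nontrivial linear functional of the coordinates has zero variance. -/
def IsNondegenerate (μ : Measure (ι → ℝ)) : Prop :=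
  ∀ a : ι → ℝ, a ≠ 0 → variance (fun x : ι → ℝ => ∑ i, a i * x i) μ ≠ 0

theorem covariance_eval_pi_gaussianReal [DecidableEq ι] (i j : ι) :
    covariance (fun z : ι → ℝ => z i) (fun z => z j) (Measure.pi fun _ => gaussianReal 0 1) =
      if i = j then 1 else 0 := by
  have hmp := measurePreserving_eval (fun _ : ι => gaussianReal 0 1)
  have h2 : ∀ i, MemLp (fun z : ι → ℝ => z i) 2 (Measure.pi fun _ => gaussianReal 0 1) :=
    fun i => (memLp_id_gaussianReal' 2 (by norm_num)).comp_measurePreserving (hmp i)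
  split_ifs with h
  · subst h
    rw [covariance_self (h2 i).aestronglyMeasurable.aemeasurable,
      ← variance_id_map (hmp i).measurable.aemeasurable, (hmp i).map_eq]
    simp
  · have := (iIndepFun_pi (μ := fun _ : ι => gaussianReal 0 1) (X := fun _ x => x)
      (fun i => aemeasurable_id)).indepFun h
    exact this.covariance_eq_zero (h2 i) (h2 j)

theorem isGaussian_pi_gaussianReal (v : ℝ≥0) :
    IsGaussian (Measure.pi fun _ : ι => gaussianReal 0 v) := by
  have h := iIndepFun.hasGaussianLaw (P := Measure.pi fun _ : ι => gaussianReal 0 v)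
    (X := fun i (z : ι → ℝ) => z i) (fun i => ⟨by
      rw [(measurePreserving_eval (fun _ : ι => gaussianReal 0 v) i).map_eq]; infer_instance⟩)
    (iIndepFun_pi (μ := fun _ : ι => gaussianReal 0 v) (X := fun _ x => x)
      (fun i => aemeasurable_id))
  have := h.isGaussian_map
  simpa using this

open scoped MatrixOrder in
/-- A Gaussian vector with invertible covariance matrix is an invertible affine image of a
standard Gaussian vector. -/
theorem IsGaussian.exists_affine [DecidableEq ι] (μ : Measure (ι → ℝ)) [IsGaussian μ]
    (hμ : IsNondegenerate μ) : ∃ (A : Matrix ι ι ℝ) (b : ι → ℝ), A.det ≠ 0 ∧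
      μ = (Measure.pi fun _ : ι => gaussianReal 0 1).map fun z => b + A.mulVec z := by
  have h2 := memLp_eval_of_isGaussian μ
  let S : Matrix ι ι ℝ :=
    Matrix.of fun i j => covariance (fun x : ι → ℝ => x i) (fun x => x j) μ
  have hvar : ∀ a : ι → ℝ, variance (fun x : ι → ℝ => ∑ i, a i * x i) μ =
      a ⬝ᵥ (S.mulVec a) := fun a => by
    rw [variance_linear_combination h2]
    simp only [dotProduct, Matrix.mulVec, Finset.mul_sum, S, Matrix.of_apply]
    exact Finset.sum_congr rfl fun i _ => Finset.sum_congr rfl fun j _ => by ring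
  have hS : S.PosSemidef := by
    refine Matrix.PosSemidef.of_dotProduct_mulVec_nonneg ?_ fun a => ?_
    · ext i j
      simp [S, covariance_comm]
    · rw [star_trivial, ← hvar]
      exact variance_nonneg _ _
  -- a square root of the covariance matrix; `Bᵀ` is the linear part of the affine map
  obtain ⟨B, hB⟩ := CStarAlgebra.nonneg_iff_eq_star_mul_self.1 hS.nonneg
  have hB' : S = B.transpose * B := by
    rw [hB, Matrix.star_eq_conjTranspose, Matrix.conjTranspose_eq_transpose_of_trivial]
  have hdet : B.det ≠ 0 := by
    intro h0
    obtain ⟨a, ha, hBa⟩ := Matrix.exists_mulVec_eq_zero_iff.2 h0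
    refine hμ a ha ?_
    rw [hvar, hB', ← Matrix.mulVec_mulVec, hBa, Matrix.mulVec_zero, dotProduct_zero]
  refine ⟨B.transpose, fun i => ∫ x, x i ∂μ, by rwa [Matrix.det_transpose], ?_⟩
  have := isGaussian_pi_gaussianReal (ι := ι) 1
  set γ := Measure.pi fun _ : ι => gaussianReal 0 1 with hγ
  have hγ2 := memLp_eval_of_isGaussian γ
  set b : ι → ℝ := fun i => ∫ x, x i ∂μ
  have hT : Measurable fun z : ι → ℝ => b + B.transpose.mulVec z :=
    measurable_const.add (Continuous.measurable (by fun_prop))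
  have hcoord : ∀ (z : ι → ℝ) i, (b + B.transpose.mulVec z) i = b i + ∑ k, B k i * z k :=
    fun z i => rfl
  have hLp : ∀ i, MemLp (fun z : ι → ℝ => ∑ k, B k i * z k) 2 γ := fun i =>
    memLp_finsetSum _ fun k _ => (hγ2 k).const_mul _
  have hmz : ∀ i : ι, ∫ z : ι → ℝ, z i ∂γ = (0 : ℝ) := fun i => by
    have hmp := measurePreserving_eval (fun _ : ι => gaussianReal 0 1) i
    have h := integral_map (μ := γ) (f := fun x : ℝ => x) hmp.measurable.aemeasurable
      aestronglyMeasurable_id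
    rw [hmp.map_eq, integral_id_gaussianReal] at h
    exact h.symm
  have hG : IsGaussian (γ.map fun z => b + B.transpose.mulVec z) := by
    have e : (fun z : ι → ℝ => b + B.transpose.mulVec z) = (fun z => b + z) ∘
        (LinearMap.toContinuousLinearMap (Matrix.toLin' B.transpose)) := by
      ext z i; simp [Matrix.toLin'_apply]
    rw [e, ← Measure.map_map (measurable_const_add b) (ContinuousLinearMap.measurable _)]
    infer_instance
  refine IsGaussian.ext_pi (fun i => ?_) fun i j => ?_
  · rw [integral_map hT.aemeasurable (measurable_pi_apply i).aestronglyMeasurable]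
    simp only [hcoord]
    rw [integral_add (integrable_const _) ((hLp i).integrable (by norm_num)),
      integral_linear_combination fun k => (hγ2 k).integrable (by norm_num)]
    simp [hmz, b]
  · rw [covariance_map_fun (measurable_pi_apply i).aestronglyMeasurable
      (measurable_pi_apply j).aestronglyMeasurable hT.aemeasurable]
    simp only [hcoord]
    rw [covariance_const_add_left ((hLp i).integrable (by norm_num)),
      covariance_const_add_right ((hLp j).integrable (by norm_num)),
      covariance_linear_combination hγ2 hγ2]
    simp only [hγ, covariance_eval_pi_gaussianReal]
    simp only [mul_ite, mul_one, mul_zero, Finset.sum_ite_eq, Finset.mem_univ, if_true]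
    have : S i j = (B.transpose * B) i j := by rw [hB']
    simpa [S, Matrix.mul_apply] using this

/-- A nondegenerate Gaussian vector has a density whose logarithm is quadratic. -/
theorem IsGaussian.exists_density {m : ℕ} (μ : Measure (Fin m → ℝ)) [IsGaussian μ]
    (hμ : IsNondegenerate μ) :
    ∃ q : (Fin m → ℝ) → ℝ, IsQuadratic q ∧
      μ = volume.withDensity fun x => ENNReal.ofReal (Real.exp (q x)) := by
  classical
  obtain ⟨A, b, hA, hAb⟩ := IsGaussian.exists_affine μ hμ
  let q : (Fin m → ℝ) → ℝ := fun x =>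
    (Real.log |A.det⁻¹| + Fintype.card (Fin m) * Real.log (√(2 * Real.pi))⁻¹) +
    (-1 / 2) * ∑ k, (∑ i, A⁻¹ k i * (x i - b i)) ^ 2
  have hq : IsQuadratic q := (IsQuadratic.const _).add
    ((IsQuadratic.sum _ fun k => IsQuadratic.affine_sq _ _).const_mul _)
  refine ⟨q, hq, ?_⟩
  have hqm := hq.measurable
  let f : (Fin m → ℝ) → ℝ≥0∞ := fun z => ∏ i, gaussianPDF 0 1 (z i)
  have hf : Measurable f :=
    Finset.measurable_prod _ fun i _ => (measurable_gaussianPDF _ _).comp (measurable_pi_apply i)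
  have hT : Measurable fun z : Fin m → ℝ => b + A.mulVec z :=
    measurable_const.add (Continuous.measurable (by fun_prop))
  -- change of variables: the factor `|det A⁻¹|` is the Jacobian of the affine map
  have hfq : ∀ z, ENNReal.ofReal |A.det⁻¹| * f z =
      ENNReal.ofReal (Real.exp (q (b + A.mulVec z))) := fun z => by
    have h1 : ∀ k, ∑ i, A⁻¹ k i * ((b + A.mulVec z) i - b i) = z k := fun k => by
      have : A⁻¹.mulVec (A.mulVec z) = z := by
        rw [Matrix.mulVec_mulVec, Matrix.nonsing_inv_mul _ (isUnit_iff_ne_zero.2 hA),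
          Matrix.one_mulVec]
      conv_rhs => rw [← this]
      simp [Matrix.mulVec, dotProduct]
    have hdet : 0 < |A.det⁻¹| := abs_pos.2 (inv_ne_zero hA)
    have hpi : 0 < (√(2 * Real.pi))⁻¹ := by positivity
    simp only [q, h1, f, gaussianPDF]
    rw [← ENNReal.ofReal_prod_of_nonneg fun i _ => gaussianPDFReal_nonneg _ _ _,
      ← ENNReal.ofReal_mul hdet.le]
    congr 1
    rw [Real.exp_add, Real.exp_add, Real.exp_log hdet, mul_assoc]
    congr 1
    rw [mul_comm (Fintype.card (Fin m) : ℝ), ← Real.rpow_def_of_pos hpi, Real.rpow_natCast,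
      Finset.mul_sum, Real.exp_sum]
    simp only [gaussianPDFReal, Finset.prod_mul_distrib, Finset.prod_const, Finset.card_univ]
    congr 1
    · simp
    · refine Finset.prod_congr rfl fun i _ => ?_
      congr 1
      simp only [NNReal.coe_one]
      ring
  refine Measure.ext fun s hs => ?_
  have hg : Measurable (s.indicator fun x => ENNReal.ofReal (Real.exp (q x))) :=
    (Measurable.ennreal_ofReal (by fun_prop)).indicator hs
  rw [withDensity_apply _ hs, ← lintegral_indicator hs, hAb, Measure.map_apply hT hs,
    pi_gaussianReal_eq_withDensity _ one_ne_zero, withDensity_apply _ (hT hs),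
    ← lintegral_indicator (hT hs)]
  have hmap := Real.map_matrix_volume_pi_eq_smul_volume_pi hA
  have hc0 : ENNReal.ofReal |A.det⁻¹| ≠ 0 := by
    simpa using hA
  refine (ENNReal.mul_right_inj hc0 ENNReal.ofReal_ne_top).1 ?_
  rw [← lintegral_const_mul _ (hf.indicator (hT hs)),
    ← lintegral_add_left_eq_self (s.indicator _) b, ← smul_eq_mul, ← lintegral_smul_measure,
    ← hmap]
  refine Eq.trans ?_ (lintegral_map (hg.comp (measurable_const_add b)) (Continuous.measurable
    (LinearMap.continuous_of_finiteDimensional _))).symm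
  refine lintegral_congr fun z => ?_
  simp only [Matrix.toLin'_apply, Set.indicator_apply, Set.mem_preimage, Function.comp]
  split_ifs with h
  · exact hfq z
  · rw [mul_zero]

/-- A measure that charges no null set of `ν` but is nondegenerate cannot live on a proper affine
subspace, on which a degenerate Gaussian `ν` would be concentrated. -/
theorem IsNondegenerate.of_absolutelyContinuous {μ ν : Measure (ι → ℝ)} [IsProbabilityMeasure μ]
    [IsGaussian ν] (hμ : IsNondegenerate μ) (h : μ ≪ ν) : IsNondegenerate ν := by
  intro a ha h0
  have h2 := memLp_eval_of_isGaussian ν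
  have hL : MemLp (fun x : ι → ℝ => ∑ i, a i * x i) 2 ν :=
    memLp_finsetSum _ fun k _ => (h2 k).const_mul _
  have h1 := h.ae_le (ae_eq_integral_of_variance_eq_zero hL h0)
  refine hμ a ha ?_
  rw [variance_congr h1, ← covariance_self aemeasurable_const, covariance_const_left]

end Density

/-! ### The Pythagorean inequality for the Kullback–Leibler divergence -/

section Pythagoras

/-- **Pythagorean inequality**: the Gaussian measure `γ` with the moments of `μ` is the
information projection of `μ` onto the Gaussian measures. The log-density of `γ` with respect to
another Gaussian `ξ` is quadratic, so it has the same expectation under `μ` and `γ`. -/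
theorem klDiv_add_klDiv_le_of_isGaussian {m : ℕ} {μ γ ξ : Measure (Fin m → ℝ)}
    [IsProbabilityMeasure μ] [IsGaussian γ] [IsGaussian ξ]
    (hμ2 : ∀ i, MemLp (fun x : Fin m → ℝ => x i) 2 μ)
    (hμ : IsNondegenerate μ) (hm : ∀ i, ∫ x, x i ∂γ = ∫ x, x i ∂μ)
    (hc : ∀ i j, covariance (fun x : Fin m → ℝ => x i) (fun x => x j) γ =
      covariance (fun x : Fin m → ℝ => x i) (fun x => x j) μ) :
    klDiv μ γ + klDiv γ ξ ≤ klDiv μ ξ := by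
  by_cases htop : klDiv μ ξ = ∞
  · rw [htop]; exact le_top
  obtain ⟨hac, hint⟩ := klDiv_ne_top_iff.1 htop
  have hγ2 := memLp_eval_of_isGaussian γ
  -- a degenerate `ξ` lives on a hyperplane, which `μ` does not, so `KL(μ, ξ)` would be infinite
  have hξ : IsNondegenerate ξ := hμ.of_absolutelyContinuous hac
  have hγ : IsNondegenerate γ := fun a ha => by
    rw [variance_linear_combination hγ2]
    simp only [hc]
    rw [← variance_linear_combination hμ2]
    exact hμ a ha
  obtain ⟨q, hq, hqγ⟩ := IsGaussian.exists_density γ hγ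
  obtain ⟨r, hr, hrξ⟩ := IsGaussian.exists_density ξ hξ
  set Q : (Fin m → ℝ) → ℝ := fun x => q x - r x with hQdef
  have hQ : IsQuadratic Q := hq.sub hr
  have hqm := hq.measurable
  have hrm := hr.measurable
  have hQm := hQ.measurable
  have hγξ : γ = ξ.withDensity fun x => ENNReal.ofReal (Real.exp (Q x)) := by
    rw [hqγ]
    conv_rhs => rw [hrξ]
    rw [← withDensity_mul _ (by fun_prop) (by fun_prop)]
    congr 1
    ext x
    rw [Pi.mul_apply, ← ENNReal.ofReal_mul (Real.exp_nonneg _), ← Real.exp_add, hQdef]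
    ring_nf
  have hone : ∫⁻ x, ENNReal.ofReal (Real.exp (Q x)) ∂ξ = 1 := by
    rw [← setLIntegral_univ, ← withDensity_apply _ MeasurableSet.univ, ← hγξ, measure_univ]
  have hexp : Integrable (fun x => Real.exp (Q x)) ξ := by
    refine (lintegral_ofReal_ne_top_iff_integrable (by fun_prop)
      (Filter.Eventually.of_forall fun _ => Real.exp_nonneg _)).1 ?_
    rw [hone]; exact ENNReal.one_ne_top
  have hone' : ∫ x, Real.exp (Q x) ∂ξ = 1 := by
    rw [integral_eq_lintegral_of_nonneg_ae
      (Filter.Eventually.of_forall fun _ => Real.exp_nonneg _) (by fun_prop), hone]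
    simp
  -- as an exponential tilt of `ξ`, `γ` has the log-likelihood ratios `Q` to `ξ` and, under `μ`,
  -- `llr μ ξ - Q` from `μ`
  have htilt : ξ.tilted Q = γ := by
    rw [Measure.tilted, hone']
    simp only [div_one]
    exact hγξ.symm
  have hξγ : ξ ≪ γ := htilt ▸ absolutelyContinuous_tilted hexp
  have hγξ' : γ ≪ ξ := htilt ▸ tilted_absolutelyContinuous ξ Q
  have hl1 : llr μ γ =ᵐ[μ] fun x => llr μ ξ x - Q x := by
    have := llr_tilted_right hac hexp
    rw [htilt, hone'] at this
    filter_upwards [this] with x hx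
    rw [hx, Real.log_one]; ring
  have hl2 : llr γ ξ =ᵐ[γ] Q := by
    have := log_rnDeriv_tilted_left_self hexp
    rw [htilt, hone'] at this
    filter_upwards [hγξ'.ae_le this] with x hx
    rw [llr, hx, Real.log_one, sub_zero]
  have hQμ := hQ.integrable hμ2
  have hQγ := hQ.integrable hγ2
  have hi1 : Integrable (llr μ γ) μ := (integrable_congr hl1).2 (hint.sub hQμ)
  have hi2 : Integrable (llr γ ξ) γ := (integrable_congr hl2).2 hQγ
  have hacγ : μ ≪ γ := hac.trans hξγ
  have hn1 := klDiv_ne_top hacγ hi1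
  have hn2 := klDiv_ne_top hγξ' hi2
  have hsum : (klDiv μ γ).toReal + (klDiv γ ξ).toReal = (klDiv μ ξ).toReal := by
    rw [toReal_klDiv_of_measure_eq hacγ (by simp), toReal_klDiv_of_measure_eq hγξ' (by simp),
      toReal_klDiv_of_measure_eq hac (by simp), integral_congr_ae hl1, integral_congr_ae hl2,
      integral_sub hint hQμ, hQ.integral_eq hμ2 hγ2 (fun i => (hm i).symm)
        fun i j => (hc i j).symm]
    ring
  refine le_of_eq ?_
  rw [← ENNReal.toReal_eq_toReal_iff' (ENNReal.add_ne_top.2 ⟨hn1, hn2⟩) htop,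
    ENNReal.toReal_add hn1 hn2, hsum]

end Pythagoras

/-! ### Bounds on the Kullback–Leibler divergence -/

section Variational

variable {α : Type*} [MeasurableSpace α]

/-- A variational lower bound for the Kullback–Leibler divergence. It is the Fenchel–Young
inequality `r * y ≤ r * log r - r + exp y`, integrated with `r = dμ/dν` and `y = g`. -/
theorem ofReal_integral_sub_le_klDiv (μ ν : Measure α) [IsProbabilityMeasure μ]
    [IsProbabilityMeasure ν] {g : α → ℝ} (hg : Measurable g) {C : ℝ} (hC : ∀ x, |g x| ≤ C) :
    ENNReal.ofReal (∫ x, g x ∂μ - ∫ x, (Real.exp (g x) - 1) ∂ν) ≤ klDiv μ ν := by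
  by_cases htop : klDiv μ ν = ∞
  · rw [htop]; exact le_top
  obtain ⟨hac, hint⟩ := klDiv_ne_top_iff.1 htop
  refine ENNReal.ofReal_le_of_le_toReal ?_
  rw [toReal_klDiv_eq_integral_klFun hac]
  have hr : Integrable (fun x => (μ.rnDeriv ν x).toReal) ν := Measure.integrable_toReal_rnDeriv
  have h1 : ∫ x, g x ∂μ = ∫ x, (μ.rnDeriv ν x).toReal * g x ∂ν := by
    rw [← integral_rnDeriv_smul hac]; rfl
  have hi1 : Integrable (fun x => (μ.rnDeriv ν x).toReal * g x) ν :=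
    hr.mul_bdd (c := C) hg.aestronglyMeasurable (Filter.Eventually.of_forall hC)
  have hi2 : Integrable (fun x => Real.exp (g x) - 1) ν := by
    refine Integrable.sub (Integrable.of_bound (by fun_prop) (Real.exp C)
      (Filter.Eventually.of_forall fun x => ?_)) (integrable_const _)
    rw [Real.norm_of_nonneg (Real.exp_nonneg _)]
    exact Real.exp_le_exp.2 ((le_abs_self _).trans (hC x))
  rw [h1, ← integral_sub hi1 hi2]
  refine integral_mono (hi1.sub hi2) ((integrable_klFun_rnDeriv_iff hac).2 hint) fun x => ?_
  have hrn : 0 ≤ (μ.rnDeriv ν x).toReal := ENNReal.toReal_nonneg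
  set r := (μ.rnDeriv ν x).toReal
  simp only [klFun_apply]
  rcases hrn.eq_or_lt with h0 | h0
  · rw [← h0]; simp; exact Real.exp_nonneg _
  · have h2 := Real.add_one_le_exp (g x - Real.log r)
    rw [Real.exp_sub, Real.exp_log h0, le_div_iff₀ h0] at h2
    nlinarith

/-- If the variational lower bounds on `KL(μ, ν)` given by bounded continuous functions are all
nonpositive then `μ = ν`. -/
theorem eq_of_forall_integral_le {E : Type*} [TopologicalSpace E] [MeasurableSpace E]
    [BorelSpace E] [HasOuterApproxClosed E] (μ ν : Measure E) [IsProbabilityMeasure μ]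
    [IsProbabilityMeasure ν]
    (h : ∀ g : BoundedContinuousFunction E ℝ,
      ∫ x, g x ∂μ ≤ ∫ x, (Real.exp (g x) - 1) ∂ν) : μ = ν := by
  have key : ∀ g : BoundedContinuousFunction E ℝ, ∫ x, g x ∂μ ≤ ∫ x, g x ∂ν := by
    intro g
    -- replace `g` by `ε g` and let `ε` tend to `0`
    have hb : ∀ ε : ℝ, 0 < ε → ε ≤ (‖g‖ + 1)⁻¹ →
        ∫ x, g x ∂μ ≤ ∫ x, g x ∂ν + ε * ‖g‖ ^ 2 := by
      intro ε hε hε1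
      have h1 := h (ε • g)
      have hgi : Integrable g ν := g.integrable ν
      have hpt : ∀ x, Real.exp ((ε • g) x) - 1 ≤ ε * g x + ε ^ 2 * ‖g‖ ^ 2 := fun x => by
        have hgx : |g x| ≤ ‖g‖ := g.norm_coe_le_norm x
        have hle : |ε * g x| ≤ 1 := by
          rw [abs_mul, abs_of_pos hε]
          calc ε * |g x| ≤ (‖g‖ + 1)⁻¹ * (‖g‖ + 1) := by
                gcongr; linarith
            _ = 1 := inv_mul_cancel₀ (by positivity)
        have h3 := Real.abs_exp_sub_one_sub_id_le hle
        have h4 := (abs_le.1 h3).2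
        have h5 : (g x) ^ 2 ≤ ‖g‖ ^ 2 := sq_le_sq' (by linarith [abs_le.1 hgx]) (abs_le.1 hgx).2
        simp only [BoundedContinuousFunction.coe_smul, smul_eq_mul]
        nlinarith [mul_le_mul_of_nonneg_left h5 (sq_nonneg ε)]
      have h6 : ∫ x, (Real.exp ((ε • g) x) - 1) ∂ν ≤ ∫ x, (ε * g x + ε ^ 2 * ‖g‖ ^ 2) ∂ν := by
        refine integral_mono ?_ ((hgi.const_mul _).add (integrable_const _)) hpt
        refine Integrable.sub (Integrable.of_bound ?_ (Real.exp ‖ε • g‖)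
          (Filter.Eventually.of_forall fun x => ?_)) (integrable_const _)
        · exact (Real.continuous_exp.comp (ε • g).continuous).aestronglyMeasurable
        · rw [Real.norm_of_nonneg (Real.exp_nonneg _)]
          exact Real.exp_le_exp.2 ((le_abs_self _).trans ((ε • g).norm_coe_le_norm x))
      rw [integral_add (hgi.const_mul _) (integrable_const _), integral_const_mul] at h6
      simp only [integral_const, probReal_univ, smul_eq_mul, one_mul] at h6
      have h7 : ∫ x, (ε • g) x ∂μ = ε * ∫ x, g x ∂μ := by
        simp only [BoundedContinuousFunction.coe_smul, smul_eq_mul, integral_const_mul]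
      rw [h7] at h1
      have := h1.trans h6
      nlinarith
    have hlim : Filter.Tendsto (fun ε : ℝ => ∫ x, g x ∂ν + ε * ‖g‖ ^ 2) (𝓝[>] 0)
        (𝓝 (∫ x, g x ∂ν)) := by
      have : Continuous fun ε : ℝ => ∫ x, g x ∂ν + ε * ‖g‖ ^ 2 := by fun_prop
      have := (this.tendsto 0).mono_left (nhdsWithin_le_nhds (s := Set.Ioi 0))
      simpa using this
    refine ge_of_tendsto hlim ?_
    filter_upwards [Ioc_mem_nhdsGT (show (0 : ℝ) < (‖g‖ + 1)⁻¹ by positivity)] with ε hε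
    exact hb ε hε.1 hε.2
  refine ext_of_forall_integral_eq_of_IsFiniteMeasure fun g => le_antisymm (key g) ?_
  have := key (-g)
  simp only [BoundedContinuousFunction.coe_neg, Pi.neg_apply, integral_neg] at this
  linarith

/-- A density bounded by `exp Q` gives a bound on the Kullback–Leibler divergence. -/
theorem klDiv_withDensity_le {ξ : Measure α} [IsProbabilityMeasure ξ] {R : α → ℝ≥0∞}
    (hR : Measurable R) [IsProbabilityMeasure (ξ.withDensity R)] {Q : α → ℝ} (hQ : Measurable Q)
    (hQ0 : ∀ x, 0 ≤ Q x) (hRQ : ∀ x, R x ≤ ENNReal.ofReal (Real.exp (Q x))) :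
    klDiv (ξ.withDensity R) ξ ≤ ∫⁻ x, ENNReal.ofReal (Q x) ∂(ξ.withDensity R) + 1 := by
  rw [klDiv_eq_lintegral_klFun_of_ac (withDensity_absolutelyContinuous _ _),
    lintegral_withDensity_eq_lintegral_mul _ hR hQ.ennreal_ofReal]
  have h1 : (1 : ℝ≥0∞) = ∫⁻ _, 1 ∂ξ := by simp
  conv_rhs => rw [h1]
  rw [← lintegral_add_right _ measurable_const]
  refine lintegral_mono_ae ?_
  filter_upwards [Measure.rnDeriv_withDensity ξ hR] with x hx
  rw [hx, Pi.mul_apply]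
  have hfin : R x ≠ ∞ := ne_top_of_le_ne_top ENNReal.ofReal_ne_top (hRQ x)
  have hle : (R x).toReal ≤ Real.exp (Q x) :=
    ENNReal.toReal_le_of_le_ofReal (Real.exp_nonneg _) (hRQ x)
  have h0 : 0 ≤ (R x).toReal := ENNReal.toReal_nonneg
  have hk : klFun (R x).toReal ≤ (R x).toReal * Q x + 1 := by
    rw [klFun_apply]
    rcases h0.eq_or_lt with h | h
    · rw [← h]; simp
    · have := (Real.log_le_iff_le_exp h).2 hle
      nlinarith [mul_le_mul_of_nonneg_left this h0]
  calc ENNReal.ofReal (klFun (R x).toReal) ≤ ENNReal.ofReal ((R x).toReal * Q x + 1) :=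
        ENNReal.ofReal_le_ofReal hk
    _ = R x * ENNReal.ofReal (Q x) + 1 := by
        rw [ENNReal.ofReal_add (mul_nonneg h0 (hQ0 x)) zero_le_one, ENNReal.ofReal_mul h0,
          ENNReal.ofReal_toReal hfin, ENNReal.ofReal_one]

end Variational

/-! ### White noise -/

section WhiteNoise

variable (T : Type*) (v : ℝ≥0)

/-- The law of independent centred Gaussian variables of variance `v`, indexed by a set `T` which
may be uncountable. -/
noncomputable def whiteNoise : Measure (T → ℝ) := Measure.infinitePi fun _ : T => gaussianReal 0 v

instance : IsProbabilityMeasure (whiteNoise T v) := by unfold whiteNoise; infer_instance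

variable {T}

theorem measurePreserving_eval_whiteNoise (t : T) :
    MeasurePreserving (fun z : T → ℝ => z t) (whiteNoise T v) (gaussianReal 0 v) :=
  measurePreserving_eval_infinitePi (fun _ : T => gaussianReal 0 v) t

theorem memLp_whiteNoise (t : T) : MemLp (fun z : T → ℝ => z t) 2 (whiteNoise T v) :=
  (memLp_id_gaussianReal' 2 (by norm_num)).comp_measurePreserving
    (measurePreserving_eval_whiteNoise v t)

theorem integral_whiteNoise (t : T) : ∫ z : T → ℝ, z t ∂(whiteNoise T v) = 0 := by
  have hmp := measurePreserving_eval_whiteNoise v t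
  have h := integral_map (μ := whiteNoise T v) (f := fun x : ℝ => x) hmp.measurable.aemeasurable
    aestronglyMeasurable_id
  rw [hmp.map_eq, integral_id_gaussianReal] at h
  exact h.symm

theorem covariance_whiteNoise [DecidableEq T] (s t : T) :
    covariance (fun z : T → ℝ => z s) (fun z => z t) (whiteNoise T v) =
      if s = t then (v : ℝ) else 0 := by
  have hmp := measurePreserving_eval_whiteNoise v t
  split_ifs with h
  · subst h
    rw [covariance_self hmp.measurable.aemeasurable,
      ← variance_id_map hmp.measurable.aemeasurable, hmp.map_eq]
    simp
  · have := (iIndepFun_infinitePi (P := fun _ : T => gaussianReal 0 v) (X := fun _ x => x)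
      (fun i => measurable_id)).indepFun h
    exact this.covariance_eq_zero (memLp_whiteNoise v s) (memLp_whiteNoise v t)

theorem isGaussianProcess_whiteNoise :
    IsGaussianProcess (fun (t : T) (z : T → ℝ) => z t) (whiteNoise T v) := by
  refine ⟨fun I => ⟨?_⟩⟩
  change IsGaussian ((whiteNoise T v).map I.restrict)
  rw [whiteNoise, Measure.infinitePi_map_restrict]
  exact isGaussian_pi_gaussianReal v

end WhiteNoise

/-! ### Gaussian families with prescribed covariances -/

section GramSchmidt

variable {H : Type*} [NormedAddCommGroup H] [InnerProductSpace ℝ H]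

/-- Every sequence of vectors is a lower triangular combination of orthogonal vectors. -/
theorem exists_triangular (u : ℕ → H) : ∃ (c : ℕ → ℕ → ℝ) (g : ℕ → H),
    (∀ k l, k ≠ l → inner ℝ (g k) (g l) = 0) ∧
      ∀ n, u n = ∑ k ∈ Finset.range (n + 1), c n k • g k := by
  let g := InnerProductSpace.gramSchmidt ℝ u
  refine ⟨fun n k => if k = n then 1 else inner ℝ (g k) (u n) / ‖g k‖ ^ 2, g,
    fun k l h => InnerProductSpace.gramSchmidt_orthogonal ℝ u h, fun n => ?_⟩
  have h := InnerProductSpace.gramSchmidt_def'' ℝ u n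
  rw [Finset.sum_range_succ]
  simp only [if_true, one_smul]
  conv_lhs => rw [h]
  rw [add_comm]
  congr 1
  have : Finset.Iio n = Finset.range n := by ext; simp
  rw [this]
  refine Finset.sum_congr rfl fun k hk => ?_
  rw [if_neg (Finset.mem_range.1 hk).ne]
  rfl

/-- For a countable family of vectors in a Hilbert space there are jointly Gaussian centred
variables whose covariances are the inner products of the vectors. -/
theorem exists_gaussian_of_inner {Q : Type*} [Denumerable Q] (u : Q → H) :
    ∃ X : Q → (ℕ → ℝ) → ℝ, (∀ q, Measurable (X q)) ∧
      IsGaussianProcess X (whiteNoise ℕ 1) ∧ (∀ q, ∫ z, X q z ∂(whiteNoise ℕ 1) = 0) ∧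
      ∀ p q, covariance (X p) (X q) (whiteNoise ℕ 1) = inner ℝ (u p) (u q) := by
  let e := Denumerable.eqv Q
  obtain ⟨c, g, hg, hu⟩ := exists_triangular fun n => u (e.symm n)
  have hu' : ∀ q, u q = ∑ k ∈ Finset.range (e q + 1), c (e q) k • g k := fun q => by
    rw [← hu, Equiv.symm_apply_apply]
  have h2 := memLp_whiteNoise (T := ℕ) 1
  -- replace the orthogonal vector `g k` by the variable `‖g k‖ * z k` of the same norm
  refine ⟨fun q z => ∑ k ∈ Finset.range (e q + 1), (c (e q) k * ‖g k‖) * z k,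
    fun q => by fun_prop, ?_, fun q => ?_, fun p q => ?_⟩
  · refine IsGaussianProcess.of_isGaussianProcess (isGaussianProcess_whiteNoise (T := ℕ) 1) fun q =>
      ⟨Finset.range (e q + 1), ∑ k : Finset.range (e q + 1),
        (c (e q) k * ‖g k‖) • ContinuousLinearMap.proj k, fun z => ?_⟩
    simp only [sum_apply, smul_apply,
      ContinuousLinearMap.proj_apply, smul_eq_mul, Finset.restrict_def]
    exact (Finset.sum_coe_sort _ fun k => c (e q) k * ‖g k‖ * z k).symm
  · rw [integral_finsetSum _ fun k _ => ((h2 k).integrable (by norm_num)).const_mul _]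
    simp only [integral_const_mul, integral_whiteNoise, mul_zero, Finset.sum_const_zero]
  · rw [covariance_fun_sum_fun_sum' (fun k _ => (h2 k).const_mul _)
      (fun k _ => (h2 k).const_mul _), hu' p, hu' q, sum_inner]
    refine Finset.sum_congr rfl fun k _ => ?_
    rw [inner_sum]
    refine Finset.sum_congr rfl fun l _ => ?_
    rw [covariance_const_mul_left, covariance_const_mul_right, covariance_whiteNoise,
      real_inner_smul_left, real_inner_smul_right]
    split_ifs with h
    · subst h
      rw [real_inner_self_eq_norm_sq]
      push_cast
      ring
    · rw [hg k l h]; ring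

end GramSchmidt

/-! ### Continuous Gaussian processes -/

section Chaining

/-- The dyadic approximation of level `n` from below. -/
noncomputable def dyadicFloor (n : ℕ) (t : ℝ) : ℚ := (⌊(2 : ℝ) ^ n * t⌋ : ℚ) / 2 ^ n

theorem abs_dyadicFloor_sub_le (n : ℕ) (t : ℝ) : |(dyadicFloor n t : ℝ) - t| ≤ (1 / 2) ^ n := by
  have h1 := Int.floor_le ((2 : ℝ) ^ n * t)
  have h2 := Int.lt_floor_add_one ((2 : ℝ) ^ n * t)
  have hp : (0 : ℝ) < 2 ^ n := by positivity
  have : (dyadicFloor n t : ℝ) - t = -((2 ^ n * t - ⌊(2 : ℝ) ^ n * t⌋) / 2 ^ n) := by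
    simp only [dyadicFloor, Rat.cast_div, Rat.cast_intCast, Rat.cast_pow, Rat.cast_ofNat]
    field_simp
    ring
  rw [this, abs_neg, abs_of_nonneg (by apply div_nonneg <;> linarith), div_pow, one_pow]
  gcongr
  linarith

theorem tendsto_dyadicFloor (t : ℝ) :
    Filter.Tendsto (fun n => (dyadicFloor n t : ℝ)) Filter.atTop (𝓝 t) := by
  rw [tendsto_iff_dist_tendsto_zero]
  refine squeeze_zero (fun _ => dist_nonneg) (fun n => abs_dyadicFloor_sub_le n t) ?_
  exact tendsto_pow_atTop_nhds_zero_of_lt_one (by norm_num) (by norm_num)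

/-- If the increments of `X` between neighbouring dyadic numbers decay geometrically in the level,
locally uniformly, then `X` extends to a continuous function. -/
theorem exists_continuous_extension {X : ℚ → ℝ} {ρ : ℝ} (h0 : 0 < ρ) (h1 : ρ < 1) (n₀ : ℕ)
    (h : ∀ K : ℕ, ∃ A : ℝ, 0 ≤ A ∧ ∀ n ≥ n₀, ∀ i : ℤ, |i| ≤ K * 2 ^ n →
      |X ((i + 1 : ℤ) / 2 ^ n) - X ((i : ℤ) / 2 ^ n)| ≤ A * ρ ^ n) :
    ∃ G : ℝ → ℝ, Continuous G ∧
      ∀ t, Filter.Tendsto (fun n => X (dyadicFloor n t)) Filter.atTop (𝓝 (G t)) := by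
  have hfloor : ∀ (K : ℕ) (n : ℕ) (t : ℝ), |t| + 1 ≤ K → |⌊(2 : ℝ) ^ n * t⌋| ≤ K * 2 ^ n := by
    intro K n t ht
    have h2 : (1 : ℝ) ≤ 2 ^ n := one_le_pow₀ (by norm_num)
    have e1 := Int.floor_le ((2 : ℝ) ^ n * t)
    have e2 := Int.lt_floor_add_one ((2 : ℝ) ^ n * t)
    have e3 := abs_le.1 (show |t| ≤ K - 1 by linarith)
    have : |(⌊(2 : ℝ) ^ n * t⌋ : ℝ)| ≤ K * 2 ^ n := by
      rw [abs_le]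
      constructor <;> nlinarith
    exact_mod_cast this
  have hstep : ∀ (K : ℕ) (A : ℝ), 0 ≤ A → (∀ n ≥ n₀, ∀ i : ℤ, |i| ≤ K * 2 ^ n →
      |X ((i + 1 : ℤ) / 2 ^ n) - X ((i : ℤ) / 2 ^ n)| ≤ A * ρ ^ n) → ∀ t : ℝ, |t| + 1 ≤ K →
      ∀ n, dist (X (dyadicFloor (n + n₀) t)) (X (dyadicFloor (n + 1 + n₀) t)) ≤
        A * ρ ^ n₀ * ρ ^ n := by
    intro K A hA hX t ht n
    have hle : A * ρ ^ (n + n₀ + 1) ≤ A * ρ ^ n₀ * ρ ^ n := by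
      have : ρ ^ (n + n₀ + 1) ≤ ρ ^ n₀ * ρ ^ n := by
        rw [← pow_add]
        exact pow_le_pow_of_le_one h0.le h1.le (by omega)
      nlinarith
    refine le_trans ?_ hle
    have hi := hfloor K (n + n₀) t ht
    set i := ⌊(2 : ℝ) ^ (n + n₀) * t⌋ with hidef
    have e1 : (i : ℝ) ≤ (2 : ℝ) ^ (n + n₀) * t := Int.floor_le _
    have e2 : (2 : ℝ) ^ (n + n₀) * t < i + 1 := Int.lt_floor_add_one _
    have hq : dyadicFloor (n + n₀) t = ((2 * i : ℤ) : ℚ) / 2 ^ (n + n₀ + 1) := by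
      rw [dyadicFloor, ← hidef]
      push_cast
      rw [pow_succ]
      field_simp
    -- the dyadic floors of two consecutive levels are equal or neighbours at the finer level
    have hcase : ⌊(2 : ℝ) ^ (n + n₀ + 1) * t⌋ = 2 * i ∨
        ⌊(2 : ℝ) ^ (n + n₀ + 1) * t⌋ = 2 * i + 1 := by
      have e3 : (2 : ℝ) ^ (n + n₀ + 1) * t = 2 * (2 ^ (n + n₀) * t) := by ring
      rw [e3]
      by_cases hc : 2 * (2 ^ (n + n₀) * t) < 2 * i + 1
      · left; rw [Int.floor_eq_iff]; push_cast; constructor <;> linarith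
      · right; rw [Int.floor_eq_iff]; push_cast; constructor <;> linarith
    have hq' : dyadicFloor (n + 1 + n₀) t =
        ((⌊(2 : ℝ) ^ (n + n₀ + 1) * t⌋ : ℤ) : ℚ) / 2 ^ (n + n₀ + 1) := by
      rw [dyadicFloor, show n + 1 + n₀ = n + n₀ + 1 by ring]
    rw [hq, hq']
    rcases hcase with hc | hc <;> rw [hc]
    · rw [dist_self]; positivity
    · rw [dist_comm, Real.dist_eq]
      refine hX _ (by omega) _ ?_
      rw [abs_mul, pow_succ]
      have : (|2| : ℤ) = 2 := rfl
      rw [this]; linarith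
  have hex : ∀ t, ∃ g, Filter.Tendsto (fun n => X (dyadicFloor n t)) Filter.atTop (𝓝 g) := by
    intro t
    obtain ⟨K, hK⟩ := exists_nat_ge (|t| + 1)
    obtain ⟨A, hA, hX⟩ := h K
    obtain ⟨g, hg⟩ := cauchySeq_tendsto_of_complete
      (cauchySeq_of_le_geometric ρ _ h1 (hstep K A hA hX t hK))
    exact ⟨g, (Filter.tendsto_add_atTop_iff_nat n₀).1 hg⟩
  choose G hG using hex
  refine ⟨G, ?_, hG⟩
  rw [continuous_iff_continuousAt]
  intro t
  obtain ⟨K, hK⟩ := exists_nat_ge (|t| + 1 + 1)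
  obtain ⟨A, hA, hX⟩ := h K
  have happrox : ∀ s : ℝ, |s| + 1 ≤ K → ∀ n,
      dist (X (dyadicFloor (n + n₀) s)) (G s) ≤ A * ρ ^ n₀ * ρ ^ n / (1 - ρ) := fun s hs n =>
    dist_le_of_le_geometric_of_tendsto ρ _ h1 (hstep K A hA hX s hs)
      ((Filter.tendsto_add_atTop_iff_nat n₀).2 (hG s)) n
  have hnear : ∀ s s' : ℝ, |s| + 1 ≤ K → s ≤ s' → ∀ n, s' - s < (1 / 2) ^ (n + n₀) →
      dist (X (dyadicFloor (n + n₀) s)) (X (dyadicFloor (n + n₀) s')) ≤ A * ρ ^ (n + n₀) := by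
    intro s s' hs hss n hn
    have hp : (0 : ℝ) < 2 ^ (n + n₀) := by positivity
    have e0 : (2 : ℝ) ^ (n + n₀) * s' < 2 ^ (n + n₀) * s + 1 := by
      have := mul_lt_mul_of_pos_left hn hp
      rw [div_pow, one_pow, mul_one_div_cancel hp.ne'] at this
      linarith
    have e0' : (2 : ℝ) ^ (n + n₀) * s ≤ 2 ^ (n + n₀) * s' := by gcongr
    have hi := hfloor K (n + n₀) s hs
    set i := ⌊(2 : ℝ) ^ (n + n₀) * s⌋ with hidef
    have e1 : (i : ℝ) ≤ (2 : ℝ) ^ (n + n₀) * s := Int.floor_le _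
    have e2 : (2 : ℝ) ^ (n + n₀) * s < i + 1 := Int.lt_floor_add_one _
    have hcase : ⌊(2 : ℝ) ^ (n + n₀) * s'⌋ = i ∨ ⌊(2 : ℝ) ^ (n + n₀) * s'⌋ = i + 1 := by
      by_cases hc : (2 : ℝ) ^ (n + n₀) * s' < i + 1
      · left; rw [Int.floor_eq_iff]; constructor <;> linarith
      · right; rw [Int.floor_eq_iff]; push_cast; constructor <;> linarith
    rw [dyadicFloor, dyadicFloor, ← hidef]
    rcases hcase with hc | hc <;> rw [hc]
    · rw [dist_self]; positivity
    · rw [dist_comm, Real.dist_eq]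
      exact hX _ (by omega) _ hi
  rw [Metric.continuousAt_iff]
  intro ε hε
  have hlim : Filter.Tendsto (fun n : ℕ => 2 * (A * ρ ^ n₀ * ρ ^ n / (1 - ρ)) + A * ρ ^ (n + n₀))
      Filter.atTop (𝓝 0) := by
    have hρ := tendsto_pow_atTop_nhds_zero_of_lt_one h0.le h1
    have l1 := ((hρ.const_mul (A * ρ ^ n₀)).div_const (1 - ρ)).const_mul 2
    have l2 := ((Filter.tendsto_add_atTop_iff_nat n₀).2 hρ).const_mul A
    simpa using l1.add l2
  obtain ⟨n, hn⟩ := (hlim.eventually (gt_mem_nhds hε)).exists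
  refine ⟨min 1 ((1 / 2) ^ (n + n₀)), by positivity, fun s hs => ?_⟩
  rw [Real.dist_eq] at hs
  have hs1 := lt_of_lt_of_le hs (min_le_left _ _)
  have hs2 := lt_of_lt_of_le hs (min_le_right _ _)
  have hsK : |s| + 1 ≤ K := by
    have : |s| ≤ |s - t| + |t| := by
      have := abs_add_le (s - t) t
      rwa [sub_add_cancel] at this
    linarith
  have htK : |t| + 1 ≤ K := by linarith
  have hd : dist (X (dyadicFloor (n + n₀) s)) (X (dyadicFloor (n + n₀) t)) ≤ A * ρ ^ (n + n₀) := by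
    rcases le_total s t with hst | hst
    · refine hnear s t hsK hst n ?_
      rw [abs_sub_comm] at hs2
      exact lt_of_le_of_lt (le_abs_self _) hs2
    · rw [dist_comm]
      exact hnear t s htK hst n (lt_of_le_of_lt (le_abs_self _) hs2)
  calc dist (G s) (G t) ≤ dist (G s) (X (dyadicFloor (n + n₀) s)) +
        dist (X (dyadicFloor (n + n₀) s)) (X (dyadicFloor (n + n₀) t)) +
        dist (X (dyadicFloor (n + n₀) t)) (G t) := dist_triangle4 _ _ _ _
    _ ≤ 2 * (A * ρ ^ n₀ * ρ ^ n / (1 - ρ)) + A * ρ ^ (n + n₀) := by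
        have a1 := happrox s hsK n
        have a2 := happrox t htK n
        rw [dist_comm (G s)]
        linarith
    _ < ε := hn

/-- The second-moment bound of Kolmogorov's continuity criterion controls the increments over
neighbouring dyadic numbers almost surely. The exponent `2 * β` exceeds `1`, which is what `ρ < 1`
says: the geometric decay `ρ ^ 3` of the expected sum of squares per level is spent on the bound
`ρ ^ (2 * n)` of the squared increments and on a summable factor `ρ ^ n`. -/
theorem ae_dyadic_increments {Ω : Type*} [MeasurableSpace Ω] {P : Measure Ω}
    {X : ℚ → Ω → ℝ} (hX : ∀ q, Measurable (X q)) {C r β ρ : ℝ} (hr : 0 < r) (hC : 0 ≤ C)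
    (hρ0 : 0 < ρ) (hρ1 : ρ < 1) (hρ : ρ ^ 3 = 2 * (1 / 2 : ℝ) ^ (2 * β))
    (h : ∀ p q : ℚ, |(p : ℝ) - q| < r →
      ∫⁻ ω, ENNReal.ofReal ((X p ω - X q ω) ^ 2) ∂P ≤
        ENNReal.ofReal (C * |(p : ℝ) - q| ^ (2 * β))) :
    ∃ n₀ : ℕ, ∀ᵐ ω ∂P, ∀ K : ℕ, ∃ A : ℝ, 0 ≤ A ∧ ∀ n ≥ n₀, ∀ i : ℤ, |i| ≤ K * 2 ^ n →
      |X ((i + 1 : ℤ) / 2 ^ n) ω - X ((i : ℤ) / 2 ^ n) ω| ≤ A * ρ ^ n := by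
  obtain ⟨n₀, hn₀⟩ := exists_pow_lt_of_lt_one hr (show (1 / 2 : ℝ) < 1 by norm_num)
  refine ⟨n₀, ae_all_iff.2 fun K => ?_⟩
  let I : ℕ → Finset ℤ := fun n => Finset.Icc (-(K * 2 ^ n)) (K * 2 ^ n)
  let d : ℕ → ℤ → Ω → ℝ≥0∞ := fun n i ω =>
    ENNReal.ofReal ((X ((i + 1 : ℤ) / 2 ^ n) ω - X ((i : ℤ) / 2 ^ n) ω) ^ 2)
  have hd : ∀ n i, Measurable (d n i) := fun n i =>
    (((hX _).sub (hX _)).pow_const 2).ennreal_ofReal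
  -- the sum of the squared increments of level `n`, normalised by their intended bound
  let T : ℕ → Ω → ℝ≥0∞ := fun n ω => (∑ i ∈ I n, d n i ω) * ENNReal.ofReal ((ρ ^ (2 * n))⁻¹)
  have hT : ∀ n, Measurable (T n) := fun n =>
    (Finset.measurable_fun_sum _ fun i _ => hd n i).mul_const _
  have hint : ∀ n ≥ n₀, ∫⁻ ω, T n ω ∂P ≤ ENNReal.ofReal ((2 * K + 1) * C * ρ ^ n) := by
    intro n hn
    have hdi : ∀ i, ∫⁻ ω, d n i ω ∂P ≤ ENNReal.ofReal (C * ((1 / 2 : ℝ) ^ (2 * β)) ^ n) := by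
      intro i
      have e : |((((i + 1 : ℤ) : ℚ) / 2 ^ n : ℚ) : ℝ) - (((i : ℤ) : ℚ) / 2 ^ n : ℚ)| =
          (1 / 2) ^ n := by
        push_cast
        rw [← sub_div, add_sub_cancel_left, abs_of_nonneg (by positivity), div_pow, one_pow]
      have hlt : (1 / 2 : ℝ) ^ n < r :=
        lt_of_le_of_lt (pow_le_pow_of_le_one (by norm_num) (by norm_num) hn) hn₀
      refine (h _ _ (by rw [e]; exact hlt)).trans (le_of_eq ?_)
      rw [e, ← Real.rpow_natCast, ← Real.rpow_natCast, ← Real.rpow_mul (by norm_num),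
        ← Real.rpow_mul (by norm_num), mul_comm (n : ℝ)]
    rw [lintegral_mul_const _ (Finset.measurable_fun_sum _ fun i _ => hd n i),
      lintegral_finsetSum _ fun i _ => hd n i]
    have hcard : ((I n).card : ℝ) ≤ (2 * K + 1) * 2 ^ n := by
      have h2 : (1 : ℝ) ≤ 2 ^ n := one_le_pow₀ (by norm_num)
      have : ((I n).card : ℤ) = 2 * (K * 2 ^ n) + 1 := by
        simp only [I, Int.card_Icc]
        have hK : (0 : ℤ) ≤ K * 2 ^ n := by positivity
        rw [Int.toNat_of_nonneg (by omega)]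
        ring
      have : ((I n).card : ℝ) = 2 * (K * 2 ^ n) + 1 := by exact_mod_cast this
      rw [this]; nlinarith
    calc (∑ i ∈ I n, ∫⁻ ω, d n i ω ∂P) * ENNReal.ofReal ((ρ ^ (2 * n))⁻¹)
        ≤ (∑ i ∈ I n, ENNReal.ofReal (C * ((1 / 2 : ℝ) ^ (2 * β)) ^ n)) *
          ENNReal.ofReal ((ρ ^ (2 * n))⁻¹) := by gcongr with i; exact hdi i
      _ = ENNReal.ofReal ((I n).card * (C * ((1 / 2 : ℝ) ^ (2 * β)) ^ n) * (ρ ^ (2 * n))⁻¹) := by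
          rw [Finset.sum_const, nsmul_eq_mul,
            ENNReal.ofReal_mul
              (show 0 ≤ (I n).card * (C * ((1 / 2 : ℝ) ^ (2 * β)) ^ n) by positivity),
            ENNReal.ofReal_mul (Nat.cast_nonneg _), ENNReal.ofReal_natCast]
      _ ≤ _ := by
          refine ENNReal.ofReal_le_ofReal ?_
          have e2 : (2 : ℝ) ^ n * ((1 / 2 : ℝ) ^ (2 * β)) ^ n = ρ ^ n * ρ ^ (2 * n) := by
            rw [← mul_pow, ← hρ, ← pow_mul, ← pow_add]; congr 1; ring
          calc (I n).card * (C * ((1 / 2 : ℝ) ^ (2 * β)) ^ n) * (ρ ^ (2 * n))⁻¹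
              ≤ ((2 * K + 1) * 2 ^ n) * (C * ((1 / 2 : ℝ) ^ (2 * β)) ^ n) *
                (ρ ^ (2 * n))⁻¹ := by gcongr
            _ = (2 * K + 1) * C * (2 ^ n * ((1 / 2 : ℝ) ^ (2 * β)) ^ n) * (ρ ^ (2 * n))⁻¹ := by
                ring
            _ = (2 * K + 1) * C * ρ ^ n := by
                rw [e2]; field_simp
  have hsum : ∫⁻ ω, ∑' n, T (n + n₀) ω ∂P ≠ ∞ := by
    rw [lintegral_tsum fun n => (hT _).aemeasurable]
    have hs : Summable fun n : ℕ => (2 * K + 1) * C * ρ ^ (n + n₀) :=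
      ((summable_nat_add_iff n₀).2 (summable_geometric_of_lt_one hρ0.le hρ1)).mul_left _
    refine ne_top_of_le_ne_top ?_ (ENNReal.tsum_le_tsum fun n => hint (n + n₀) (by omega))
    rw [← ENNReal.ofReal_tsum_of_nonneg (fun n => by positivity) hs]
    exact ENNReal.ofReal_ne_top
  filter_upwards [ae_lt_top (Measurable.tsum fun n => hT _) hsum] with ω hω
  refine ⟨√(∑' n, T (n + n₀) ω).toReal, Real.sqrt_nonneg _, fun n hn i hi => ?_⟩
  have hle : T n ω ≤ ∑' n, T (n + n₀) ω := by
    have := ENNReal.le_tsum (f := fun n => T (n + n₀) ω) (n - n₀)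
    simpa [Nat.sub_add_cancel hn] using this
  have hmem : i ∈ I n := Finset.mem_Icc.2 (abs_le.1 hi)
  have h3 : d n i ω * ENNReal.ofReal ((ρ ^ (2 * n))⁻¹) ≤ ∑' n, T (n + n₀) ω := by
    refine le_trans ?_ hle
    simp only [T]
    gcongr
    exact Finset.single_le_sum (f := fun i => d n i ω) (fun _ _ => zero_le) hmem
  rw [← ENNReal.ofReal_mul (sq_nonneg _), ENNReal.ofReal_le_iff_le_toReal hω.ne,
    mul_inv_le_iff₀ (by positivity), mul_comm 2 n, pow_mul] at h3
  have h4 := Real.abs_le_sqrt h3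
  rwa [Real.sqrt_mul ENNReal.toReal_nonneg, Real.sqrt_sq (by positivity)] at h4

/-- **Existence of continuous Gaussian processes**: for a curve `U` in a Hilbert space that is
locally uniformly Hölder of exponent greater than `1 / 2`, there is a centred Gaussian process with
continuous paths and covariance function `⟪U s, U t⟫`. A Gaussian family with these covariances is
constructed on the rationals and extended by continuity. -/
theorem exists_continuous_gaussianProcess {H : Type*} [NormedAddCommGroup H]
    [InnerProductSpace ℝ H] {U : ℝ → H} {c r β : ℝ} (hr : 0 < r) (hβ : 1 / 2 < β)
    (hU : ∀ s t, |s - t| < r → ‖U s - U t‖ ≤ c * |s - t| ^ β) :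
    ∃ G : ℝ → (ℕ → ℝ) → ℝ, (∀ t, Measurable (G t)) ∧
      (∀ᵐ z ∂(whiteNoise ℕ 1), Continuous fun t => G t z) ∧
      IsGaussianProcess G (whiteNoise ℕ 1) ∧ (∀ t, ∫ z, G t z ∂(whiteNoise ℕ 1) = 0) ∧
      ∀ s t, covariance (G s) (G t) (whiteNoise ℕ 1) = inner ℝ (U s) (U t) := by
  obtain ⟨X, hXm, hXG, hX0, hXc⟩ := exists_gaussian_of_inner fun q : ℚ => U q
  have hX2 : ∀ q, MemLp (X q) 2 (whiteNoise ℕ 1) := fun q =>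
    (hXG.hasGaussianLaw_eval q).memLp_two
  have hUc : Continuous U := by
    rw [continuous_iff_continuousAt]
    intro t
    rw [ContinuousAt, tendsto_iff_norm_sub_tendsto_zero]
    have hlim : Filter.Tendsto (fun s => c * |s - t| ^ β) (𝓝 t) (𝓝 0) := by
      have : Continuous fun s : ℝ => c * |s - t| ^ β := by
        refine continuous_const.mul (Continuous.rpow_const (by fun_prop) fun _ => Or.inr ?_)
        linarith
      have := this.tendsto t
      rwa [sub_self, abs_zero, Real.zero_rpow (by linarith), mul_zero] at this
    refine squeeze_zero' (Filter.Eventually.of_forall fun _ => norm_nonneg _) ?_ hlim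
    filter_upwards [Metric.ball_mem_nhds t hr] with s hs
    exact hU s t (by simpa [Real.dist_eq] using hs)
  have hsq : ∀ p q : ℚ, |(p : ℝ) - q| < r →
      ∫⁻ z, ENNReal.ofReal ((X p z - X q z) ^ 2) ∂(whiteNoise ℕ 1) ≤
        ENNReal.ofReal (c ^ 2 * |(p : ℝ) - q| ^ (2 * β)) := by
    intro p q hpq
    have hL : MemLp (fun z => X p z - X q z) 2 (whiteNoise ℕ 1) := (hX2 p).sub (hX2 q)
    rw [← ofReal_integral_eq_lintegral_ofReal hL.integrable_sq
      (Filter.Eventually.of_forall fun _ => sq_nonneg _)]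
    refine ENNReal.ofReal_le_ofReal ?_
    have hmean : ∫ z, (X p z - X q z) ∂(whiteNoise ℕ 1) = 0 := by
      rw [integral_sub ((hX2 p).integrable (by norm_num)) ((hX2 q).integrable (by norm_num)),
        hX0, hX0, sub_zero]
    have hvar : ∫ z, (X p z - X q z) ^ 2 ∂(whiteNoise ℕ 1) = ‖U p - U q‖ ^ 2 := by
      have := variance_eq_integral hL.aestronglyMeasurable.aemeasurable
      rw [hmean] at this
      simp only [sub_zero] at this
      rw [← this, ← covariance_self hL.aestronglyMeasurable.aemeasurable,
        covariance_fun_sub_fun_sub (hX2 p) (hX2 q) (hX2 p) (hX2 q), hXc, hXc, hXc, hXc,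
        ← real_inner_self_eq_norm_sq, inner_sub_sub_self]
    rw [hvar, mul_comm 2 β, Real.rpow_mul (abs_nonneg _), Real.rpow_two, ← mul_pow]
    exact pow_le_pow_left₀ (norm_nonneg _) (hU p q hpq) 2
  let ρ : ℝ := (1 / 2 : ℝ) ^ ((2 * β - 1) / 3)
  have hρ0 : 0 < ρ := by positivity
  have hρ1 : ρ < 1 := Real.rpow_lt_one (by norm_num) (by norm_num) (by linarith)
  have hρ3 : ρ ^ 3 = 2 * (1 / 2 : ℝ) ^ (2 * β) := by
    rw [← Real.rpow_natCast, ← Real.rpow_mul (by norm_num)]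
    have : (2 * β - 1) / 3 * ((3 : ℕ) : ℝ) = 2 * β - 1 := by push_cast; ring
    rw [this, Real.rpow_sub (by norm_num), Real.rpow_one]
    ring
  obtain ⟨n₀, hn₀⟩ := ae_dyadic_increments hXm hr (sq_nonneg c) hρ0 hρ1 hρ3 hsq
  -- the upper limit is measurable everywhere and agrees with the limit where the latter exists
  let G : ℝ → (ℕ → ℝ) → ℝ := fun t z =>
    Filter.limsup (fun n => X (dyadicFloor n t) z) Filter.atTop
  have hgood : ∀ᵐ z ∂(whiteNoise ℕ 1), (Continuous fun t => G t z) ∧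
      ∀ t, Filter.Tendsto (fun n => X (dyadicFloor n t) z) Filter.atTop (𝓝 (G t z)) := by
    filter_upwards [hn₀] with z hz
    obtain ⟨g, hg, hlim⟩ := exists_continuous_extension (X := fun q => X q z) hρ0 hρ1 n₀ hz
    have : (fun t => G t z) = g := funext fun t => (hlim t).limsup_eq
    exact ⟨this ▸ hg, fun t => by rw [congrFun this t]; exact hlim t⟩
  refine ⟨G, fun t => Measurable.limsup fun n => hXm _, hgood.mono fun z hz => hz.1, ?_⟩
  refine IsGaussianProcess.of_tendsto (X := fun n t => X (dyadicFloor n t))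
    (fun n => hXG.comp_right (dyadicFloor n)) (fun t => hgood.mono fun z hz => hz.2 t)
    (fun t => ?_) (fun s t => ?_)
  · simp only [hX0]; exact tendsto_const_nhds
  · simp only [hXc]
    exact ((hUc.tendsto s).comp (tendsto_dyadicFloor s)).inner
      ((hUc.tendsto t).comp (tendsto_dyadicFloor t))

end Chaining

/-! ### Laws of noisy processes -/

section NoisyLaw

variable {Ω : Type*} [MeasurableSpace Ω]

theorem whiteNoise_map_proj (v : ℝ≥0) {m : ℕ} {x : Fin m → ℝ} (hx : Function.Injective x) :
    (whiteNoise ℝ v).map (proj x) = Measure.pi fun _ => gaussianReal 0 v := by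
  classical
  have hx' : ∀ i j, x i = x j → i = j := fun i j h => hx h
  refine (Measure.pi_eq fun s hs => ?_).symm
  rw [Measure.map_apply (measurable_proj x) (MeasurableSet.univ_pi hs)]
  have hpre : proj x ⁻¹' Set.univ.pi s =
      Set.pi (Finset.univ.image x : Finset ℝ) fun t => {y | ∀ i, x i = t → y ∈ s i} := by
    ext f
    simp [proj, Set.mem_pi]
    exact ⟨fun h a i hi => by rw [← hi]; exact h i, fun h i => h i i rfl⟩
  have hset : ∀ i, {y | ∀ j, x j = x i → y ∈ s j} = s i := fun i => by
    ext y
    exact ⟨fun h => h i rfl, fun h j hj => by rw [hx hj]; exact h⟩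
  rw [hpre, whiteNoise, Measure.infinitePi_pi, Finset.prod_image fun i _ j _ h => hx h]
  · simp only [hset]
  · intro t ht
    obtain ⟨i, -, rfl⟩ := Finset.mem_image.1 ht
    rw [hset]; exact hs i

/-- The noisy part of a noisy process is white noise. -/
theorem IsNoisyDecomposition.map_noise {P : Measure Ω} {fs fn : ℝ → Ω → ℝ} {v : ℝ≥0}
    (h : IsNoisyDecomposition P fs fn v) : P.map (fun ω t => fn t ω) = whiteNoise ℝ v := by
  have hN : Measurable fun ω t => fn t ω := measurable_pi_lambda _ h.measurable_noise
  refine Measure.eq_infinitePi _ fun s t ht => ?_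
  let x : Fin s.card → ℝ := fun i => s.equivFin.symm i
  have hx : Function.Injective x := Subtype.val_injective.comp s.equivFin.symm.injective
  have hm : MeasurableSet (Set.pi (s : Set ℝ) t) :=
    MeasurableSet.pi s.countable_toSet fun i _ => ht i
  rw [Measure.map_apply hN hm]
  have hpre : (fun ω t => fn t ω) ⁻¹' Set.pi (s : Set ℝ) t =
      (fun ω i => fn (x i) ω) ⁻¹' Set.univ.pi fun i => t (x i) := by
    ext ω
    simp only [Set.mem_preimage, Set.mem_pi, Finset.mem_coe, Set.mem_univ, true_implies]
    refine ⟨fun h i => h _ (s.equivFin.symm i).2, fun h a ha => ?_⟩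
    simpa [x] using h (s.equivFin ⟨a, ha⟩)
  rw [hpre, ← Measure.map_apply (measurable_pi_lambda _ fun i => h.measurable_noise _)
    (MeasurableSet.univ_pi fun i => ht _), h.noise_law _ x hx, Measure.pi_pi]
  rw [Equiv.prod_comp s.equivFin.symm fun i : s => gaussianReal 0 v (t i),
    Finset.prod_coe_sort s fun i => gaussianReal 0 v (t i)]

/-- The law of the sum of the process `g` under `Q` and independent white noise of variance `v`. -/
noncomputable def noisyLaw (Q : Measure Ω) (g : ℝ → Ω → ℝ) (v : ℝ≥0) : Measure (ℝ → ℝ) :=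
  (Q.prod (whiteNoise ℝ v)).map fun p t => g t p.1 + p.2 t

variable {Q : Measure Ω} {g : ℝ → Ω → ℝ} {v : ℝ≥0}

theorem measurable_add_noise (hg : ∀ t, Measurable (g t)) :
    Measurable fun (p : Ω × (ℝ → ℝ)) t => g t p.1 + p.2 t :=
  measurable_pi_lambda _ fun t => ((hg t).comp measurable_fst).add
    ((measurable_pi_apply t).comp measurable_snd)

theorem memLp_smooth_fst (v : ℝ≥0) {φ : Ω → ℝ} (hφ : MemLp φ 2 Q) :
    MemLp (fun p : Ω × (ℝ → ℝ) => φ p.1) 2 (Q.prod (whiteNoise ℝ v)) :=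
  hφ.comp_measurePreserving measurePreserving_fst

theorem integral_fst_prod_whiteNoise (v : ℝ≥0) {φ : Ω → ℝ} (hφ : Measurable φ) :
    ∫ p : Ω × (ℝ → ℝ), φ p.1 ∂(Q.prod (whiteNoise ℝ v)) = ∫ ω, φ ω ∂Q := by
  have h := integral_map (μ := Q.prod (whiteNoise ℝ v)) measurable_fst.aemeasurable
    hφ.aestronglyMeasurable
  rw [measurePreserving_fst.map_eq] at h
  exact h.symm

variable [IsProbabilityMeasure Q]

theorem isProbabilityMeasure_noisyLaw (hg : ∀ t, Measurable (g t)) :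
    IsProbabilityMeasure (noisyLaw Q g v) :=
  Measure.isProbabilityMeasure_map (measurable_add_noise hg).aemeasurable

theorem IsNoisyDecomposition.map_add {fs fn : ℝ → Ω → ℝ}
    (h : IsNoisyDecomposition Q fs fn v) :
    Q.map (fun ω t => fs t ω + fn t ω) = noisyLaw Q fs v := by
  have hS : Measurable fun ω t => fs t ω := measurable_pi_lambda _ h.measurable_smooth
  have hN : Measurable fun ω t => fn t ω := measurable_pi_lambda _ h.measurable_noise
  have hmap := (indepFun_iff_map_prod_eq_prod_map_map hS.aemeasurable hN.aemeasurable).1 h.indep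
  have hadd : Measurable fun q : (ℝ → ℝ) × (ℝ → ℝ) => fun t => q.1 t + q.2 t :=
    measurable_pi_lambda _ fun t => ((measurable_pi_apply t).comp measurable_fst).add
      ((measurable_pi_apply t).comp measurable_snd)
  have h1 : Q.map (fun ω t => fs t ω + fn t ω) =
      (Q.map fun ω => ((fun t => fs t ω), fun t => fn t ω)).map
        fun q : (ℝ → ℝ) × (ℝ → ℝ) => fun t => q.1 t + q.2 t := by
    rw [Measure.map_map hadd (hS.prodMk hN)]; rfl
  have h2 : (Q.map fun ω t => fs t ω).prod (whiteNoise ℝ v) =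
      (Q.prod (whiteNoise ℝ v)).map (Prod.map (fun ω t => fs t ω) id) := by
    rw [← Measure.map_prod_map _ _ hS measurable_id, Measure.map_id]
  rw [h1, hmap, h.map_noise, h2, Measure.map_map hadd (hS.prodMap measurable_id)]
  rfl

/-- The independent copy of the noise in the posterior prediction is white noise. -/
theorem posteriorPredictionMap_eq_noisyLaw {fs fn : ℝ → Ω → ℝ}
    (h : IsNoisyDecomposition Q fs fn v) (D : DataSet) :
    (posteriorPredictionMap h D : Measure (ℝ → ℝ)) = noisyLaw (smoothPosterior Q fs v D) fs v := by
  have := isProbabilityMeasure_smoothPosterior (P := Q) h.measurable_smooth h.var_pos D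
  have hN : Measurable fun ω t => fn t ω := measurable_pi_lambda _ h.measurable_noise
  have h2 : (smoothPosterior Q fs v D).prod (whiteNoise ℝ v) =
      ((smoothPosterior Q fs v D).prod Q).map (Prod.map id fun ω t => fn t ω) := by
    rw [← Measure.map_prod_map _ _ measurable_id hN, Measure.map_id, h.map_noise]
  rw [noisyLaw, h2, Measure.map_map (measurable_add_noise h.measurable_smooth)
    (measurable_id.prodMap hN)]
  rfl

theorem memLp_noise_snd (t : ℝ) :
    MemLp (fun p : Ω × (ℝ → ℝ) => p.2 t) 2 (Q.prod (whiteNoise ℝ v)) :=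
  (memLp_whiteNoise v t).comp_measurePreserving measurePreserving_snd

theorem memLp_noisyLaw (hg : ∀ t, Measurable (g t)) {t : ℝ} (h2 : MemLp (g t) 2 Q) :
    MemLp (fun f : ℝ → ℝ => f t) 2 (noisyLaw Q g v) := by
  rw [noisyLaw, memLp_map_measure_iff (measurable_pi_apply t).aestronglyMeasurable
    (measurable_add_noise hg).aemeasurable]
  exact (memLp_smooth_fst v h2).add (memLp_noise_snd t)

theorem integral_snd_prod_whiteNoise (t : ℝ) :
    ∫ p : Ω × (ℝ → ℝ), p.2 t ∂(Q.prod (whiteNoise ℝ v)) = 0 := by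
  have h := integral_map (μ := Q.prod (whiteNoise ℝ v)) measurable_snd.aemeasurable
    (measurable_pi_apply t).aestronglyMeasurable
  rw [measurePreserving_snd.map_eq, integral_whiteNoise] at h
  exact h.symm

theorem integral_noisyLaw (hg : ∀ t, Measurable (g t)) {t : ℝ} (h2 : MemLp (g t) 2 Q) :
    ∫ f, f t ∂(noisyLaw Q g v) = ∫ ω, g t ω ∂Q := by
  rw [noisyLaw, integral_map (measurable_add_noise hg).aemeasurable
    (measurable_pi_apply t).aestronglyMeasurable]
  rw [integral_add ((memLp_smooth_fst v h2).integrable (by norm_num))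
    ((memLp_noise_snd t).integrable (by norm_num)), integral_snd_prod_whiteNoise, add_zero,
    integral_fst_prod_whiteNoise v (hg t)]

theorem covariance_noisyLaw (hg : ∀ t, Measurable (g t)) (h2 : ∀ t, MemLp (g t) 2 Q) (s t : ℝ) :
    covariance (fun f : ℝ → ℝ => f s) (fun f => f t) (noisyLaw Q g v) =
      covariance (g s) (g t) Q + if s = t then (v : ℝ) else 0 := by
  rw [noisyLaw, covariance_map_fun (measurable_pi_apply s).aestronglyMeasurable
    (measurable_pi_apply t).aestronglyMeasurable (measurable_add_noise hg).aemeasurable]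
  have e : ∀ r : ℝ, (fun p : Ω × (ℝ → ℝ) => g r p.1 + p.2 r) =
      (fun p : Ω × (ℝ → ℝ) => g r p.1) + fun p : Ω × (ℝ → ℝ) => p.2 r := fun r => rfl
  rw [e, e, covariance_add_left (memLp_smooth_fst v (h2 s)) (memLp_noise_snd s)
      ((memLp_smooth_fst v (h2 t)).add (memLp_noise_snd t)),
    covariance_add_right (memLp_smooth_fst v (h2 s)) (memLp_smooth_fst v (h2 t))
      (memLp_noise_snd t),
    covariance_add_right (memLp_noise_snd s) (memLp_smooth_fst v (h2 t)) (memLp_noise_snd t)]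
  have c1 : covariance (fun p : Ω × (ℝ → ℝ) => g s p.1) (fun p => g t p.1)
      (Q.prod (whiteNoise ℝ v)) = covariance (g s) (g t) Q := by
    have h := covariance_map_fun (μ := Q.prod (whiteNoise ℝ v)) (Z := Prod.fst)
      (hg s).aestronglyMeasurable (hg t).aestronglyMeasurable measurable_fst.aemeasurable
    rw [measurePreserving_fst.map_eq] at h
    exact h.symm
  have c2 : covariance (fun p : Ω × (ℝ → ℝ) => p.2 s) (fun p => p.2 t)
      (Q.prod (whiteNoise ℝ v)) = if s = t then (v : ℝ) else 0 := by
    have h := covariance_map_fun (μ := Q.prod (whiteNoise ℝ v)) (Z := Prod.snd)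
      (measurable_pi_apply s).aestronglyMeasurable (measurable_pi_apply t).aestronglyMeasurable
      measurable_snd.aemeasurable
    rw [measurePreserving_snd.map_eq, covariance_whiteNoise] at h
    exact h.symm
  have c3 : ∀ s t, covariance (fun p : Ω × (ℝ → ℝ) => g s p.1) (fun p => p.2 t)
      (Q.prod (whiteNoise ℝ v)) = 0 := fun s t =>
    covariance_fst_snd_prod (h2 s) (memLp_whiteNoise v t)
  rw [c1, c2, c3, covariance_comm _ (fun p : Ω × (ℝ → ℝ) => g t p.1), c3]
  ring

theorem isNoisyWith_noisyLaw {Ω : Type} [MeasurableSpace Ω] {Q : Measure Ω}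
    [IsProbabilityMeasure Q] {g : ℝ → Ω → ℝ} (hg : ∀ t, Measurable (g t))
    (hc : ∀ᵐ ω ∂Q, Continuous fun t => g t ω) (hv : 0 < v) {μ : ProbabilityMeasure (ℝ → ℝ)}
    (hμ : (μ : Measure (ℝ → ℝ)) = noisyLaw Q g v) : IsNoisyWith μ v := by
  refine ⟨Ω × (ℝ → ℝ), inferInstance, Q.prod (whiteNoise ℝ v), inferInstance,
    fun t p => g t p.1, fun t p => p.2 t, ⟨fun t => (hg t).comp measurable_fst,
      fun t => (measurable_pi_apply t).comp measurable_snd, ?_, fun m x hx => ?_, ?_, hv⟩, hμ.symm⟩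
  · exact measurePreserving_fst.quasiMeasurePreserving.ae hc
  · have h := Measure.map_map (μ := Q.prod (whiteNoise ℝ v)) (measurable_proj x) measurable_snd
    rw [measurePreserving_snd.map_eq, whiteNoise_map_proj v hx] at h
    exact h.symm
  · exact indepFun_prod (μ := Q) (ν := whiteNoise ℝ v) (X := fun ω t => g t ω) (Y := fun z => z)
      (measurable_pi_lambda _ hg) measurable_id

theorem isGaussianLaw_noisyLaw (hg : ∀ t, Measurable (g t)) (hG : IsGaussianProcess g Q)
    {μ : ProbabilityMeasure (ℝ → ℝ)} (hμ : (μ : Measure (ℝ → ℝ)) = noisyLaw Q g v) :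
    IsGaussianLaw μ := by
  have hsum : IsGaussianProcess (fun t (p : Ω × (ℝ → ℝ)) => g t p.1 + p.2 t)
      (Q.prod (whiteNoise ℝ v)) := by
    refine ⟨fun I => ?_⟩
    have m1 : Measurable fun ω => I.restrict (g · ω) := measurable_pi_lambda _ fun i => hg i
    have m2 : Measurable fun z : ℝ → ℝ => I.restrict z :=
      measurable_pi_lambda _ fun i => measurable_pi_apply _
    have h1 : HasGaussianLaw (fun p : Ω × (ℝ → ℝ) => I.restrict (g · p.1))
        (Q.prod (whiteNoise ℝ v)) := ⟨by
      have h := Measure.map_map (μ := Q.prod (whiteNoise ℝ v)) m1 measurable_fst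
      rw [measurePreserving_fst.map_eq] at h
      exact h ▸ (hG.hasGaussianLaw I).isGaussian_map⟩
    have h2 : HasGaussianLaw (fun p : Ω × (ℝ → ℝ) => I.restrict p.2)
        (Q.prod (whiteNoise ℝ v)) := ⟨by
      have h := Measure.map_map (μ := Q.prod (whiteNoise ℝ v)) m2 measurable_snd
      rw [measurePreserving_snd.map_eq] at h
      exact h ▸ ((isGaussianProcess_whiteNoise v).hasGaussianLaw I).isGaussian_map⟩
    have hind := indepFun_prod (μ := Q) (ν := whiteNoise ℝ v) m1 m2
    exact (hind.hasGaussianLaw h1 h2).fun_add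
  refine ⟨fun I => ⟨?_⟩⟩
  have hr : Measurable fun f : ℝ → ℝ => I.restrict f :=
    measurable_pi_lambda _ fun i => measurable_pi_apply _
  rw [hμ, noisyLaw, Measure.map_map hr (measurable_add_noise hg)]
  exact (hsum.hasGaussianLaw I).isGaussian_map

theorem fdd_noisyLaw (hg : ∀ t, Measurable (g t)) {μ : ProbabilityMeasure (ℝ → ℝ)}
    (hμ : (μ : Measure (ℝ → ℝ)) = noisyLaw Q g v) {m : ℕ} {x : Fin m → ℝ}
    (hx : Function.Injective x) :
    (fdd μ x : Measure (Fin m → ℝ)) =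
      (Q.prod (Measure.pi fun _ : Fin m => gaussianReal 0 v)).map
        fun p i => g (x i) p.1 + p.2 i := by
  have hT : Measurable fun (p : Ω × (Fin m → ℝ)) i => g (x i) p.1 + p.2 i :=
    measurable_pi_lambda _ fun i => ((hg _).comp measurable_fst).add
      ((measurable_pi_apply i).comp measurable_snd)
  have h2 : Q.prod (Measure.pi fun _ : Fin m => gaussianReal 0 v) =
      (Q.prod (whiteNoise ℝ v)).map (Prod.map id (proj x)) := by
    rw [← Measure.map_prod_map _ _ measurable_id (measurable_proj x), Measure.map_id,
      whiteNoise_map_proj v hx]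
  rw [fdd, ProbabilityMeasure.toMeasure_map, hμ, noisyLaw,
    Measure.map_map (measurable_proj x) (measurable_add_noise hg), h2,
    Measure.map_map hT (measurable_id.prodMap (measurable_proj x))]
  rfl

/-- The finite-dimensional distributions of a noisy process depend continuously on the inputs as
long as the inputs are distinct. -/
theorem continuousOn_integral_fdd_noisyLaw (hg : ∀ t, Measurable (g t))
    (hc : ∀ᵐ ω ∂Q, Continuous fun t => g t ω) {μ : ProbabilityMeasure (ℝ → ℝ)}
    (hμ : (μ : Measure (ℝ → ℝ)) = noisyLaw Q g v) {m : ℕ} {φ : (Fin m → ℝ) → ℝ}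
    (hφ : Continuous φ) {C : ℝ} (hC : ∀ y, |φ y| ≤ C) :
    ContinuousOn (fun x : Fin m → ℝ => ∫ y, φ y ∂(fdd μ x : Measure (Fin m → ℝ)))
      {x | Function.Injective x} := by
  have hT : ∀ x : Fin m → ℝ, Measurable fun (p : Ω × (Fin m → ℝ)) i => g (x i) p.1 + p.2 i :=
    fun x => measurable_pi_lambda _ fun i => ((hg _).comp measurable_fst).add
      ((measurable_pi_apply i).comp measurable_snd)
  have hF : Continuous fun x : Fin m → ℝ => ∫ p, φ (fun i => g (x i) p.1 + p.2 i)
      ∂(Q.prod (Measure.pi fun _ : Fin m => gaussianReal 0 v)) := by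
    refine continuous_of_dominated (bound := fun _ => C)
      (fun x => hφ.comp_aestronglyMeasurable (hT x).aestronglyMeasurable)
      (fun x => Filter.Eventually.of_forall fun p => hC _) (integrable_const _) ?_
    filter_upwards [measurePreserving_fst.quasiMeasurePreserving.ae hc] with p hp
    exact hφ.comp (continuous_pi fun i => (hp.comp (continuous_apply i)).add continuous_const)
  refine hF.continuousOn.congr fun x hx => ?_
  rw [fdd_noisyLaw hg hμ hx, integral_map (hT x).aemeasurable hφ.aestronglyMeasurable]

/-- The noise contributes `v I` with `v > 0` to the covariance matrix at distinct inputs. -/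
theorem isNondegenerate_fdd_noisyLaw (hg : ∀ t, Measurable (g t)) (h2 : ∀ t, MemLp (g t) 2 Q)
    (hv : 0 < v) {μ : ProbabilityMeasure (ℝ → ℝ)}
    (hμ : (μ : Measure (ℝ → ℝ)) = noisyLaw Q g v) {m : ℕ} {x : Fin m → ℝ}
    (hx : Function.Injective x) : IsNondegenerate (fdd μ x : Measure (Fin m → ℝ)) := by
  intro a ha
  rw [variance_linear_combination (memLp_fdd (fun t => hμ ▸ memLp_noisyLaw hg (h2 t)) x)]
  simp only [fdd_eval_covariance, hμ, covariance_noisyLaw hg h2, hx.eq_iff, mul_add,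
    Finset.sum_add_distrib, mul_ite, mul_zero, Finset.sum_ite_eq, Finset.mem_univ, if_true]
  have h3 : 0 ≤ ∑ i, ∑ j, a i * a j * covariance (g (x i)) (g (x j)) Q := by
    rw [← variance_linear_combination fun i => h2 (x i)]
    exact variance_nonneg _ _
  have h4 : 0 < ∑ i, a i * a i * (v : ℝ) := by
    obtain ⟨i, hi⟩ := Function.ne_iff.1 ha
    refine Finset.sum_pos' (fun i _ => mul_nonneg (mul_self_nonneg _) v.2)
      ⟨i, Finset.mem_univ i, mul_pos (mul_self_pos.2 hi) (by exact_mod_cast hv)⟩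
  linarith

theorem gaussianPDF_eq_mul_exp (a : ℝ) (v : ℝ≥0) (y : ℝ) :
    gaussianPDF a v y =
      gaussianPDF 0 v y * ENNReal.ofReal (Real.exp ((2 * a * y - a ^ 2) / (2 * v))) := by
  rw [gaussianPDF, gaussianPDF, ← ENNReal.ofReal_mul (gaussianPDFReal_nonneg _ _ _),
    gaussianPDFReal, gaussianPDFReal, mul_assoc _ (Real.exp _) (Real.exp _), ← Real.exp_add,
    ← add_div]
  congr 4
  ring

/-- The Cameron-Martin formula for translations of white noise on a finite index set. -/
theorem lintegral_add_pi_gaussianReal {v : ℝ≥0} (hv : v ≠ 0) {m : ℕ} (a : Fin m → ℝ)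
    {φ : (Fin m → ℝ) → ℝ≥0∞} (hφ : Measurable φ) :
    ∫⁻ z, φ (fun i => a i + z i) ∂(Measure.pi fun _ : Fin m => gaussianReal 0 v) =
      ∫⁻ y, (∏ i, ENNReal.ofReal (Real.exp ((2 * a i * y i - a i ^ 2) / (2 * v)))) * φ y
        ∂(Measure.pi fun _ : Fin m => gaussianReal 0 v) := by
  have hr : Measurable fun y : Fin m → ℝ =>
      ∏ i, ENNReal.ofReal (Real.exp ((2 * a i * y i - a i ^ 2) / (2 * v))) :=
    Finset.measurable_prod _ fun i _ => by fun_prop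
  have hrφ : Measurable fun y : Fin m → ℝ =>
      (∏ i, ENNReal.ofReal (Real.exp ((2 * a i * y i - a i ^ 2) / (2 * v)))) * φ y := hr.mul hφ
  have hpdf : ∀ a : Fin m → ℝ, Measurable fun y : Fin m → ℝ => ∏ i, gaussianPDF (a i) v (y i) :=
    fun a => Finset.measurable_prod _ fun i _ =>
      (measurable_gaussianPDF _ _).comp (measurable_pi_apply i)
  have hT : Measurable fun (z : Fin m → ℝ) i => a i + z i :=
    measurable_pi_lambda _ fun i => (measurable_pi_apply i).const_add _
  rw [← lintegral_map hφ hT, map_add_pi_gaussianReal a v,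
    pi_gaussianReal_eq_withDensity _ hv, pi_gaussianReal_eq_withDensity _ hv,
    lintegral_withDensity_eq_lintegral_mul _ (hpdf _) hφ,
    lintegral_withDensity_eq_lintegral_mul _ (hpdf _) hrφ]
  refine lintegral_congr fun y => ?_
  simp only [Pi.mul_apply]
  rw [← mul_assoc, ← Finset.prod_mul_distrib]
  congr 1
  exact Finset.prod_congr rfl fun i _ => gaussianPDF_eq_mul_exp _ _ _

/-- The divergence of the finite-dimensional distributions of a noisy process from `𝒩(0, v I)` is
bounded by their second moments, because the density of `𝒩(a, v I)` with respect to `𝒩(0, v I)` is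
at most `exp (|y|² / (2 v))`, whatever `a`. -/
theorem klDiv_fdd_noisyLaw_le (hg : ∀ t, Measurable (g t)) (hv : 0 < v)
    {μ : ProbabilityMeasure (ℝ → ℝ)} (hμ : (μ : Measure (ℝ → ℝ)) = noisyLaw Q g v) {m : ℕ}
    {x : Fin m → ℝ} (hx : Function.Injective x) :
    klDiv (fdd μ x : Measure (Fin m → ℝ)) (Measure.pi fun _ => gaussianReal 0 v) ≤
      ∫⁻ y, ENNReal.ofReal (∑ i, y i ^ 2 / (2 * v)) ∂(fdd μ x : Measure (Fin m → ℝ)) + 1 := by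
  obtain ⟨ξ, hξ⟩ : ∃ ξ, ξ = Measure.pi fun _ : Fin m => gaussianReal 0 v := ⟨_, rfl⟩
  have : IsProbabilityMeasure ξ := hξ ▸ inferInstance
  rw [← hξ]
  -- the density of `𝒩(g(x), v I)` with respect to `𝒩(0, v I)`, and its mean `R` over `g`
  obtain ⟨r, hrdef⟩ : ∃ r : Ω → (Fin m → ℝ) → ℝ≥0∞, ∀ ω y, r ω y = ∏ i,
      ENNReal.ofReal (Real.exp ((2 * g (x i) ω * y i - g (x i) ω ^ 2) / (2 * v))) :=
    ⟨_, fun _ _ => rfl⟩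
  have hr : Measurable fun p : Ω × (Fin m → ℝ) => r p.1 p.2 := by
    simp only [hrdef]
    refine Finset.measurable_prod _ fun i _ => ?_
    have h1 : Measurable fun p : Ω × (Fin m → ℝ) => g (x i) p.1 := (hg _).comp measurable_fst
    have h2 : Measurable fun p : Ω × (Fin m → ℝ) => p.2 i :=
      (measurable_pi_apply i).comp measurable_snd
    exact ENNReal.measurable_ofReal.comp (Real.measurable_exp.comp
      ((((h1.const_mul 2).mul h2).sub (h1.pow_const 2)).div_const _))
  have hr' : Measurable fun p : (Fin m → ℝ) × Ω => r p.2 p.1 := hr.comp measurable_swap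
  obtain ⟨R, hRdef⟩ : ∃ R : (Fin m → ℝ) → ℝ≥0∞, ∀ y, R y = ∫⁻ ω, r ω y ∂Q := ⟨_, fun _ => rfl⟩
  have hR : Measurable R := by
    rw [funext hRdef]
    exact hr'.lintegral_prod_right'
  have hT : Measurable fun (p : Ω × (Fin m → ℝ)) i => g (x i) p.1 + p.2 i :=
    measurable_pi_lambda _ fun i => ((hg _).comp measurable_fst).add
      ((measurable_pi_apply i).comp measurable_snd)
  have hshift : ∀ ω, ∀ φ : (Fin m → ℝ) → ℝ≥0∞, Measurable φ →
      ∫⁻ z, φ (fun i => g (x i) ω + z i) ∂ξ = ∫⁻ y, r ω y * φ y ∂ξ := by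
    simp only [hrdef, hξ]
    exact fun ω φ hφ => lintegral_add_pi_gaussianReal hv.ne' (fun i => g (x i) ω) hφ
  have hden : (fdd μ x : Measure (Fin m → ℝ)) = ξ.withDensity R := by
    refine Measure.ext fun A hA => ?_
    have hind : Measurable (A.indicator (1 : (Fin m → ℝ) → ℝ≥0∞)) := measurable_one.indicator hA
    have hindT : Measurable fun p : Ω × (Fin m → ℝ) =>
        A.indicator (1 : (Fin m → ℝ) → ℝ≥0∞) fun i => g (x i) p.1 + p.2 i := hind.comp hT
    rw [fdd_noisyLaw hg hμ hx, ← hξ, ← lintegral_indicator_one hA, lintegral_map hind hT,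
      lintegral_prod _ hindT.aemeasurable, withDensity_apply _ hA,
      ← lintegral_indicator hA]
    have h1 : ∀ ω, ∫⁻ z, A.indicator (1 : (Fin m → ℝ) → ℝ≥0∞) (fun i => g (x i) ω + z i) ∂ξ =
        ∫⁻ y, r ω y * A.indicator 1 y ∂ξ := fun ω => hshift ω _ hind
    rw [lintegral_congr h1, lintegral_lintegral_swap
      (hr.mul (hind.comp measurable_snd)).aemeasurable]
    refine lintegral_congr fun y => ?_
    by_cases hy : y ∈ A <;> simp [hy, hRdef]
  have hprob : IsProbabilityMeasure (ξ.withDensity R) := hden ▸ inferInstance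
  rw [hden]
  refine klDiv_withDensity_le hR (by fun_prop) (fun y => ?_) fun y => ?_
  · exact Finset.sum_nonneg fun i _ => by positivity
  · have hle : ∀ ω, r ω y ≤ ENNReal.ofReal (Real.exp (∑ i, y i ^ 2 / (2 * v))) := by
      intro ω
      rw [hrdef, Real.exp_sum, ENNReal.ofReal_prod_of_nonneg fun i _ => Real.exp_nonneg _]
      refine Finset.prod_le_prod' fun i _ => ENNReal.ofReal_le_ofReal (Real.exp_le_exp.2 ?_)
      gcongr
      nlinarith [sq_nonneg (g (x i) ω - y i)]
    rw [hRdef]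
    calc ∫⁻ ω, r ω y ∂Q ≤ ∫⁻ _, ENNReal.ofReal (Real.exp (∑ i, y i ^ 2 / (2 * v))) ∂Q :=
          lintegral_mono hle
      _ = _ := by simp

end NoisyLaw

/-! ### The posterior of the smooth part -/

section Posterior

variable {Ω : Type*}

/-- The negative log-likelihood of the data set `D`, up to an additive constant that does not
depend on the process. -/
noncomputable def misfit (fs : ℝ → Ω → ℝ) (v : ℝ≥0) (D : DataSet) (ω : Ω) : ℝ :=
  ∑ i, ((D.2 i).2 - fs (D.2 i).1 ω) ^ 2 / (2 * v)

theorem misfit_nonneg (fs : ℝ → Ω → ℝ) (v : ℝ≥0) (D : DataSet) (ω : Ω) : 0 ≤ misfit fs v D ω :=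
  Finset.sum_nonneg fun _ _ => by positivity

theorem likelihood_eq_exp_neg_misfit (fs : ℝ → Ω → ℝ) (v : ℝ≥0) (D : DataSet) (ω : Ω) :
    likelihood fs v D ω =
      ENNReal.ofReal ((√(2 * Real.pi * v))⁻¹ ^ D.1) *
        ENNReal.ofReal (Real.exp (-misfit fs v D ω)) := by
  rw [← ENNReal.ofReal_mul (by positivity), misfit, ← Finset.sum_neg_distrib, Real.exp_sum,
    ← Fin.prod_const, ← Finset.prod_mul_distrib,
    ENNReal.ofReal_prod_of_nonneg fun _ _ => by positivity]
  refine Finset.prod_congr rfl fun _ _ => ?_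
  rw [gaussianPDF, gaussianPDFReal, neg_div]

theorem exp_neg_misfit_le_one (fs : ℝ → Ω → ℝ) (v : ℝ≥0) (D : DataSet) (ω : Ω) :
    Real.exp (-misfit fs v D ω) ≤ 1 :=
  Real.exp_le_one_iff.2 (neg_nonpos.2 (misfit_nonneg fs v D ω))

variable [MeasurableSpace Ω] {P : Measure Ω} {fs fn : ℝ → Ω → ℝ} {v : ℝ≥0}

theorem measurable_misfit (hfs : ∀ t, Measurable (fs t)) (D : DataSet) :
    Measurable (misfit fs v D) :=
  Finset.measurable_sum _ fun _ _ => ((measurable_const.sub (hfs _)).pow_const 2).div_const _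

/-- The marginal likelihood of the data set `D`, up to a constant factor. -/
noncomputable def evidence (P : Measure Ω) (fs : ℝ → Ω → ℝ) (v : ℝ≥0) (D : DataSet) : ℝ :=
  ∫ ω, Real.exp (-misfit fs v D ω) ∂P

theorem integrable_mul_exp_neg_misfit (hfs : ∀ t, Measurable (fs t)) (D : DataSet) {φ : Ω → ℝ}
    (hφ : Integrable φ P) : Integrable (fun ω => φ ω * Real.exp (-misfit fs v D ω)) P := by
  refine hφ.mul_bdd (c := 1)
    (Real.measurable_exp.comp (measurable_misfit hfs D).neg).aestronglyMeasurable ?_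
  refine Filter.Eventually.of_forall fun ω => ?_
  rw [Real.norm_eq_abs, Real.abs_exp]
  exact exp_neg_misfit_le_one fs v D ω

/-- Continuity in the data, both inputs and outputs; it uses that paths are continuous. -/
theorem continuous_integral_mul_exp_neg_misfit (hfs : ∀ t, Measurable (fs t))
    (hc : ∀ᵐ ω ∂P, Continuous fun t => fs t ω) {φ : Ω → ℝ} (hφ : Integrable φ P) :
    Continuous fun D : DataSet => ∫ ω, φ ω * Real.exp (-misfit fs v D ω) ∂P := by
  refine continuous_sigma fun m => ?_
  refine continuous_of_dominated (bound := fun ω => |φ ω|)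
    (fun d => (integrable_mul_exp_neg_misfit hfs _ hφ).aestronglyMeasurable)
    (fun d => Filter.Eventually.of_forall fun ω => ?_) hφ.abs ?_
  · rw [Real.norm_eq_abs, abs_mul, Real.abs_exp]
    exact mul_le_of_le_one_right (abs_nonneg _) (exp_neg_misfit_le_one fs v _ ω)
  · filter_upwards [hc] with ω hω
    refine continuous_const.mul (Real.continuous_exp.comp (Continuous.neg ?_))
    change Continuous fun d : Fin m → ℝ × ℝ => ∑ i, ((d i).2 - fs (d i).1 ω) ^ 2 / (2 * (v : ℝ))
    refine continuous_finsetSum _ fun i _ => ?_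
    have h1 : Continuous fun d : Fin m → ℝ × ℝ => fs (d i).1 ω :=
      hω.comp (continuous_fst.comp (continuous_apply i))
    fun_prop

theorem IsNoisyDecomposition.map_noise_eval (h : IsNoisyDecomposition P fs fn v) (t : ℝ) :
    P.map (fn t) = gaussianReal 0 v := by
  have h1 := Measure.map_map (μ := P) (measurable_pi_apply t)
    (measurable_pi_lambda (fun ω t => fn t ω) h.measurable_noise)
  rw [h.map_noise, (measurePreserving_eval_whiteNoise v t).map_eq] at h1
  exact h1.symm

/-- If the second moments of a noisy process are bounded, then so are those of its smooth part. -/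
theorem IsNoisyDecomposition.exists_sq_smooth_le (h : IsNoisyDecomposition P fs fn v)
    (h2 : (⨆ t : ℝ, ∫⁻ ω, ENNReal.ofReal ((fs t ω + fn t ω) ^ 2) ∂P) < ∞) :
    ∃ M : ℝ, 0 ≤ M ∧ ∀ t, MemLp (fs t) 2 P ∧ ∫ ω, fs t ω ^ 2 ∂P ≤ M := by
  have hn2 : ∀ t, MemLp (fn t) 2 P := fun t => by
    have := memLp_id_gaussianReal (μ := 0) (v := v) 2
    rw [← h.map_noise_eval t, memLp_map_measure_iff aestronglyMeasurable_id
      (h.measurable_noise t).aemeasurable] at this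
    exact this
  have hnv : ∀ t, ∫ ω, fn t ω ^ 2 ∂P = ∫ y, y ^ 2 ∂(gaussianReal 0 v) := fun t => by
    rw [← h.map_noise_eval t, integral_map (h.measurable_noise t).aemeasurable
      (by fun_prop)]
  set A := ⨆ t : ℝ, ∫⁻ ω, ENNReal.ofReal ((fs t ω + fn t ω) ^ 2) ∂P with hA
  have hsm : ∀ t, Measurable fun ω => fs t ω + fn t ω := fun t =>
    (h.measurable_smooth t).add (h.measurable_noise t)
  have hle : ∀ t, ∫⁻ ω, ENNReal.ofReal ((fs t ω + fn t ω) ^ 2) ∂P ≤ A := fun t =>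
    le_iSup (fun t : ℝ => ∫⁻ ω, ENNReal.ofReal ((fs t ω + fn t ω) ^ 2) ∂P) t
  have hsi : ∀ t, Integrable (fun ω => (fs t ω + fn t ω) ^ 2) P := fun t =>
    ⟨((hsm t).pow_const 2).aestronglyMeasurable,
      (hasFiniteIntegral_iff_ofReal (Filter.Eventually.of_forall fun _ => sq_nonneg _)).2
        ((hle t).trans_lt h2)⟩
  have hs2 : ∀ t, MemLp (fun ω => fs t ω + fn t ω) 2 P := fun t =>
    (memLp_two_iff_integrable_sq (hsm t).aestronglyMeasurable).2 (hsi t)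
  have hsA : ∀ t, ∫ ω, (fs t ω + fn t ω) ^ 2 ∂P ≤ A.toReal := fun t => by
    rw [integral_eq_lintegral_of_nonneg_ae (Filter.Eventually.of_forall fun _ => sq_nonneg _)
      (hsi t).aestronglyMeasurable]
    exact ENNReal.toReal_mono h2.ne (hle t)
  have hf2 : ∀ t, MemLp (fs t) 2 P := fun t => by
    have := (hs2 t).sub (hn2 t)
    refine this.ae_eq (Filter.Eventually.of_forall fun ω => ?_)
    simp
  refine ⟨2 * A.toReal + 2 * ∫ y, y ^ 2 ∂(gaussianReal 0 v), ?_, fun t => ⟨hf2 t, ?_⟩⟩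
  · have : 0 ≤ ∫ y, y ^ 2 ∂(gaussianReal 0 v) := integral_nonneg fun _ => sq_nonneg _
    positivity
  · calc ∫ ω, fs t ω ^ 2 ∂P
        ≤ ∫ ω, (2 * (fs t ω + fn t ω) ^ 2 + 2 * fn t ω ^ 2) ∂P := by
          refine integral_mono (hf2 t).integrable_sq
            (((hsi t).const_mul 2).add ((hn2 t).integrable_sq.const_mul 2)) fun ω => ?_
          change fs t ω ^ 2 ≤ 2 * (fs t ω + fn t ω) ^ 2 + 2 * fn t ω ^ 2
          nlinarith [sq_nonneg (fs t ω + 2 * fn t ω)]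
      _ = 2 * ∫ ω, (fs t ω + fn t ω) ^ 2 ∂P + 2 * ∫ y, y ^ 2 ∂(gaussianReal 0 v) := by
          rw [integral_add ((hsi t).const_mul 2) ((hn2 t).integrable_sq.const_mul 2),
            integral_const_mul, integral_const_mul, hnv]
      _ ≤ _ := by linarith [hsA t]

variable [IsProbabilityMeasure P]

theorem integrable_exp_neg_misfit (hfs : ∀ t, Measurable (fs t)) (D : DataSet) :
    Integrable (fun ω => Real.exp (-misfit fs v D ω)) P := by
  simpa using integrable_mul_exp_neg_misfit (v := v) hfs D (integrable_const (μ := P) (1 : ℝ))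

theorem evidence_pos (hfs : ∀ t, Measurable (fs t)) (D : DataSet) : 0 < evidence P fs v D :=
  integral_exp_pos (integrable_exp_neg_misfit hfs D)

theorem continuous_evidence (hfs : ∀ t, Measurable (fs t))
    (hc : ∀ᵐ ω ∂P, Continuous fun t => fs t ω) : Continuous (evidence P fs v) := by
  simpa [evidence] using continuous_integral_mul_exp_neg_misfit (v := v) hfs hc
    (integrable_const (μ := P) (1 : ℝ))

theorem smoothPosterior_eq_withDensity (hfs : ∀ t, Measurable (fs t)) (hv : 0 < v)
    (D : DataSet) :
    smoothPosterior P fs v D = P.withDensity fun ω =>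
      ENNReal.ofReal (Real.exp (-misfit fs v D ω) / evidence P fs v D) := by
  have hκ : 0 < (√(2 * Real.pi * v))⁻¹ ^ D.1 := by
    have : (0 : ℝ) < v := hv
    positivity
  have hexp : Measurable fun ω => ENNReal.ofReal (Real.exp (-misfit fs v D ω)) :=
    ENNReal.measurable_ofReal.comp (Real.measurable_exp.comp (measurable_misfit hfs D).neg)
  have hZ : ∫⁻ ω, ENNReal.ofReal (Real.exp (-misfit fs v D ω)) ∂P =
      ENNReal.ofReal (evidence P fs v D) := by
    refine (ofReal_integral_eq_lintegral_ofReal ?_ ?_).symm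
    · exact integrable_exp_neg_misfit hfs D
    · exact Filter.Eventually.of_forall fun _ => Real.exp_nonneg _
  rw [smoothPosterior]
  congr 1
  ext ω
  simp only [likelihood_eq_exp_neg_misfit]
  rw [lintegral_const_mul _ hexp, hZ, ENNReal.mul_div_mul_left _ _ (by simpa using hκ)
    ENNReal.ofReal_ne_top, ENNReal.ofReal_div_of_pos (evidence_pos hfs D)]

theorem integral_smoothPosterior (hfs : ∀ t, Measurable (fs t)) (hv : 0 < v) (D : DataSet)
    (φ : Ω → ℝ) :
    ∫ ω, φ ω ∂(smoothPosterior P fs v D) =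
      (∫ ω, φ ω * Real.exp (-misfit fs v D ω) ∂P) / evidence P fs v D := by
  have hm : Measurable fun ω => Real.exp (-misfit fs v D ω) / evidence P fs v D :=
    (Real.measurable_exp.comp (measurable_misfit hfs D).neg).div_const _
  rw [smoothPosterior_eq_withDensity hfs hv, integral_withDensity_eq_integral_toReal_smul
    hm.ennreal_ofReal (Filter.Eventually.of_forall fun _ => ENNReal.ofReal_lt_top),
    ← integral_div]
  refine integral_congr_ae (Filter.Eventually.of_forall fun ω => ?_)
  change (ENNReal.ofReal _).toReal • φ ω = _
  rw [ENNReal.toReal_ofReal (div_nonneg (Real.exp_nonneg _) (evidence_pos hfs D).le), smul_eq_mul]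
  ring

/-- The posterior is dominated by the prior. -/
theorem smoothPosterior_le (hfs : ∀ t, Measurable (fs t)) (hv : 0 < v) (D : DataSet) :
    smoothPosterior P fs v D ≤ ENNReal.ofReal (evidence P fs v D)⁻¹ • P := by
  rw [smoothPosterior_eq_withDensity hfs hv, ← withDensity_const]
  refine withDensity_mono (Filter.Eventually.of_forall fun ω => ENNReal.ofReal_le_ofReal ?_)
  rw [div_eq_mul_inv]
  exact mul_le_of_le_one_left (inv_nonneg.2 (evidence_pos hfs D).le)
    (exp_neg_misfit_le_one fs v D ω)

/-- The evidence is bounded from below on bounded collections of data sets, by Jensen's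
inequality: the expected misfit is bounded, however the inputs are placed. -/
theorem exists_le_evidence (hfs : ∀ t, Measurable (fs t)) {M : ℝ}
    (hM : ∀ t, MemLp (fs t) 2 P ∧ ∫ ω, fs t ω ^ 2 ∂P ≤ M) {S : Set DataSet}
    (hS : IsBoundedCollection S) : ∃ ε > 0, ∀ D ∈ S, ε ≤ evidence P fs v D := by
  obtain ⟨B, hB⟩ := hS
  have hM0 : 0 ≤ M := le_trans (integral_nonneg fun _ => sq_nonneg _) (hM 0).2
  refine ⟨Real.exp (-((B * B + B * M) / v)), Real.exp_pos _, fun D hD => ?_⟩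
  have hsize : ∑ i, max |(D.2 i).2| 1 ≤ B := hB ⟨D, hD, rfl⟩
  have h0 : ∀ i, 0 ≤ max |(D.2 i).2| 1 := fun i => le_max_of_le_right zero_le_one
  have hi : ∀ i, Integrable (fun ω => ((D.2 i).2 - fs (D.2 i).1 ω) ^ 2) P := fun i =>
    ((memLp_const _).sub (hM _).1).integrable_sq
  have hi' : ∀ i, ∫ ω, ((D.2 i).2 - fs (D.2 i).1 ω) ^ 2 ∂P ≤ 2 * (D.2 i).2 ^ 2 + 2 * M := by
    intro i
    have hq := (hM (D.2 i).1).1.integrable_sq.const_mul 2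
    calc _ ≤ ∫ ω, (2 * (D.2 i).2 ^ 2 + 2 * fs (D.2 i).1 ω ^ 2) ∂P := by
          refine integral_mono (hi i) ((integrable_const _).add hq) fun ω => ?_
          change ((D.2 i).2 - fs (D.2 i).1 ω) ^ 2 ≤ 2 * (D.2 i).2 ^ 2 + 2 * fs (D.2 i).1 ω ^ 2
          nlinarith [sq_nonneg ((D.2 i).2 + fs (D.2 i).1 ω)]
      _ = 2 * (D.2 i).2 ^ 2 + 2 * ∫ ω, fs (D.2 i).1 ω ^ 2 ∂P := by
          rw [integral_add (integrable_const _) hq,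
            integral_const_mul 2 fun ω => fs (D.2 i).1 ω ^ 2]
          simp
      _ ≤ _ := by linarith [(hM (D.2 i).1).2]
  have hy : ∀ i, (D.2 i).2 ^ 2 + M ≤ (B + M) * max |(D.2 i).2| 1 := fun i => by
    have h1 : max |(D.2 i).2| 1 ≤ B :=
      (Finset.single_le_sum (fun i _ => h0 i) (Finset.mem_univ i)).trans hsize
    have h2 : (1 : ℝ) ≤ max |(D.2 i).2| 1 := le_max_right _ _
    have h3 : |(D.2 i).2| ≤ max |(D.2 i).2| 1 := le_max_left _ _
    rw [← sq_abs]
    nlinarith [abs_nonneg (D.2 i).2]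
  have hW : Integrable (misfit fs v D) P :=
    integrable_finsetSum _ fun i _ => (hi i).div_const _
  have hk : ∫ ω, misfit fs v D ω ∂P ≤ (B * B + B * M) / v := by
    have e : ∫ ω, misfit fs v D ω ∂P =
        ∑ i, (∫ ω, ((D.2 i).2 - fs (D.2 i).1 ω) ^ 2 ∂P) / (2 * v) := by
      simp only [misfit]
      rw [integral_finsetSum _ fun i _ => (hi i).div_const _]
      simp only [integral_div]
    calc _ ≤ ∑ i, (2 * (B + M) * max |(D.2 i).2| 1) / (2 * (v : ℝ)) := by
          rw [e]
          refine Finset.sum_le_sum fun i _ => ?_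
          gcongr
          linarith [hi' i, hy i]
      _ = (B + M) * (∑ i, max |(D.2 i).2| 1) / v := by
          rw [← Finset.sum_div, ← Finset.mul_sum, mul_assoc, mul_div_mul_left _ _ two_ne_zero]
      _ ≤ _ := by
          have hB0 : 0 ≤ B := (Finset.sum_nonneg fun i _ => h0 i).trans hsize
          gcongr
          nlinarith
  refine (Real.exp_le_exp.2 (neg_le_neg hk)).trans ?_
  -- bound `exp` from below by its tangent at `-k`, where `k` is the expected misfit
  set k := ∫ ω, misfit fs v D ω ∂P
  calc Real.exp (-k) = ∫ ω, Real.exp (-k) * (1 + k - misfit fs v D ω) ∂P := by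
        rw [integral_const_mul, integral_sub (integrable_const _) hW]
        simp [k]
    _ ≤ evidence P fs v D := by
        refine integral_mono (((integrable_const (1 + k)).sub hW).const_mul _)
          (integrable_exp_neg_misfit hfs D) fun ω => ?_
        have := Real.add_one_le_exp (k - misfit fs v D ω)
        calc Real.exp (-k) * (1 + k - misfit fs v D ω)
            ≤ Real.exp (-k) * Real.exp (k - misfit fs v D ω) := by
              gcongr
              linarith
          _ = _ := by
              rw [← Real.exp_add]
              congr 1
              ring


/-- The Hölder condition passes to dominated laws, with exponent `2`. -/
theorem IsHolderInLp.exists_eLpNorm_two_le (hh : IsHolderInLp P fs)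
    (hfs : ∀ t, Measurable (fs t)) {Q : Measure Ω} {C : ℝ≥0∞} (hC : C ≠ ∞) (hQ : Q ≤ C • P) :
    ∃ c r β : ℝ, 0 ≤ c ∧ 0 < r ∧ 1 / 2 < β ∧ ∀ s t : ℝ, |s - t| < r →
      eLpNorm (fun ω => fs s ω - fs t ω) 2 Q ≤ ENNReal.ofReal (c * |s - t| ^ β) := by
  obtain ⟨p, hp, β, hβ, -, c, hc, r, hr, h⟩ := hh
  refine ⟨(C ^ (1 / (2 : ℝ≥0∞)).toReal).toReal * c, r, β, by positivity, hr, hβ,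
    fun s t hst => ?_⟩
  have hC' : C ^ (1 / (2 : ℝ≥0∞)).toReal ≠ ∞ :=
    ENNReal.rpow_ne_top_of_nonneg ENNReal.toReal_nonneg hC
  calc eLpNorm (fun ω => fs s ω - fs t ω) 2 Q
      ≤ C ^ (1 / (2 : ℝ≥0∞)).toReal * eLpNorm (fun ω => fs s ω - fs t ω) 2 P :=
        eLpNorm_le_of_measure_le_smul hQ
    _ ≤ C ^ (1 / (2 : ℝ≥0∞)).toReal * ENNReal.ofReal (c * |s - t| ^ β) := by
        gcongr
        exact (eLpNorm_le_eLpNorm_of_exponent_le hp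
          ((hfs s).sub (hfs t)).aestronglyMeasurable).trans (h s t hst)
    _ = _ := by
        rw [mul_assoc, ENNReal.ofReal_mul ENNReal.toReal_nonneg, ENNReal.ofReal_toReal hC']

/-- A process which is Hölder continuous in `L²` with exponent greater than `1 / 2` shares its mean
and covariance functions with a continuous Gaussian process. -/
theorem exists_continuous_gaussianProcess_of_holder (hfs : ∀ t, MemLp (fs t) 2 P) {c r β : ℝ}
    (hr : 0 < r) (hβ : 1 / 2 < β) (hh : ∀ s t : ℝ, |s - t| < r →
      eLpNorm (fun ω => fs s ω - fs t ω) 2 P ≤ ENNReal.ofReal (c * |s - t| ^ β)) (hc : 0 ≤ c) :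
    ∃ g : ℝ → (ℕ → ℝ) → ℝ, (∀ t, Measurable (g t)) ∧
      (∀ᵐ z ∂(whiteNoise ℕ 1), Continuous fun t => g t z) ∧
      IsGaussianProcess g (whiteNoise ℕ 1) ∧
      (∀ t, ∫ z, g t z ∂(whiteNoise ℕ 1) = ∫ ω, fs t ω ∂P) ∧
      ∀ s t, covariance (g s) (g t) (whiteNoise ℕ 1) = covariance (fs s) (fs t) P := by
  have hint : ∀ t, Integrable (fs t) P := fun t => (hfs t).integrable (by norm_num)
  set m : ℝ → ℝ := fun t => ∫ ω, fs t ω ∂P with hm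
  have hmdist : ∀ s t, |s - t| < r → |m s - m t| ≤ c * |s - t| ^ β := by
    intro s t hst
    have h0 : 0 ≤ c * |s - t| ^ β := by positivity
    rw [hm, ← integral_sub (hint s) (hint t), ← ENNReal.ofReal_le_ofReal_iff h0]
    refine le_trans ?_ (hh s t hst)
    refine le_trans ?_ (eLpNorm_le_eLpNorm_of_exponent_le (p := 1) (by norm_num)
      ((hint s).sub (hint t)).aestronglyMeasurable)
    rw [eLpNorm_one_eq_lintegral_enorm, ← Real.norm_eq_abs, ofReal_norm]
    exact enorm_integral_le_lintegral_enorm _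
  have hmc : Continuous m := by
    refine continuous_iff_continuousAt.2 fun t => ?_
    rw [ContinuousAt, tendsto_iff_norm_sub_tendsto_zero]
    have hβ0 : 0 < β := by linarith
    have hlim : Filter.Tendsto (fun s => c * |s - t| ^ β) (𝓝 t) (𝓝 0) := by
      have : Continuous fun s : ℝ => c * |s - t| ^ β :=
        continuous_const.mul ((continuous_id.sub continuous_const).abs.rpow_const
          fun _ => Or.inr hβ0.le)
      simpa [Real.zero_rpow hβ0.ne'] using this.tendsto t
    refine squeeze_zero' (Filter.Eventually.of_forall fun s => norm_nonneg _) ?_ hlim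
    filter_upwards [Metric.ball_mem_nhds t hr] with s hs
    exact hmdist s t (by simpa [Real.dist_eq] using hs)
  have hU2 : ∀ t, MemLp (fun ω => fs t ω - m t) 2 P := fun t => (hfs t).sub (memLp_const _)
  -- the centred process as a curve in `L²`, whose inner products are the covariances
  let U : ℝ → Lp ℝ 2 P := fun t => (hU2 t).toLp _
  have hUinner : ∀ s t, inner ℝ (U s) (U t) = covariance (fs s) (fs t) P := by
    intro s t
    rw [L2.inner_def, covariance]
    refine integral_congr_ae ?_
    filter_upwards [(hU2 s).coeFn_toLp, (hU2 t).coeFn_toLp] with ω h1 h2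
    simp only [U]
    rw [h1, h2]
    simp [mul_comm, hm]
  have hUdist : ∀ s t, |s - t| < r → ‖U s - U t‖ ≤ (2 * c) * |s - t| ^ β := by
    intro s t hst
    have h0 : 0 ≤ c * |s - t| ^ β := by positivity
    rw [← MemLp.toLp_sub, Lp.norm_toLp]
    refine ENNReal.toReal_le_of_le_ofReal (by positivity) ?_
    have e : (fun ω => fs s ω - m s) - (fun ω => fs t ω - m t) =
        (fun ω => fs s ω - fs t ω) - fun _ => m s - m t := by
      ext ω
      simp only [Pi.sub_apply]
      ring
    have hconst : eLpNorm (fun _ : Ω => m s - m t) 2 P ≤ ENNReal.ofReal (c * |s - t| ^ β) := by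
      rw [eLpNorm_const _ (by norm_num) (IsProbabilityMeasure.ne_zero P)]
      simp only [measure_univ, ENNReal.one_rpow, mul_one]
      rw [← ofReal_norm, Real.norm_eq_abs]
      exact ENNReal.ofReal_le_ofReal (hmdist s t hst)
    rw [e]
    calc _ ≤ eLpNorm (fun ω => fs s ω - fs t ω) 2 P + eLpNorm (fun _ : Ω => m s - m t) 2 P :=
          eLpNorm_sub_le ((hint s).sub (hint t)).aestronglyMeasurable
            aestronglyMeasurable_const (by norm_num)
      _ ≤ ENNReal.ofReal (c * |s - t| ^ β) + ENNReal.ofReal (c * |s - t| ^ β) :=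
          add_le_add (hh s t hst) hconst
      _ = _ := by
          rw [← ENNReal.ofReal_add h0 h0]
          congr 1
          ring
  obtain ⟨G, hG1, hG2, hG3, hG4, hG5⟩ := exists_continuous_gaussianProcess hr hβ hUdist
  have hGL : ∀ t, MemLp (G t) 2 (whiteNoise ℕ 1) := fun t => (hG3.hasGaussianLaw_eval t).memLp_two
  have hGI : ∀ t, Integrable (G t) (whiteNoise ℕ 1) := fun t => (hGL t).integrable (by norm_num)
  refine ⟨fun t z => m t + G t z, fun t => (hG1 t).const_add _, ?_,
    isGaussianProcess_const_add hG3 m, fun t => ?_, fun s t => ?_⟩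
  · filter_upwards [hG2] with z hz
    exact hmc.add hz
  · rw [integral_add (integrable_const _) (hGI t), hG4]
    simp [hm]
  · rw [covariance_const_add_left (hGI s), covariance_const_add_right (hGI t), hG5, hUinner]

end Posterior

/-! ### Gaussianisation of the posterior prediction map -/

section Gaussianisation

variable {Ω : Type*} [MeasurableSpace Ω] {P : Measure Ω} {fs fn : ℝ → Ω → ℝ} {v : ℝ≥0}

/-- Uncentred second moments in terms of means and covariances. -/
theorem integral_mul_eq_covariance_add {P : Measure Ω} [IsProbabilityMeasure P] {X Y : Ω → ℝ}
    (hX : MemLp X 2 P) (hY : MemLp Y 2 P) :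
    ∫ ω, X ω * Y ω ∂P = covariance X Y P + (∫ ω, X ω ∂P) * ∫ ω, Y ω ∂P := by
  rw [covariance_eq_sub hX hY]
  simp

theorem IsGaussianisation.unique {μ ν ν' : ProbabilityMeasure (ℝ → ℝ)}
    (h : IsGaussianisation μ ν) (h' : IsGaussianisation μ ν') : ν = ν' :=
  h.gaussian.ext h'.gaussian (fun t => (h.mean_eq t).trans (h'.mean_eq t).symm)
    fun s t => (h.cov_eq s t).trans (h'.cov_eq s t).symm

theorem IsGaussianisation.integral_sq {μ ν : ProbabilityMeasure (ℝ → ℝ)}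
    (h : IsGaussianisation μ ν) (t : ℝ) :
    ∫ f, f t ^ 2 ∂(ν : Measure (ℝ → ℝ)) = ∫ f, f t ^ 2 ∂(μ : Measure (ℝ → ℝ)) := by
  simp only [sq]
  rw [integral_mul_eq_covariance_add (h.gaussian.memLp t) (h.gaussian.memLp t),
    integral_mul_eq_covariance_add (h.memLp t) (h.memLp t), h.cov_eq, h.mean_eq]

variable [IsProbabilityMeasure P]

theorem integral_sq_noisyLaw (hg : ∀ t, Measurable (fs t)) {t : ℝ} (h2 : ∀ t, MemLp (fs t) 2 P) :
    ∫ f, f t ^ 2 ∂(noisyLaw P fs v) = ∫ ω, fs t ω ^ 2 ∂P + v := by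
  have := isProbabilityMeasure_noisyLaw (Q := P) (v := v) hg
  simp only [sq]
  rw [integral_mul_eq_covariance_add (memLp_noisyLaw hg (h2 t)) (memLp_noisyLaw hg (h2 t)),
    integral_mul_eq_covariance_add (h2 t) (h2 t), covariance_noisyLaw hg h2,
    integral_noisyLaw hg (h2 t), if_pos rfl]
  ring

theorem memLp_smoothPosterior (hfs : ∀ t, Measurable (fs t)) (hv : 0 < v)
    (h2 : ∀ t, MemLp (fs t) 2 P) (D : DataSet) (t : ℝ) :
    MemLp (fs t) 2 (smoothPosterior P fs v D) :=
  (h2 t).of_measure_le_smul ENNReal.ofReal_ne_top (smoothPosterior_le hfs hv D)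

theorem integral_sq_smoothPosterior_le (hfs : ∀ t, Measurable (fs t)) (hv : 0 < v)
    (h2 : ∀ t, MemLp (fs t) 2 P) (D : DataSet) (t : ℝ) :
    ∫ ω, fs t ω ^ 2 ∂(smoothPosterior P fs v D) ≤
      (evidence P fs v D)⁻¹ * ∫ ω, fs t ω ^ 2 ∂P := by
  have hZ := evidence_pos (P := P) (fs := fs) (v := v) hfs D
  rw [integral_smoothPosterior hfs hv, div_eq_inv_mul]
  refine mul_le_mul_of_nonneg_left ?_ (inv_nonneg.2 hZ.le)
  exact integral_mono (integrable_mul_exp_neg_misfit hfs D (h2 t).integrable_sq)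
    (h2 t).integrable_sq fun ω =>
      mul_le_of_le_one_right (sq_nonneg _) (exp_neg_misfit_le_one fs v D ω)

theorem continuous_integral_smoothPosterior (hfs : ∀ t, Measurable (fs t)) (hv : 0 < v)
    (hc : ∀ᵐ ω ∂P, Continuous fun t => fs t ω) {φ : Ω → ℝ} (hφ : Integrable φ P) :
    Continuous fun D : DataSet => ∫ ω, φ ω ∂(smoothPosterior P fs v D) := by
  simp only [integral_smoothPosterior hfs hv]
  exact (continuous_integral_mul_exp_neg_misfit hfs hc hφ).div (continuous_evidence hfs hc)
    fun D => (evidence_pos hfs D).ne'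

theorem continuous_covariance_smoothPosterior (hfs : ∀ t, Measurable (fs t)) (hv : 0 < v)
    (hc : ∀ᵐ ω ∂P, Continuous fun t => fs t ω) (h2 : ∀ t, MemLp (fs t) 2 P) (s t : ℝ) :
    Continuous fun D : DataSet => covariance (fs s) (fs t) (smoothPosterior P fs v D) := by
  have e : ∀ D : DataSet, covariance (fs s) (fs t) (smoothPosterior P fs v D) =
      ∫ ω, fs s ω * fs t ω ∂(smoothPosterior P fs v D) -
        (∫ ω, fs s ω ∂(smoothPosterior P fs v D)) * ∫ ω, fs t ω ∂(smoothPosterior P fs v D) := by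
    intro D
    have := isProbabilityMeasure_smoothPosterior (P := P) hfs hv D
    rw [integral_mul_eq_covariance_add (memLp_smoothPosterior hfs hv h2 D s)
      (memLp_smoothPosterior hfs hv h2 D t)]
    ring
  simp only [e]
  exact (continuous_integral_smoothPosterior hfs hv hc ((h2 s).integrable_mul (h2 t))).sub
    ((continuous_integral_smoothPosterior hfs hv hc ((h2 s).integrable (by norm_num))).mul
      (continuous_integral_smoothPosterior hfs hv hc ((h2 t).integrable (by norm_num))))

/-- The posterior prediction has a Gaussianisation which is noisy. The point is that its smooth part
may be taken continuous, because the Hölder condition carries over to the posterior. -/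
theorem exists_isGaussianisation_posteriorPredictionMap (h : IsNoisyDecomposition P fs fn v)
    (hh : IsHolderInLp P fs) (h2 : ∀ t, MemLp (fs t) 2 P) (D : DataSet) :
    ∃ ν, IsGaussianisation (posteriorPredictionMap h D) ν ∧ IsNoisyWith ν v := by
  have hfs := h.measurable_smooth
  have := isProbabilityMeasure_smoothPosterior (P := P) hfs h.var_pos D
  have hp2 := memLp_smoothPosterior hfs h.var_pos h2 D
  obtain ⟨c, r, β, hc, hr, hβ, hU⟩ := hh.exists_eLpNorm_two_le hfs ENNReal.ofReal_ne_top
    (smoothPosterior_le (P := P) hfs h.var_pos D)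
  obtain ⟨g, hg, hgc, hgG, hgm, hgk⟩ := exists_continuous_gaussianProcess_of_holder hp2 hr hβ hU hc
  have hg2 : ∀ t, MemLp (g t) 2 (whiteNoise ℕ 1) := fun t => (hgG.hasGaussianLaw_eval t).memLp_two
  let ν : ProbabilityMeasure (ℝ → ℝ) :=
    ⟨noisyLaw (whiteNoise ℕ 1) g v, isProbabilityMeasure_noisyLaw hg⟩
  have hν : (ν : Measure (ℝ → ℝ)) = noisyLaw (whiteNoise ℕ 1) g v := rfl
  refine ⟨ν, ⟨fun t => ?_, isGaussianLaw_noisyLaw hg hgG hν, fun t => ?_, fun s t => ?_⟩,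
    isNoisyWith_noisyLaw hg hgc h.var_pos hν⟩
  · rw [posteriorPredictionMap_eq_noisyLaw]
    exact memLp_noisyLaw hfs (hp2 t)
  · rw [hν, posteriorPredictionMap_eq_noisyLaw, integral_noisyLaw hg (hg2 t),
      integral_noisyLaw hfs (hp2 t), hgm]
  · rw [hν, posteriorPredictionMap_eq_noisyLaw, covariance_noisyLaw hg hg2,
      covariance_noisyLaw hfs hp2, hgk]

/-- Gaussian finite-dimensional distributions depend continuously on the data because the
posterior means and covariances do. -/
theorem isContinuousAlongFdds_of_isGaussianisation (h : IsNoisyDecomposition P fs fn v)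
    (h2 : ∀ t, MemLp (fs t) 2 P) {γ : PredictionMap}
    (hγ : ∀ D, IsGaussianisation (posteriorPredictionMap h D) (γ D)) :
    IsContinuousAlongFdds γ := by
  intro m x
  have hfs := h.measurable_smooth
  refine continuous_sigma fun k => continuous_iff_seqContinuous.2 fun d d₀ hd => ?_
  have hd' : Filter.Tendsto (fun n => (⟨k, d n⟩ : DataSet)) Filter.atTop (𝓝 ⟨k, d₀⟩) :=
    ((continuous_sigmaMk (σ := fun m => Fin m → ℝ × ℝ)).tendsto d₀).comp hd
  have hprob := fun D => isProbabilityMeasure_smoothPosterior (P := P) hfs h.var_pos D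
  have hmean : ∀ D t, ∫ f, f t ∂(γ D : Measure (ℝ → ℝ)) =
      ∫ ω, fs t ω ∂(smoothPosterior P fs v D) := fun D t => by
    have := hprob D
    rw [(hγ D).mean_eq, posteriorPredictionMap_eq_noisyLaw,
      integral_noisyLaw hfs (memLp_smoothPosterior hfs h.var_pos h2 D t)]
  have hcov : ∀ D s t, covariance (fun f : ℝ → ℝ => f s) (fun f => f t) (γ D : Measure (ℝ → ℝ)) =
      covariance (fs s) (fs t) (smoothPosterior P fs v D) + if s = t then (v : ℝ) else 0 :=
    fun D s t => by
    have := hprob D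
    rw [(hγ D).cov_eq, posteriorPredictionMap_eq_noisyLaw,
      covariance_noisyLaw hfs (memLp_smoothPosterior hfs h.var_pos h2 D)]
  refine tendsto_of_isGaussian_pi (fun n => (hγ _).gaussian.isGaussian_fdd x)
    ((hγ _).gaussian.isGaussian_fdd x) (fun i => ?_) fun i j => ?_
  · simp only [Function.comp_apply, fdd_eval_integral, hmean]
    exact ((continuous_integral_smoothPosterior hfs h.var_pos h.continuous_smooth
      ((h2 _).integrable (by norm_num))).tendsto _).comp hd'
  · simp only [Function.comp_apply, fdd_eval_covariance, hcov]
    exact (((continuous_covariance_smoothPosterior hfs h.var_pos h.continuous_smooth h2 _ _).tendsto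
      _).comp hd').add_const _

theorem integral_sq_posteriorPredictionMap_le (h : IsNoisyDecomposition P fs fn v) {M : ℝ}
    (hM : ∀ t, MemLp (fs t) 2 P ∧ ∫ ω, fs t ω ^ 2 ∂P ≤ M) {ε : ℝ} (hε : 0 < ε) {D : DataSet}
    (hD : ε ≤ evidence P fs v D) (t : ℝ) :
    ∫ f, f t ^ 2 ∂(posteriorPredictionMap h D : Measure (ℝ → ℝ)) ≤ ε⁻¹ * M + v := by
  have hfs := h.measurable_smooth
  have := isProbabilityMeasure_smoothPosterior (P := P) hfs h.var_pos D
  have h2 := fun t => (hM t).1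
  rw [posteriorPredictionMap_eq_noisyLaw,
    integral_sq_noisyLaw hfs (memLp_smoothPosterior hfs h.var_pos h2 D)]
  gcongr
  refine (integral_sq_smoothPosterior_le hfs h.var_pos h2 D t).trans ?_
  have h0 : 0 ≤ ∫ ω, fs t ω ^ 2 ∂P := integral_nonneg fun _ => sq_nonneg _
  gcongr
  exact (hM t).2

theorem fdd_comp (μ : ProbabilityMeasure (ℝ → ℝ)) {k m : ℕ} (x : Fin k → ℝ) (σ : Fin m → Fin k) :
    (fdd μ (x ∘ σ) : Measure (Fin m → ℝ)) =
      (fdd μ x : Measure (Fin k → ℝ)).map fun y => y ∘ σ := by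
  have hσ : Measurable fun y : Fin k → ℝ => y ∘ σ :=
    measurable_pi_lambda _ fun i => measurable_pi_apply _
  rw [fdd, fdd, ProbabilityMeasure.toMeasure_map, ProbabilityMeasure.toMeasure_map,
    Measure.map_map hσ (measurable_proj x)]
  rfl

theorem klDiv_fdd_comp_le (μ ν : ProbabilityMeasure (ℝ → ℝ)) {k m : ℕ} (x : Fin k → ℝ)
    (σ : Fin m → Fin k) :
    klDiv (fdd μ (x ∘ σ) : Measure (Fin m → ℝ)) (fdd ν (x ∘ σ)) ≤
      klDiv (fdd μ x : Measure (Fin k → ℝ)) (fdd ν x) := by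
  rw [fdd_comp, fdd_comp]
  exact klDiv_map_le _ _ (measurable_pi_lambda _ fun i => measurable_pi_apply _)

/-- A tuple lists its distinct entries with repetitions. -/
theorem exists_injective_comp_eq {m : ℕ} (x : Fin m → ℝ) :
    ∃ (k : ℕ) (σ : Fin m → Fin k) (s : Fin k → Fin m),
      k ≤ m ∧ Function.Injective (x ∘ s) ∧ x ∘ s ∘ σ = x := by
  classical
  let I : Finset ℝ := Finset.univ.image x
  have hmem : ∀ i, x i ∈ I := fun i => Finset.mem_image_of_mem _ (Finset.mem_univ i)
  have hex : ∀ j : Fin I.card, ∃ i, x i = I.equivFin.symm j := fun j => by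
    obtain ⟨i, -, hi⟩ := Finset.mem_image.1 (I.equivFin.symm j).2
    exact ⟨i, hi⟩
  choose s hs using hex
  refine ⟨I.card, fun i => I.equivFin ⟨x i, hmem i⟩, s,
    Finset.card_image_le.trans (by simp), fun a b hab => ?_, ?_⟩
  · simp only [Function.comp_apply, hs] at hab
    exact I.equivFin.symm.injective (Subtype.ext hab)
  · ext i
    simp [hs]

/-- The Pythagorean inequality for the finite-dimensional distributions at distinct inputs. -/
theorem IsGaussianisation.klDiv_add_klDiv_le {μ ν : ProbabilityMeasure (ℝ → ℝ)}
    (h : IsGaussianisation μ ν) (hnd : ∀ (k : ℕ) (x : Fin k → ℝ), Function.Injective x →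
      IsNondegenerate (fdd μ x : Measure (Fin k → ℝ))) {m : ℕ} {x : Fin m → ℝ}
    (hx : Function.Injective x) (ξ : Measure (Fin m → ℝ)) [IsGaussian ξ] :
    klDiv (fdd μ x : Measure (Fin m → ℝ)) (fdd ν x) + klDiv (fdd ν x : Measure (Fin m → ℝ)) ξ ≤
      klDiv (fdd μ x : Measure (Fin m → ℝ)) ξ := by
  have hG := h.gaussian.isGaussian_fdd x
  exact klDiv_add_klDiv_le_of_isGaussian (memLp_fdd h.memLp x) (hnd m x hx)
    (fun i => by rw [fdd_eval_integral, fdd_eval_integral, h.mean_eq])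
    (fun i j => by rw [fdd_eval_covariance, fdd_eval_covariance, h.cov_eq])

/-- Among the Gaussian distributions, the Gaussianisation is closest to the law itself. For
repeated inputs, this follows from the case of distinct inputs by data processing. -/
theorem IsGaussianisation.klDiv_fdd_le {μ ν : ProbabilityMeasure (ℝ → ℝ)}
    (h : IsGaussianisation μ ν) (hnd : ∀ (k : ℕ) (x : Fin k → ℝ), Function.Injective x →
      IsNondegenerate (fdd μ x : Measure (Fin k → ℝ))) {m : ℕ} (x : Fin m → ℝ)
    (ξ : Measure (Fin m → ℝ)) [IsGaussian ξ] :
    klDiv (fdd μ x : Measure (Fin m → ℝ)) (fdd ν x) ≤ klDiv (fdd μ x : Measure (Fin m → ℝ)) ξ := by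
  obtain ⟨k, σ, s, -, hinj, hx⟩ := exists_injective_comp_eq x
  have hsm : Measurable fun y : Fin m → ℝ => y ∘ s :=
    measurable_pi_lambda _ fun i => measurable_pi_apply _
  let L : (Fin m → ℝ) →L[ℝ] (Fin k → ℝ) :=
    ContinuousLinearMap.pi fun i => ContinuousLinearMap.proj (s i)
  have hξ : IsGaussian (ξ.map fun y => y ∘ s) := isGaussian_map L
  calc klDiv (fdd μ x : Measure (Fin m → ℝ)) (fdd ν x)
      = klDiv (fdd μ ((x ∘ s) ∘ σ) : Measure (Fin m → ℝ)) (fdd ν ((x ∘ s) ∘ σ)) := by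
        rw [Function.comp_assoc, hx]
    _ ≤ klDiv (fdd μ (x ∘ s) : Measure (Fin k → ℝ)) (fdd ν (x ∘ s)) :=
        klDiv_fdd_comp_le μ ν (x ∘ s) σ
    _ ≤ klDiv (fdd μ (x ∘ s) : Measure (Fin k → ℝ)) (ξ.map fun y => y ∘ s) :=
        le_self_add.trans (h.klDiv_add_klDiv_le hnd hinj _)
    _ ≤ _ := by
        rw [fdd_comp]
        exact klDiv_map_le _ _ hsm

/-- The Gaussianisation attains the infimum in the definition of the Gaussian divergence. -/
theorem IsGaussianisation.gaussianDiv_fdd {μ ν : ProbabilityMeasure (ℝ → ℝ)}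
    (h : IsGaussianisation μ ν)
    (hnd : ∀ (k : ℕ) (x : Fin k → ℝ), Function.Injective x →
      IsNondegenerate (fdd μ x : Measure (Fin k → ℝ)))
    {n : ℕ} {x : Fin n → ℝ} (hfin : klDiv (fdd μ x : Measure (Fin n → ℝ)) (fdd ν x) < ∞)
    (ξ : Measure (Fin n → ℝ)) :
    gaussianDiv (fdd μ x : Measure (Fin n → ℝ)) ξ =
      klDiv (fdd μ x : Measure (Fin n → ℝ)) ξ -
        klDiv (fdd μ x : Measure (Fin n → ℝ)) (fdd ν x) := by
  have hG := h.gaussian.isGaussian_fdd x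
  rw [gaussianDiv, if_pos ⟨_, hG, hfin⟩]
  congr 1
  exact le_antisymm (iInf₂_le _ hG) (le_iInf₂ fun ξ' hξ' => h.klDiv_fdd_le hnd x ξ')

/-- A bound on the divergence from the Gaussianisation of a noisy process that depends on the
process through its noise variance and second moments only. -/
theorem IsGaussianisation.klDiv_fdd_le_of_integral_sq_le {g : ℝ → Ω → ℝ}
    (hg : ∀ t, Measurable (g t)) (hv : 0 < v) {μ ν : ProbabilityMeasure (ℝ → ℝ)}
    (hμ : (μ : Measure (ℝ → ℝ)) = noisyLaw P g v) (h : IsGaussianisation μ ν)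
    (hnd : ∀ (k : ℕ) (x : Fin k → ℝ), Function.Injective x →
      IsNondegenerate (fdd μ x : Measure (Fin k → ℝ))) {K : ℝ}
    (hK : ∀ t, ∫ f, f t ^ 2 ∂(μ : Measure (ℝ → ℝ)) ≤ K) {m : ℕ} (x : Fin m → ℝ) :
    klDiv (fdd μ x : Measure (Fin m → ℝ)) (fdd ν x) ≤ ENNReal.ofReal (m * (K / (2 * v))) + 1 := by
  obtain ⟨k, σ, s, hkm, hinj, hx⟩ := exists_injective_comp_eq x
  have hξ : IsGaussian (Measure.pi fun _ : Fin k => gaussianReal 0 v) :=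
    isGaussian_pi_gaussianReal v
  have hK0 : 0 ≤ K := (integral_nonneg fun _ => sq_nonneg _).trans (hK 0)
  have hint : ∀ i : Fin k, Integrable (fun f : ℝ → ℝ => f ((x ∘ s) i) ^ 2 / (2 * (v : ℝ)))
      (μ : Measure (ℝ → ℝ)) := fun i => (h.memLp _).integrable_sq.div_const _
  have hle : ∫⁻ y, ENNReal.ofReal (∑ i, y i ^ 2 / (2 * (v : ℝ)))
      ∂(fdd μ (x ∘ s) : Measure (Fin k → ℝ)) ≤ ENNReal.ofReal (m * (K / (2 * v))) := by
    rw [fdd, ProbabilityMeasure.toMeasure_map, lintegral_map (by fun_prop) (measurable_proj _)]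
    simp only [proj]
    rw [← ofReal_integral_eq_lintegral_ofReal (integrable_finsetSum _ fun i _ => hint i)
      (Filter.Eventually.of_forall fun f => Finset.sum_nonneg fun _ _ => by positivity),
      integral_finsetSum _ fun i _ => hint i]
    refine ENNReal.ofReal_le_ofReal ?_
    calc _ ≤ ∑ _i : Fin k, K / (2 * (v : ℝ)) := by
          refine Finset.sum_le_sum fun i _ => ?_
          rw [integral_div]
          gcongr
          exact hK _
      _ = k * (K / (2 * v)) := by simp
      _ ≤ _ := by gcongr
  calc klDiv (fdd μ x : Measure (Fin m → ℝ)) (fdd ν x)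
      = klDiv (fdd μ ((x ∘ s) ∘ σ) : Measure (Fin m → ℝ)) (fdd ν ((x ∘ s) ∘ σ)) := by
        rw [Function.comp_assoc, hx]
    _ ≤ klDiv (fdd μ (x ∘ s) : Measure (Fin k → ℝ)) (fdd ν (x ∘ s)) :=
        klDiv_fdd_comp_le μ ν (x ∘ s) σ
    _ ≤ klDiv (fdd μ (x ∘ s) : Measure (Fin k → ℝ)) (Measure.pi fun _ => gaussianReal 0 v) :=
        h.klDiv_fdd_le hnd _ _
    _ ≤ _ := (klDiv_fdd_noisyLaw_le hg hv hμ hinj).trans (by gcongr)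

end Gaussianisation

/-! ### Minimisers of the expected divergence -/

section Optimality

theorem isOpen_setOf_injective (n : ℕ) : IsOpen {x : Fin n → ℝ | Function.Injective x} := by
  have h : {x : Fin n → ℝ | Function.Injective x} =
      ⋂ i : Fin n, ⋂ j : Fin n, {x | x i = x j → i = j} := by
    ext x
    simp [Function.Injective]
  rw [h]
  refine isOpen_iInter_of_finite fun i => isOpen_iInter_of_finite fun j => ?_
  by_cases hij : i = j
  · simp [hij]
  · simpa [hij] using isOpen_ne_fun (continuous_apply (A := fun _ => ℝ) i) (continuous_apply j)

theorem exists_injective_fin {n : ℕ} (hn : 2 ≤ n) {s t : ℝ} (hst : s ≠ t) :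
    ∃ x : Fin n → ℝ, Function.Injective x ∧ x ⟨0, by omega⟩ = s ∧ x ⟨1, by omega⟩ = t := by
  refine ⟨fun i => s + (i : ℕ) * (t - s), fun i j hij => ?_, by simp, by simp⟩
  have h := mul_right_cancel₀ (sub_ne_zero.2 hst.symm) (add_left_cancel hij)
  exact Fin.ext (by exact_mod_cast h)

variable {n : ℕ}

/-- The variational lower bound `∫ g dμ - ∫ (exp g - 1) dν` for `KL(μ, ν)`, applied to the
finite-dimensional distributions at `x`. -/
noncomputable def variationalBound (g : BoundedContinuousFunction (Fin n → ℝ) ℝ)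
    (μ ν : ProbabilityMeasure (ℝ → ℝ)) (x : Fin n → ℝ) : ℝ :=
  ∫ y, g y ∂(fdd μ x : Measure (Fin n → ℝ)) -
    ∫ y, (Real.exp (g y) - 1) ∂(fdd ν x : Measure (Fin n → ℝ))

variable (g : BoundedContinuousFunction (Fin n → ℝ) ℝ)

theorem abs_exp_sub_one_le (y : Fin n → ℝ) : |Real.exp (g y) - 1| ≤ Real.exp ‖g‖ + 1 := by
  have h1 : Real.exp (g y) ≤ Real.exp ‖g‖ :=
    Real.exp_le_exp.2 ((le_abs_self _).trans (g.norm_coe_le_norm y))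
  rw [abs_le]
  constructor <;> linarith [Real.exp_pos (g y), Real.exp_pos ‖g‖]

theorem ofReal_variationalBound_le (μ ν : ProbabilityMeasure (ℝ → ℝ)) (x : Fin n → ℝ) :
    ENNReal.ofReal (variationalBound g μ ν x) ≤
      klDiv (fdd μ x : Measure (Fin n → ℝ)) (fdd ν x) :=
  ofReal_integral_sub_le_klDiv _ _ g.continuous.measurable g.norm_coe_le_norm

theorem variationalBound_le (μ ν : ProbabilityMeasure (ℝ → ℝ)) (x : Fin n → ℝ) :
    variationalBound g μ ν x ≤ ‖g‖ + 1 := by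
  have h1 : ∫ y, g y ∂(fdd μ x : Measure (Fin n → ℝ)) ≤ ‖g‖ := by
    refine (le_abs_self _).trans ((norm_integral_le_of_norm_le_const (C := ‖g‖)
      (Filter.Eventually.of_forall g.norm_coe_le_norm)).trans (by simp))
  have h2 : 0 ≤ ∫ y, Real.exp (g y) ∂(fdd ν x : Measure (Fin n → ℝ)) :=
    integral_nonneg fun _ => Real.exp_nonneg _
  have h3 : Integrable (fun y => Real.exp (g y)) (fdd ν x : Measure (Fin n → ℝ)) :=
    Integrable.of_bound (Real.continuous_exp.comp g.continuous).aestronglyMeasurable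
      (Real.exp ‖g‖) (Filter.Eventually.of_forall fun y => by
        rw [Real.norm_eq_abs, Real.abs_exp]
        exact Real.exp_le_exp.2 ((le_abs_self _).trans (g.norm_coe_le_norm y)))
  have h4 : ∫ y, (Real.exp (g y) - 1) ∂(fdd ν x : Measure (Fin n → ℝ)) =
      ∫ y, Real.exp (g y) ∂(fdd ν x : Measure (Fin n → ℝ)) - 1 := by
    rw [integral_sub h3 (integrable_const _)]
    simp
  rw [variationalBound, h4]
  linarith

theorem continuous_variationalBound {γ π : PredictionMap} (hγ : IsContinuousAlongFdds γ)
    (hπ : IsContinuousAlongFdds π) (x : Fin n → ℝ) :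
    Continuous fun D => variationalBound g (γ D) (π D) x := by
  let e : BoundedContinuousFunction (Fin n → ℝ) ℝ :=
    BoundedContinuousFunction.ofNormedAddCommGroup (fun y => Real.exp (g y) - 1)
      ((Real.continuous_exp.comp g.continuous).sub continuous_const) (Real.exp ‖g‖ + 1)
      (abs_exp_sub_one_le g)
  exact ((ProbabilityMeasure.continuous_integral_boundedContinuousFunction g).comp (hγ n x)).sub
    ((ProbabilityMeasure.continuous_integral_boundedContinuousFunction e).comp (hπ n x))

theorem IsNoisy.continuousOn_integral_fdd {μ : ProbabilityMeasure (ℝ → ℝ)} (hμ : IsNoisy μ)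
    {φ : (Fin n → ℝ) → ℝ} (hφ : Continuous φ) {C : ℝ} (hC : ∀ y, |φ y| ≤ C) :
    ContinuousOn (fun x : Fin n → ℝ => ∫ y, φ y ∂(fdd μ x : Measure (Fin n → ℝ)))
      {x | Function.Injective x} := by
  obtain ⟨v, Ω, _, P, _, fs, fn, h, hlaw⟩ := hμ
  exact continuousOn_integral_fdd_noisyLaw h.measurable_smooth h.continuous_smooth
    (hlaw.symm.trans h.map_add) hφ hC

theorem continuousOn_variationalBound {μ ν : ProbabilityMeasure (ℝ → ℝ)} (hμ : IsNoisy μ)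
    (hν : IsNoisy ν) :
    ContinuousOn (variationalBound g μ ν) {x | Function.Injective x} :=
  (hμ.continuousOn_integral_fdd g.continuous g.norm_coe_le_norm).sub
    (hν.continuousOn_integral_fdd ((Real.continuous_exp.comp g.continuous).sub continuous_const)
      (abs_exp_sub_one_le g))

/-- The positive part of the variational bound, restricted to distinct inputs, where the
finite-dimensional distributions of a noisy process vary continuously with the inputs. -/
noncomputable def excess (μ ν : ProbabilityMeasure (ℝ → ℝ)) : (Fin n → ℝ) → ℝ :=
  {x | Function.Injective x}.indicator fun x => max (variationalBound g μ ν x) 0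

theorem measurable_excess {μ ν : ProbabilityMeasure (ℝ → ℝ)} (hμ : IsNoisy μ) (hν : IsNoisy ν) :
    Measurable (excess g μ ν) := by
  classical
  rw [excess, ← Set.piecewise_eq_indicator]
  exact ((continuousOn_variationalBound g hμ hν).sup continuousOn_const).measurable_piecewise
    continuousOn_const (isOpen_setOf_injective n).measurableSet

theorem excess_nonneg (μ ν : ProbabilityMeasure (ℝ → ℝ)) (x : Fin n → ℝ) : 0 ≤ excess g μ ν x :=
  Set.indicator_nonneg (fun _ _ => le_max_right _ _) x

theorem excess_le (μ ν : ProbabilityMeasure (ℝ → ℝ)) (x : Fin n → ℝ) :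
    excess g μ ν x ≤ ‖g‖ + 1 := by
  have h0 : 0 ≤ ‖g‖ + 1 := by positivity
  exact Set.indicator_le' (fun x _ => max_le (variationalBound_le g μ ν x) h0) (fun _ _ => h0) x

theorem ofReal_excess_le (μ ν : ProbabilityMeasure (ℝ → ℝ)) (x : Fin n → ℝ) :
    ENNReal.ofReal (excess g μ ν x) ≤ klDiv (fdd μ x : Measure (Fin n → ℝ)) (fdd ν x) := by
  by_cases hx : x ∈ {x : Fin n → ℝ | Function.Injective x}
  · rw [excess, Set.indicator_of_mem hx, ENNReal.ofReal_max, ENNReal.ofReal_zero]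
    exact max_le (ofReal_variationalBound_le g μ ν x) bot_le
  · rw [excess, Set.indicator_of_notMem hx, ENNReal.ofReal_zero]
    exact bot_le

variable {S : Set DataSet} {pD : Measure S} {px : Measure (Fin n → ℝ)} [IsProbabilityMeasure px]

theorem integrable_excess {μ ν : ProbabilityMeasure (ℝ → ℝ)} (hμ : IsNoisy μ) (hν : IsNoisy ν) :
    Integrable (excess g μ ν) px :=
  Integrable.of_bound (measurable_excess g hμ hν).aestronglyMeasurable (‖g‖ + 1)
    (Filter.Eventually.of_forall fun x => by
      rw [Real.norm_of_nonneg (excess_nonneg g μ ν x)]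
      exact excess_le g μ ν x)

theorem continuous_integral_excess {γ π : PredictionMap} (hγ : γ ∈ noisyGaussianMaps)
    (hπ : π ∈ noisyGaussianMaps) : Continuous fun D => ∫ x, excess g (γ D) (π D) x ∂px := by
  refine continuous_sigma fun k => ?_
  refine continuous_of_dominated (bound := fun _ => ‖g‖ + 1)
    (fun d => (measurable_excess g (hγ.1 _) (hπ.1 _)).aestronglyMeasurable)
    (fun d => Filter.Eventually.of_forall fun x => ?_) (integrable_const _)
    (Filter.Eventually.of_forall fun x => ?_)
  · rw [Real.norm_of_nonneg (excess_nonneg g _ _ x)]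
    exact excess_le g _ _ x
  · by_cases hx : x ∈ {x : Fin n → ℝ | Function.Injective x}
    · simp only [excess, Set.indicator_of_mem hx]
      exact ((continuous_variationalBound g hγ.2.2 hπ.2.2 x).comp continuous_sigmaMk).sup
        continuous_const
    · simp only [excess, Set.indicator_of_notMem hx]
      exact continuous_const

/-- Two inputs at a time determine means and covariances, hence `2 ≤ n`. -/
theorem eq_of_forall_variationalBound_nonpos (hn : 2 ≤ n) {μ ν : ProbabilityMeasure (ℝ → ℝ)}
    (hμ : IsGaussianLaw μ) (hν : IsGaussianLaw ν)
    (h : ∀ (g : BoundedContinuousFunction (Fin n → ℝ) ℝ) (x : Fin n → ℝ),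
      Function.Injective x → variationalBound g μ ν x ≤ 0) : μ = ν := by
  have hfdd : ∀ x : Fin n → ℝ, Function.Injective x →
      (fdd μ x : Measure (Fin n → ℝ)) = fdd ν x := fun x hx =>
    eq_of_forall_integral_le _ _ fun g => sub_nonpos.1 (h g x hx)
  have hpair : ∀ s t : ℝ, s ≠ t →
      (∫ f, f s ∂(μ : Measure (ℝ → ℝ)) = ∫ f, f s ∂(ν : Measure (ℝ → ℝ))) ∧
      (covariance (fun f : ℝ → ℝ => f s) (fun f : ℝ → ℝ => f s) (μ : Measure (ℝ → ℝ)) =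
        covariance (fun f : ℝ → ℝ => f s) (fun f : ℝ → ℝ => f s) (ν : Measure (ℝ → ℝ))) ∧
      covariance (fun f : ℝ → ℝ => f s) (fun f : ℝ → ℝ => f t) (μ : Measure (ℝ → ℝ)) =
        covariance (fun f : ℝ → ℝ => f s) (fun f : ℝ → ℝ => f t) (ν : Measure (ℝ → ℝ)) := by
    intro s t hst
    obtain ⟨x, hx, rfl, rfl⟩ := exists_injective_fin hn hst
    refine ⟨?_, ?_, ?_⟩
    · rw [← fdd_eval_integral, ← fdd_eval_integral, hfdd x hx]
    · rw [← fdd_eval_covariance, ← fdd_eval_covariance, hfdd x hx]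
    · rw [← fdd_eval_covariance, ← fdd_eval_covariance, hfdd x hx]
  refine hμ.ext hν (fun t => (hpair t (t + 1) (by simp)).1) fun s t => ?_
  by_cases hst : s = t
  · subst hst
    exact (hpair s (s + 1) (by simp)).2.1
  · exact (hpair s t hst).2.2

/-- Suppose that the integrand `F` of an objective at `π` exceeds the integrand `F₀` at `γ` by at
least the divergence of `π` from `γ` at distinct inputs. If the objective is finite at `γ` and not
larger at `π`, then `π` agrees with `γ` on `S`. Neither `F` nor `F₀` needs to be measurable, because
the divergence is replaced by the measurable lower bound `excess`; the latter is moreover continuous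
in the data and, at distinct inputs, in the inputs, so that it vanishes everywhere once it vanishes
almost everywhere. -/
theorem eq_on_of_lintegral_le [pD.IsOpenPosMeasure] [px.IsOpenPosMeasure] (hn : 2 ≤ n)
    {γ π : PredictionMap} (hγ : γ ∈ noisyGaussianMaps) (hπ : π ∈ noisyGaussianMaps)
    {F₀ F : S → (Fin n → ℝ) → ℝ≥0∞}
    (hF : ∀ D x, F₀ D x + (if Function.Injective x then
      klDiv (fdd (γ D) x : Measure (Fin n → ℝ)) (fdd (π D) x) else 0) ≤ F D x)
    (hfin : ∫⁻ D, ∫⁻ x, F₀ D x ∂px ∂pD ≠ ∞)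
    (hle : ∫⁻ D, ∫⁻ x, F D x ∂px ∂pD ≤ ∫⁻ D, ∫⁻ x, F₀ D x ∂px ∂pD) :
    ∀ D ∈ S, π D = γ D := by
  have hzero : ∀ (g : BoundedContinuousFunction (Fin n → ℝ) ℝ) (D : S) (x : Fin n → ℝ),
      Function.Injective x → variationalBound g (γ D) (π D) x ≤ 0 := by
    intro g
    let J : S → ℝ≥0∞ := fun D => ∫⁻ x, ENNReal.ofReal (excess g (γ D) (π D) x) ∂px
    have hJ : Continuous J := by
      have e : J = fun D : S => ENNReal.ofReal (∫ x, excess g (γ D) (π D) x ∂px) := by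
        ext D
        exact (ofReal_integral_eq_lintegral_ofReal (integrable_excess g (hγ.1 _) (hπ.1 _))
          (Filter.Eventually.of_forall fun x => excess_nonneg g _ _ x)).symm
      rw [e]
      exact ENNReal.continuous_ofReal.comp
        ((continuous_integral_excess g hγ hπ).comp continuous_subtype_val)
    have h1 : ∀ D : S, ∫⁻ x, F₀ D x ∂px + J D ≤ ∫⁻ x, F D x ∂px := by
      intro D
      have hm : Measurable fun x => ENNReal.ofReal (excess g (γ D) (π D) x) :=
        (measurable_excess g (hγ.1 _) (hπ.1 _)).ennreal_ofReal
      rw [← lintegral_add_right _ hm]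
      refine lintegral_mono fun x => le_trans ?_ (hF D x)
      gcongr
      split_ifs with hx
      · exact ofReal_excess_le g _ _ x
      · rw [excess, Set.indicator_of_notMem (by simpa using hx), ENNReal.ofReal_zero]
    have h2 : ∫⁻ D, ∫⁻ x, F₀ D x ∂px ∂pD + ∫⁻ D, J D ∂pD ≤ ∫⁻ D, ∫⁻ x, F₀ D x ∂px ∂pD := by
      rw [← lintegral_add_right _ hJ.measurable]
      exact (lintegral_mono h1).trans hle
    have h3 : ∫⁻ D, J D ∂pD = 0 := by
      have : ∫⁻ D, ∫⁻ x, F₀ D x ∂px ∂pD + ∫⁻ D, J D ∂pD ≤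
          ∫⁻ D, ∫⁻ x, F₀ D x ∂px ∂pD + 0 := by simpa using h2
      exact le_antisymm ((ENNReal.add_le_add_iff_left hfin).1 this) bot_le
    -- `pD` charges every nonempty open set, so a continuous function vanishing a.e. is zero
    have h4 : J = 0 := (hJ.ae_eq_iff_eq pD continuous_zero).1
      ((lintegral_eq_zero_iff hJ.measurable).1 h3)
    intro D x hx
    have hm := measurable_excess g (hγ.1 D) (hπ.1 D)
    have h5 : (fun x => ENNReal.ofReal (excess g (γ D) (π D) x)) =ᵐ[px] 0 :=
      (lintegral_eq_zero_iff hm.ennreal_ofReal).1 (congrFun h4 D)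
    have h6 : (fun x => max (variationalBound g (γ D) (π D) x) 0)
        =ᵐ[px.restrict {x | Function.Injective x}] fun _ => 0 := by
      rw [Filter.EventuallyEq, ae_restrict_iff' (isOpen_setOf_injective n).measurableSet]
      filter_upwards [h5] with y hy hyi
      have : ENNReal.ofReal (excess g (γ D) (π D) y) = 0 := hy
      rw [excess, Set.indicator_of_mem hyi, ENNReal.ofReal_eq_zero] at this
      exact le_antisymm this (le_max_right _ _)
    have h7 := Measure.eqOn_open_of_ae_eq h6 (isOpen_setOf_injective n)
      ((continuousOn_variationalBound g (hγ.1 D) (hπ.1 D)).sup continuousOn_const)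
      continuousOn_const hx
    exact max_eq_right_iff.1 h7
  exact fun D hD => (eq_of_forall_variationalBound_nonpos hn (hγ.2.1 D) (hπ.2.1 D)
    fun g x hx => hzero g ⟨D, hD⟩ x hx).symm

end Optimality

/-! ### The Gaussianised posterior prediction map is the unique minimiser -/

theorem mainTheorem1 {Ω : Type*} [MeasurableSpace Ω] (P : Measure Ω) [IsProbabilityMeasure P]
    (fs fn : ℝ → Ω → ℝ) (v : ℝ≥0) (hf : IsNoisyDecomposition P fs fn v)
    (hfs : IsHolderInLp P fs)
    (hf2 : (⨆ t : ℝ, ∫⁻ ω, ENNReal.ofReal ((fs t ω + fn t ω) ^ 2) ∂P) < ∞)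
    (S : Set DataSet) (hSo : IsOpen S) (hSb : IsBoundedCollection S)
    (pD : Measure S) [IsProbabilityMeasure pD] [pD.IsOpenPosMeasure]
    (n : ℕ) (hn : 2 ≤ n)
    (px : Measure (Fin n → ℝ)) [IsProbabilityMeasure px] [px.IsOpenPosMeasure] :
    ∃ γ : PredictionMap,
      (∀ D ν, IsGaussianisation (posteriorPredictionMap hf D) ν ↔ ν = γ D) ∧
      γ ∈ noisyGaussianMaps ∧
      (∀ D, IsNoisyWith (γ D) v) ∧
      (⨆ D ∈ S, ⨆ t : ℝ, ∫⁻ f, ENNReal.ofReal (f t ^ 2) ∂(γ D : Measure (ℝ → ℝ))) < ∞ ∧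
      klObjective pD px (posteriorPredictionMap hf) γ < ∞ ∧
      (∀ π ∈ noisyGaussianMaps,
        IsMinOn (klObjective pD px (posteriorPredictionMap hf)) noisyGaussianMaps π ↔
          ∀ D ∈ S, π D = γ D) ∧
      (∀ π ∈ noisyGaussianMaps,
        IsMinOn (gaussianObjective pD px (posteriorPredictionMap hf)) noisyGaussianMaps π ↔
          ∀ D ∈ S, π D = γ D) := by
  have hm := hf.measurable_smooth
  obtain ⟨M, -, hM⟩ := hf.exists_sq_smooth_le hf2
  have h2 : ∀ t, MemLp (fs t) 2 P := fun t => (hM t).1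
  obtain ⟨ε, hε, hεS⟩ := exists_le_evidence (v := v) hm hM hSb
  choose γ hγ hγv using exists_isGaussianisation_posteriorPredictionMap hf hfs h2
  have hγG : γ ∈ noisyGaussianMaps := ⟨fun D => ⟨v, hγv D⟩, fun D => (hγ D).gaussian,
    isContinuousAlongFdds_of_isGaussianisation hf h2 hγ⟩
  have hprob := fun D => isProbabilityMeasure_smoothPosterior (P := P) hm hf.var_pos D
  have hnd : ∀ D (k : ℕ) (x : Fin k → ℝ), Function.Injective x →
      IsNondegenerate (fdd (posteriorPredictionMap hf D) x : Measure (Fin k → ℝ)) := by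
    intro D k x hx
    have := hprob D
    exact isNondegenerate_fdd_noisyLaw hm (memLp_smoothPosterior hm hf.var_pos h2 D) hf.var_pos
      (posteriorPredictionMap_eq_noisyLaw hf D) hx
  have hK : ∀ D ∈ S, ∀ t, ∫ f, f t ^ 2 ∂(posteriorPredictionMap hf D : Measure (ℝ → ℝ)) ≤
      ε⁻¹ * M + v := fun D hD t => integral_sq_posteriorPredictionMap_le hf hM hε (hεS D hD) t
  -- uniform in `D ∈ S` and in the inputs, which is why no integrability condition on `px` is needed
  have hKL : ∀ D ∈ S, ∀ x : Fin n → ℝ,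
      klDiv (fdd (posteriorPredictionMap hf D) x : Measure (Fin n → ℝ)) (fdd (γ D) x) ≤
        ENNReal.ofReal (n * ((ε⁻¹ * M + v) / (2 * v))) + 1 := by
    intro D hD x
    have := hprob D
    exact (hγ D).klDiv_fdd_le_of_integral_sq_le hm hf.var_pos
      (posteriorPredictionMap_eq_noisyLaw hf D) (hnd D) (hK D hD) x
  have hB : ENNReal.ofReal (n * ((ε⁻¹ * M + v) / (2 * v))) + 1 < ∞ :=
    ENNReal.add_lt_top.2 ⟨ENNReal.ofReal_lt_top, ENNReal.one_lt_top⟩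
  have hKLfin : ∀ D ∈ S, ∀ x : Fin n → ℝ,
      klDiv (fdd (posteriorPredictionMap hf D) x : Measure (Fin n → ℝ)) (fdd (γ D) x) < ∞ :=
    fun D hD x => (hKL D hD x).trans_lt hB
  have hobj : klObjective pD px (posteriorPredictionMap hf) γ < ∞ := by
    calc klObjective pD px (posteriorPredictionMap hf) γ
        ≤ ∫⁻ _ : S, ∫⁻ _ : Fin n → ℝ,
            (ENNReal.ofReal (n * ((ε⁻¹ * M + v) / (2 * v))) + 1) ∂px ∂pD :=
          lintegral_mono fun D => lintegral_mono fun x => hKL D D.2 x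
      _ < ∞ := by simpa only [lintegral_const, measure_univ, mul_one] using hB
  refine ⟨γ, fun D ν => ⟨fun hν => hν.unique (hγ D), fun hν => hν ▸ hγ D⟩, hγG, hγv, ?_, hobj,
    fun π hπ => ⟨fun hmin => ?_, fun heq π' hπ' => ?_⟩,
    fun π hπ => ⟨fun hmin => ?_, fun heq π' hπ' => ?_⟩⟩
  · refine (iSup₂_le fun D hD => iSup_le fun t => ?_ :
      _ ≤ ENNReal.ofReal (ε⁻¹ * M + v)).trans_lt ENNReal.ofReal_lt_top
    rw [← ofReal_integral_eq_lintegral_ofReal ((hγ D).gaussian.memLp t).integrable_sq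
      (Filter.Eventually.of_forall fun _ => sq_nonneg _), (hγ D).integral_sq]
    exact ENNReal.ofReal_le_ofReal (hK D hD t)
  · refine eq_on_of_lintegral_le hn hγG hπ (fun D x => ?_) hobj.ne (hmin hγG)
    have := (hπ.2.1 D).isGaussian_fdd x
    split_ifs with hx
    · exact (hγ D).klDiv_add_klDiv_le (hnd D) hx _
    · rw [add_zero]
      exact (hγ D).klDiv_fdd_le (hnd D) x _
  · refine lintegral_mono fun D => lintegral_mono fun x => ?_
    have := (hπ'.2.1 D).isGaussian_fdd x
    rw [heq D D.2]
    exact (hγ D).klDiv_fdd_le (hnd D) x _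
  · -- the Gaussian divergence of `γ` vanishes, so here the optimal value is `0`
    have hγ0 : gaussianObjective pD px (posteriorPredictionMap hf) γ = 0 := by
      have h0 : ∀ (D : S) (x : Fin n → ℝ),
          gaussianDiv (fdd (posteriorPredictionMap hf D) x : Measure (Fin n → ℝ)) (fdd (γ D) x) =
            0 := fun D x => by
        rw [(hγ D).gaussianDiv_fdd (hnd D) (hKLfin D D.2 x), tsub_self]
      simp only [gaussianObjective, h0, lintegral_zero]
    refine eq_on_of_lintegral_le (F₀ := fun _ _ => 0) hn hγG hπ (fun D x => ?_) (by simp)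
      ((hmin hγG).trans (hγ0.trans_le bot_le))
    rw [zero_add]
    split_ifs with hx
    · have := (hπ.2.1 D).isGaussian_fdd x
      rw [(hγ D).gaussianDiv_fdd (hnd D) (hKLfin D D.2 x)]
      exact ENNReal.le_sub_of_add_le_left (hKLfin D D.2 x).ne
        ((hγ D).klDiv_add_klDiv_le (hnd D) hx _)
    · exact bot_le
  · refine lintegral_mono fun D => lintegral_mono fun x => ?_
    rw [heq D D.2, (hγ D).gaussianDiv_fdd (hnd D) (hKLfin D D.2 x), tsub_self]
    exact bot_le
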